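/- Let $G=(V,E)$ be a finite undirected graph with $V\neq\emptyset$ (parallel edges and loops allowed). For $S\subseteq V$ let $\delta(S)\subseteq E$ be the set of edges with exactly one end in $S$; a 2-edge cut of $G$ is a set $\delta(S)$ with $|\delta(S)|=2$. Let $$\mathrm{Subtour}(G)=\{x\in\mathbb R^E:\ x_e\ge 0\ (e\in E),\ \ \textstyle\sum_{e\in\delta(S)}x_e\ge 2\ (\emptyset\ne S\subsetneq V)\}.$$ A connector of $G$ is a multiset $F$ of edges of $G$ that contains each edge at most twice and such that the multigraph $(V,F)$ is connected; $\chi^F(e)\in\{0,1,2\}$ denotes the multiplicity of $e$ in $F$. Theorem 4.4. There is an algorithm that, given $G$ and $x^*\in\mathrm{Subtour}(G)$, finds in time polynomial in the size of $G$ a family of connectors $F_1,\dots,F_\ell$ of $G$ and multipliers $\lambda_1,\dots,\lambda_\ell$ such that (a) $\lambda_i>0$ for all $i$, $\sum_{i=1}^{\ell}\lambda_i=1$, and $x^*_e\ \ge\ \sum_{i=1}^{\ell}\lambda_i\,\chi^{F_i}(e)$ for every $e\in E$; and (b) every $F_i$ crosses every 2-edge cut of $G$ an even number of times: $\sum_{e\in\delta(S)}\chi^{F_i}(e)$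 is even for all $1\le i\le\ell$ and all $S\subseteq V$ with $|\delta(S)|=2$. Here the time is the number of steps of a random access machine that performs exact arithmetic operations and comparisons on real numbers at unit cost; it is at most a polynomial in $|V|+|E|$. The integers that occur have binary length polynomial in $|V|+|E|$, and if $x^*$ is rational, then all numbers that occur are rational, with binary length polynomial in $|V|+|E|$ and the binary length of the entries of $x^*$. -/

import Mathlib

/-! ### A random access machine with exact real arithmetic

Programs are written in a small imperative language.  The memory consists of countably many
unbounded arrays of natural numbers and countably many unbounded arrays of real numbers.  The real
cells can only be accessed through the field operations and comparisons; there is no rounding and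
no conversion from reals to integers.  A program is a finite, fixed object, so the expressions in
it have constant size and each elementary command (assignment or test) is charged one step.
-/

namespace RAM

/-- Memory: `ints a i` is the `i`-th cell of the `a`-th integer array, `reals a i` is the `i`-th
cell of the `a`-th real array. -/
structure State where
  ints : ℕ → ℕ → ℕ
  reals : ℕ → ℕ → ℝ

/-- Writing a natural number into a cell. -/
def State.setInt (s : State) (a i v : ℕ) : State :=
  { s with ints := Function.update s.ints a (Function.update (s.ints a) i v) }

/-- Writing a real number into a cell. -/
def State.setReal (s : State) (a i : ℕ) (v : ℝ) : State :=
  { s with reals := Function.update s.reals a (Function.update (s.reals a) i v) }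

/-- Integer expressions. -/
inductive IntExpr where
  | const (k : ℕ)
  | get (a : ℕ) (i : IntExpr)
  | add (e f : IntExpr)
  | sub (e f : IntExpr)
  | mul (e f : IntExpr)
  | div (e f : IntExpr)
  | mod (e f : IntExpr)

/-- Value of an integer expression (truncated subtraction, rounded-down division). -/
def IntExpr.eval (s : State) : IntExpr → ℕ
  | const k => k
  | get a i => s.ints a (i.eval s)
  | add e f => e.eval s + f.eval s
  | sub e f => e.eval s - f.eval s
  | mul e f => e.eval s * f.eval s
  | div e f => e.eval s / f.eval s
  | mod e f => e.eval s % f.eval s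

/-- Real expressions. -/
inductive RealExpr where
  | ofInt (e : IntExpr)
  | get (a : ℕ) (i : IntExpr)
  | add (e f : RealExpr)
  | sub (e f : RealExpr)
  | mul (e f : RealExpr)
  | div (e f : RealExpr)

/-- Value of a real expression (division by zero returns zero). -/
noncomputable def RealExpr.eval (s : State) : RealExpr → ℝ
  | ofInt e => (e.eval s : ℝ)
  | get a i => s.reals a (i.eval s)
  | add e f => e.eval s + f.eval s
  | sub e f => e.eval s - f.eval s
  | mul e f => e.eval s * f.eval s
  | div e f => e.eval s / f.eval s

/-- Tests. -/
inductive Test where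
  | ltInt (e f : IntExpr)
  | ltReal (e f : RealExpr)
  | not (b : Test)
  | and (b c : Test)

/-- Truth of a test in a state. -/
def Test.holds (s : State) : Test → Prop
  | ltInt e f => e.eval s < f.eval s
  | ltReal e f => e.eval s < f.eval s
  | not b => ¬ b.holds s
  | and b c => b.holds s ∧ c.holds s

/-- Programs. `setInt a i v` is the assignment `a[i] := v` for an integer array, `setReal` the same
for a real array, `cond b P Q` is `if b then P else Q`, and `loop b P` is `while b do P`. -/
inductive Program where
  | setInt (a : ℕ) (i v : IntExpr)
  | setReal (a : ℕ) (i : IntExpr) (v : RealExpr)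
  | seq (P Q : Program)
  | cond (b : Test) (P Q : Program)
  | loop (b : Test) (P : Program)

/-- `Exec B R P s s' t`: started in the state `s`, the program `P` halts in the state `s'` after
exactly `t` steps, every natural number written during the run has at most `B` binary digits, and
every real number written during the run satisfies `R`. -/
inductive Exec (B : ℕ) (R : ℝ → Prop) : Program → State → State → ℕ → Prop where
  | setInt (s : State) (a : ℕ) (i v : IntExpr) (h : (v.eval s).size ≤ B) :
      Exec B R (.setInt a i v) s (s.setInt a (i.eval s) (v.eval s)) 1
  | setReal (s : State) (a : ℕ) (i : IntExpr) (v : RealExpr) (h : R (v.eval s)) :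
      Exec B R (.setReal a i v) s (s.setReal a (i.eval s) (v.eval s)) 1
  | seq {P Q : Program} {s s₁ s₂ : State} {t₁ t₂ : ℕ}
      (h₁ : Exec B R P s s₁ t₁) (h₂ : Exec B R Q s₁ s₂ t₂) :
      Exec B R (.seq P Q) s s₂ (t₁ + t₂)
  | condTrue {b : Test} {P Q : Program} {s s₁ : State} {t : ℕ}
      (hb : b.holds s) (h : Exec B R P s s₁ t) :
      Exec B R (.cond b P Q) s s₁ (t + 1)
  | condFalse {b : Test} {P Q : Program} {s s₁ : State} {t : ℕ}
      (hb : ¬ b.holds s) (h : Exec B R Q s s₁ t) :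
      Exec B R (.cond b P Q) s s₁ (t + 1)
  | loopDone {b : Test} {P : Program} {s : State} (hb : ¬ b.holds s) :
      Exec B R (.loop b P) s s 1
  | loopStep {b : Test} {P : Program} {s s₁ s₂ : State} {t₁ t₂ : ℕ}
      (hb : b.holds s) (h₁ : Exec B R P s s₁ t₁) (h₂ : Exec B R (.loop b P) s₁ s₂ t₂) :
      Exec B R (.loop b P) s s₂ (t₁ + t₂ + 1)

end RAM

/-- The real number `r` is rational, and in lowest terms its numerator and its denominator have at
most `b` binary digits each. -/
def HasBitSize (r : ℝ) (b : ℕ) : Prop :=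
  ∃ q : ℚ, (q : ℝ) = r ∧ q.num.natAbs.size ≤ b ∧ q.den.size ≤ b

/-! ### Graphs, the subtour polyhedron, connectors -/

/-- A finite undirected graph with vertices `0, …, n - 1` and edges `0, …, m - 1`, where the edge
`e` joins `fst e` and `snd e`.  Parallel edges (and loops) are permitted. -/
structure EdgeListGraph where
  n : ℕ
  m : ℕ
  fst : Fin m → Fin n
  snd : Fin m → Fin n

namespace EdgeListGraph

/-- The set `δ(S)` of the edges with exactly one end in `S`. -/
def cut (G : EdgeListGraph) (S : Finset (Fin G.n)) : Finset (Fin G.m) :=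
  Finset.univ.filter fun e => ¬ (G.fst e ∈ S ↔ G.snd e ∈ S)

/-- The subtour polyhedron: `x ≥ 0` and `x(δ(S)) ≥ 2` for all `∅ ≠ S ≠ V`. -/
def subtour (G : EdgeListGraph) : Set (Fin G.m → ℝ) :=
  {x | (∀ e, 0 ≤ x e) ∧
    ∀ S : Finset (Fin G.n), S.Nonempty → S ≠ Finset.univ → 2 ≤ ∑ e ∈ G.cut S, x e}

/-- The simple graph on all vertices of `G` in which two distinct vertices are adjacent when some
edge with positive multiplicity in `F` joins them. -/
def supportGraph (G : EdgeListGraph) (F : Fin G.m → ℕ) : SimpleGraph (Fin G.n) :=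
  SimpleGraph.fromRel fun u v => ∃ e, 0 < F e ∧ G.fst e = u ∧ G.snd e = v

/-- A connector is a multiset of edges, given by its multiplicities `F`, that contains each edge at
most twice and forms a connected multigraph on the whole vertex set. -/
def IsConnector (G : EdgeListGraph) (F : Fin G.m → ℕ) : Prop :=
  (∀ e, F e ≤ 2) ∧ (G.supportGraph F).Connected

/-- The memory at the start: integer array `0` holds `n` and `m`, integer arrays `1` and `2` hold
the ends of the edges, real array `0` holds `x`, and all other cells are zero. -/
def input (G : EdgeListGraph) (x : Fin G.m → ℝ) : RAM.State where
  ints a i :=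
    if a = 0 then (if i = 0 then G.n else if i = 1 then G.m else 0)
    else if h : i < G.m then
      (if a = 1 then (G.fst ⟨i, h⟩ : ℕ) else if a = 2 then (G.snd ⟨i, h⟩ : ℕ) else 0)
    else 0
  reals a i := if h : i < G.m then (if a = 0 then x ⟨i, h⟩ else 0) else 0

/-- The memory `s` holds the family `F` of `ℓ` edge multisets and the multipliers `lam`: cell `0`
of integer array `3` holds `ℓ`, integer array `4` holds the `ℓ × m` table `F` row by row, and real
array `1` holds `lam`. -/
def IsOutput (G : EdgeListGraph) (s : RAM.State) (ℓ : ℕ) (F : Fin ℓ → Fin G.m → ℕ)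
    (lam : Fin ℓ → ℝ) : Prop :=
  s.ints 3 0 = ℓ ∧ (∀ (i : Fin ℓ) (e : Fin G.m), s.ints 4 (i * G.m + e) = F i e) ∧
    ∀ i : Fin ℓ, s.reals 1 i = lam i

end EdgeListGraph

/-! The theorem splits into a rounding argument, a decomposition, and a cost analysis.

Rounding. Suppose that there are connected spanning edge sets `U_i` with weights `λ_i` summing to 1
such that every edge `e` has total weight exactly `min(1, x_e)`. Call `f` critical for `e` if some
cut contains `e` and lies inside `{e, f}`. In each `U_i`, double those `e ∈ U_i` that are bridges or
have a critical `f ∉ U_i`. Parity: on a 2-edge cut `{g, h}`, an edge whose partner is missing is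
doubled. If both are present, taking the symmetric difference with this cut turns a reason for
doubling `g` into one for doubling `h`. Cost: a bridge has `x_e ≥ 2`. Otherwise critical edges `f,
f'` of `e` are critical for each other, so `x_f + x_f' ≥ 2` and at most one critical `f` has `x_f <
1`; all others lie in every `U_i`. Hence `e` is doubled only where this `f` is absent, which costs
at most `1 - x_f`, and `1 + (1 - x_f) ≤ x_e` because `x_e + x_f ≥ 2`. This is `even_mult` and
`sum_mult_le`.

Decomposition. Adding up parallel edges gives weights on pairs of vertices for which every cut
weighs at least 2. The vertices `n-1, n-2, ...` are eliminated by fractional splitting off: weight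
is moved from pairs `uk`, `wk` to `uw` as long as all cuts other than the star of `k` stay at least
2. When no pair at `k` admits more, uncrossing of tight sets shows that `k` can be deleted with
whatever weight is left at it (`full_of_blocked`). How much can be split off is found by a minimum
cut computation with maximum adjacency orderings that start in `k`.

The eliminations are then undone, starting from the one-vertex graph with weight 1. Members of the
family that use `uw` beyond its weight before the elimination of `k` replace it by `uk`, `wk`, or
both, as connectivity requires. Each replacement creates at most one superfluous pair at `k`, since
the first pair at `k` is needed anyway. The total weight rerouted is at most half of the degree `D`
of `k`, and `D ≥ 2`. So if all capacity at `k` were used and some members still missed `k`, then `D`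
would be less than `1 + D/2`, contradicting `D ≥ 2`; hence attaching members to `k` within the
capacities succeeds for all of them (`AttachPhase.levelPhase`). Finally pairs are replaced by actual
edges, and each edge is filled up to the weight `min(1, x_e)` (`EdgePhase.step`).

Cost. The algorithm is written with counting loops whose bounds depend on `n` and `m` only, which
gives polynomial time by inspection of the syntax. Real numbers are only added, subtracted and
halved, and integers are never multiplied in stored values, so every step lengthens numbers by a
bounded number of digits; the denominators always divide a power of 2 times the product of the input
denominators. Both facts are one structural induction, `exec_compile`. -/

namespace RAM

/-! ### Counting programs: bounded loops only -/

/-- Statements whose only loops are counting loops: `iter a N P` runs `P` for the values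
`0, …, N - 1` of the counter in cell `0` of the integer array `a`. -/
inductive Stmt where
  | setInt (a : ℕ) (i v : IntExpr)
  | setReal (a : ℕ) (i : IntExpr) (v : RealExpr)
  | seq (P Q : Stmt)
  | cond (b : Test) (P Q : Stmt)
  | iter (a : ℕ) (N : IntExpr) (P : Stmt)

infixr:60 " ;; " => Stmt.seq

/-- The state after `i` rounds of a counting loop with body `f` and counter `a`. -/
def loopState (a : ℕ) (f : State → State) (s : State) : ℕ → State
  | 0 => s.setInt a 0 0
  | i + 1 => (f (loopState a f s i)).setInt a 0 (i + 1)

namespace Stmt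

/-- Translation into the programming language of the machine. -/
def compile : Stmt → Program
  | setInt a i v => .setInt a i v
  | setReal a i v => .setReal a i v
  | seq P Q => .seq P.compile Q.compile
  | cond b P Q => .cond b P.compile Q.compile
  | iter a N P => .seq (.setInt a (.const 0) (.const 0))
      (.loop (.ltInt (.get a (.const 0)) N)
        (.seq P.compile (.setInt a (.const 0) (.add (.get a (.const 0)) (.const 1)))))

open Classical in
/-- The effect of a statement on the memory. -/
noncomputable def run : Stmt → State → State
  | setInt a i v, s => s.setInt a (i.eval s) (v.eval s)
  | setReal a i v, s => s.setReal a (i.eval s) (v.eval s)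
  | seq P Q, s => Q.run (P.run s)
  | cond b P Q, s => if b.holds s then P.run s else Q.run s
  | iter a N P, s => loopState a P.run s (N.eval s)

/-- Does the statement write into the integer array `b`? -/
def writesInt : Stmt → ℕ → Bool
  | setInt a _ _, b => a == b
  | setReal _ _ _, _ => false
  | seq P Q, b => P.writesInt b || Q.writesInt b
  | cond _ P Q, b => P.writesInt b || Q.writesInt b
  | iter a _ P, b => a == b || P.writesInt b

/-- Does the statement write into the real array `b`? -/
def writesReal : Stmt → ℕ → Bool
  | setInt _ _ _, _ => false
  | setReal a _ _, b => a == b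
  | seq P Q, b => P.writesReal b || Q.writesReal b
  | cond _ P Q, b => P.writesReal b || Q.writesReal b
  | iter _ _ P, b => P.writesReal b

end Stmt

/-- Number of binary digits that the value of the expression may have more than the cells in it
(at least `100` if there is no such bound). -/
def IntExpr.growth : IntExpr → ℕ
  | const k => k.size
  | get _ _ => 0
  | add e f => e.growth + f.growth + 1
  | sub e _ => e.growth
  | mul _ _ => 100
  | div e _ => e.growth
  | mod e _ => e.growth

/-- Number of binary digits that the value of the expression may have more than the cells in it
(at least `100` if there is no such bound). -/
def RealExpr.growth : RealExpr → ℕ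
  | ofInt e => e.growth
  | get _ _ => 0
  | add e f => e.growth + f.growth + 1
  | sub e f => e.growth + f.growth + 1
  | mul _ _ => 100
  | div e (ofInt (.const 2)) => e.growth + 1
  | div _ _ => 100

/-- The expression reads the integer array `0` only. -/
def IntExpr.isStatic : IntExpr → Bool
  | const _ => true
  | get a i => a == 0 && i.isStatic
  | add e f => e.isStatic && f.isStatic
  | sub e f => e.isStatic && f.isStatic
  | mul e f => e.isStatic && f.isStatic
  | div e f => e.isStatic && f.isStatic
  | mod e f => e.isStatic && f.isStatic

/-- A polynomial bound for the value of a static expression, in terms of a bound for the cells. -/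
noncomputable def IntExpr.poly : IntExpr → Polynomial ℕ
  | const k => Polynomial.C k
  | get _ _ => Polynomial.X
  | add e f => e.poly + f.poly
  | sub e _ => e.poly
  | mul e f => e.poly * f.poly
  | div e _ => e.poly
  | mod e _ => e.poly

namespace Stmt

/-- A polynomial bound for the number of steps. -/
noncomputable def costPoly : Stmt → Polynomial ℕ
  | setInt _ _ _ => 1
  | setReal _ _ _ => 1
  | seq P Q => P.costPoly + Q.costPoly
  | cond _ P Q => P.costPoly + Q.costPoly + 1
  | iter _ N P => N.poly * (P.costPoly + 2) + 2

/-- The syntactic conditions under which running times and lengths of numbers are polynomially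
bounded. -/
def wf : Stmt → Bool
  -- Only the stored value is restricted. Indices may contain products, because an execution bounds
  -- what is written and not where. Integer array `0` is never written, so loop bounds that read
  -- nothing else are constant during the run. The constant 4 is attained by the assignment of `(2 -
  -- c) / 2` when splitting off.
  | setInt a _ v => a != 0 && decide (v.growth ≤ 4)
  | setReal _ _ v => decide (v.growth ≤ 4)
  | seq P Q => P.wf && Q.wf
  | cond _ P Q => P.wf && Q.wf
  | iter a N P => a != 0 && !P.writesInt a && N.isStatic && P.wf

end Stmt

@[simp] theorem ints_setInt (s : State) (a i v b j : ℕ) :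
    (s.setInt a i v).ints b j = if b = a ∧ j = i then v else s.ints b j := by
  unfold State.setInt
  by_cases h : b = a
  · subst h; by_cases h2 : j = i <;> simp [Function.update, h2]
  · simp [Function.update, h]

@[simp] theorem reals_setInt (s : State) (a i v : ℕ) : (s.setInt a i v).reals = s.reals := rfl

@[simp] theorem ints_setReal (s : State) (a i : ℕ) (v : ℝ) : (s.setReal a i v).ints = s.ints := rfl

@[simp] theorem reals_setReal (s : State) (a i : ℕ) (v : ℝ) (b j : ℕ) :
    (s.setReal a i v).reals b j = if b = a ∧ j = i then v else s.reals b j := by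
  unfold State.setReal
  by_cases h : b = a
  · subst h; by_cases h2 : j = i <;> simp [Function.update, h2]
  · simp [Function.update, h]

theorem ints_setInt_ne (s : State) {a b : ℕ} (h : b ≠ a) (i v : ℕ) :
    (s.setInt a i v).ints b = s.ints b := by
  funext j; simp [h]

theorem reals_setReal_ne (s : State) {a b : ℕ} (h : b ≠ a) (i : ℕ) (v : ℝ) :
    (s.setReal a i v).reals b = s.reals b := by
  funext j; simp [h]

namespace Stmt

/-- The frame rule. Its hypothesis is computed from the syntax, so that facts about untouched arrays
reduce to evaluation. -/
theorem run_ints (P : Stmt) {b : ℕ} (h : P.writesInt b = false) (s : State) :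
    (P.run s).ints b = s.ints b := by
  induction P generalizing s with
  | setInt a i v =>
    simp only [writesInt, beq_eq_false_iff_ne, ne_eq] at h
    exact ints_setInt_ne _ (Ne.symm h) _ _
  | setReal a i v => rfl
  | seq P Q hP hQ =>
    simp only [writesInt, Bool.or_eq_false_iff] at h
    simp only [run]
    rw [hQ h.2, hP h.1]
  | cond c P Q hP hQ =>
    simp only [writesInt, Bool.or_eq_false_iff] at h
    simp only [run]
    split_ifs
    · exact hP h.1 s
    · exact hQ h.2 s
  | iter a N P hP =>
    simp only [writesInt, Bool.or_eq_false_iff, beq_eq_false_iff_ne, ne_eq] at h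
    simp only [run]
    generalize N.eval s = M
    induction M with
    | zero => exact ints_setInt_ne _ (Ne.symm h.1) _ _
    | succ M ih =>
      simp only [loopState]
      rw [ints_setInt_ne _ (Ne.symm h.1), hP h.2, ih]

theorem run_reals (P : Stmt) {b : ℕ} (h : P.writesReal b = false) (s : State) :
    (P.run s).reals b = s.reals b := by
  induction P generalizing s with
  | setInt a i v => rfl
  | setReal a i v =>
    simp only [writesReal, beq_eq_false_iff_ne, ne_eq] at h
    exact reals_setReal_ne _ (Ne.symm h) _ _
  | seq P Q hP hQ =>
    simp only [writesReal, Bool.or_eq_false_iff] at h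
    simp only [run]
    rw [hQ h.2, hP h.1]
  | cond c P Q hP hQ =>
    simp only [writesReal, Bool.or_eq_false_iff] at h
    simp only [run]
    split_ifs
    · exact hP h.1 s
    · exact hQ h.2 s
  | iter a N P hP =>
    simp only [writesReal] at h
    simp only [run]
    generalize N.eval s = M
    induction M with
    | zero => rfl
    | succ M ih =>
      simp only [loopState]
      rw [reals_setInt, hP h, ih]

/-- The invariant rule for counting loops. -/
theorem run_iter {a : ℕ} {N : IntExpr} {P : Stmt} {s : State} (I : ℕ → State → Prop)
    (h0 : I 0 (s.setInt a 0 0))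
    (hs : ∀ i t, i < N.eval s → t.ints a 0 = i →
      (∀ b, b ≠ a → P.writesInt b = false → t.ints b = s.ints b) →
      (∀ b, P.writesReal b = false → t.reals b = s.reals b) →
      I i t → I (i + 1) ((P.run t).setInt a 0 (i + 1))) :
    I (N.eval s) ((iter a N P).run s) := by
  have key : ∀ i, i ≤ N.eval s → (loopState a P.run s i).ints a 0 = i ∧
      (∀ b, b ≠ a → P.writesInt b = false → (loopState a P.run s i).ints b = s.ints b) ∧
      (∀ b, P.writesReal b = false → (loopState a P.run s i).reals b = s.reals b) ∧
      I i (loopState a P.run s i) := by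
    intro i
    induction i with
    | zero =>
      intro _
      exact ⟨by simp [loopState], fun b hb _ => ints_setInt_ne _ hb _ _, fun b _ => rfl, h0⟩
    | succ i ih =>
      intro hi
      obtain ⟨h1, h2, h3, h4⟩ := ih (by omega)
      refine ⟨by simp [loopState], fun b hb hw => ?_, fun b hw => ?_, hs i _ (by omega) h1 h2 h3 h4⟩
      · simp only [loopState]
        rw [ints_setInt_ne _ hb, run_ints P hw, h2 b hb hw]
      · simp only [loopState]
        rw [reals_setInt, run_reals P hw, h3 b hw]
  exact (key _ le_rfl).2.2.2

end Stmt

/-! ### Running times and lengths of numbers -/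

theorem IntExpr.eval_static {e : IntExpr} (h : e.isStatic) {s t : State}
    (hst : s.ints 0 = t.ints 0) : e.eval s = e.eval t := by
  induction e with
  | const k => rfl
  | get a i hi =>
    simp only [isStatic, Bool.and_eq_true, beq_iff_eq] at h
    simp [eval, h.1, hi h.2, hst]
  | _ e f he hf =>
    simp only [isStatic, Bool.and_eq_true] at h
    simp [eval, he h.1, hf h.2]

theorem IntExpr.eval_le_poly {e : IntExpr} (h : e.isStatic) {s : State} {n : ℕ}
    (hs : ∀ i, s.ints 0 i ≤ n) : e.eval s ≤ e.poly.eval n := by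
  induction e with
  | const k => simp [eval, poly]
  | get a i hi =>
    simp only [isStatic, Bool.and_eq_true, beq_iff_eq] at h
    simpa [eval, poly, h.1] using hs _
  | add e f he hf =>
    simp only [isStatic, Bool.and_eq_true] at h
    simpa [eval, poly] using add_le_add (he h.1) (hf h.2)
  | sub e f he hf =>
    simp only [isStatic, Bool.and_eq_true] at h
    exact (Nat.sub_le _ _).trans (he h.1)
  | mul e f he hf =>
    simp only [isStatic, Bool.and_eq_true] at h
    simpa [eval, poly] using Nat.mul_le_mul (he h.1) (hf h.2)
  | div e f he hf =>
    simp only [isStatic, Bool.and_eq_true] at h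
    exact (Nat.div_le_self _ _).trans (he h.1)
  | mod e f he hf =>
    simp only [isStatic, Bool.and_eq_true] at h
    exact (Nat.mod_le _ _).trans (he h.1)

theorem IntExpr.eval_lt {e : IntExpr} (h : e.growth ≤ 4) {s : State} {k : ℕ}
    (hs : ∀ a i, s.ints a i < 2 ^ k) : e.eval s < 2 ^ (k + e.growth) := by
  induction e with
  | const c =>
    exact (Nat.lt_size_self c).trans_le (Nat.pow_le_pow_right (by norm_num) (by simp [growth]))
  | get a i hi => exact hs _ _
  | add e f he hf =>
    simp only [growth] at h
    have h1 := he (by omega)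
    have h2 := hf (by omega)
    simp only [eval, growth]
    have h3 : 2 ^ (k + e.growth) ≤ 2 ^ (k + (e.growth + f.growth)) :=
      Nat.pow_le_pow_right (by norm_num) (by omega)
    have h4 : 2 ^ (k + f.growth) ≤ 2 ^ (k + (e.growth + f.growth)) :=
      Nat.pow_le_pow_right (by norm_num) (by omega)
    rw [← add_assoc, pow_succ]
    omega
  | sub e f he hf => exact (Nat.sub_le _ _).trans_lt (he h)
  | mul e f he hf => simp [growth] at h
  | div e f he hf => exact (Nat.div_le_self _ _).trans_lt (he h)
  | mod e f he hf => exact (Nat.mod_le _ _).trans_lt (he h)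

/-- A graded family of sets of real numbers that contains what can be computed from numbers of
lower grade by an addition, a subtraction or a halving. -/
structure Graded (Q : ℕ → ℝ → Prop) : Prop where
  mono : ∀ {k l r}, k ≤ l → Q k r → Q l r
  add : ∀ {k r r'}, Q k r → Q k r' → Q (k + 1) (r + r')
  sub : ∀ {k r r'}, Q k r → Q k r' → Q (k + 1) (r - r')
  half : ∀ {k r}, Q k r → Q (k + 1) (r / 2)
  nat : ∀ {k c : ℕ}, c < 2 ^ k → Q k c

/-- Halving is the only admissible division; this keeps all denominators under control. -/
theorem RealExpr.eq_two_of_growth_div {e f : RealExpr} (h : (RealExpr.div e f).growth ≤ 4) :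
    f = .ofInt (.const 2) ∧ (RealExpr.div e f).growth = e.growth + 1 := by
  by_cases hf : f = .ofInt (.const 2)
  · subst hf; exact ⟨rfl, rfl⟩
  · exfalso
    rw [RealExpr.growth] at h
    · omega
    · exact fun h => hf h

theorem RealExpr.eval_graded {Q : ℕ → ℝ → Prop} (hQ : Graded Q) {e : RealExpr}
    (h : e.growth ≤ 4) {s : State} {k : ℕ}
    (hs : ∀ a i, s.ints a i < 2 ^ k) (hr : ∀ a i, Q k (s.reals a i)) :
    Q (k + e.growth) (e.eval s) := by
  induction e with
  | ofInt e => exact hQ.nat (IntExpr.eval_lt h hs)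
  | get a i => exact hr _ _
  | add e f he hf =>
    simp only [growth] at h
    have h1 := hQ.mono (l := k + (e.growth + f.growth)) (by omega) (he (by omega))
    have h2 := hQ.mono (l := k + (e.growth + f.growth)) (by omega) (hf (by omega))
    exact hQ.add h1 h2
  | sub e f he hf =>
    simp only [growth] at h
    have h1 := hQ.mono (l := k + (e.growth + f.growth)) (by omega) (he (by omega))
    have h2 := hQ.mono (l := k + (e.growth + f.growth)) (by omega) (hf (by omega))
    exact hQ.sub h1 h2
  | mul e f he hf => simp [growth] at h
  | div e f he hf =>
    obtain ⟨rfl, h1⟩ := eq_two_of_growth_div h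
    rw [h1]
    have := hQ.half (he (by omega))
    simpa [eval, IntExpr.eval, add_assoc] using this

namespace Stmt

/-- Each step raises the grade of the memory by at most 4, so a run of `t` steps from grade `k`
stays within `k + 4 * t`; the bound on `t` is a polynomial because loop bounds are static. The
number `t` is produced before `B` and `R`, since admissible values of these are only known once `t`
is. -/
theorem exec_compile {Q : ℕ → ℝ → Prop} (hQ : Graded Q) {n : ℕ} (P : Stmt) (hP : P.wf) :
    ∀ (s : State) (k : ℕ), (∀ i, s.ints 0 i ≤ n) → (∀ a i, s.ints a i < 2 ^ k) →
      (∀ a i, Q k (s.reals a i)) →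
      ∃ t, t ≤ P.costPoly.eval n ∧
        (∀ (B : ℕ) (R : ℝ → Prop), k + 4 * t ≤ B → (∀ r, Q (k + 4 * t) r → R r) →
          Exec B R P.compile s (P.run s) t) ∧
        (P.run s).ints 0 = s.ints 0 ∧
        (∀ a i, (P.run s).ints a i < 2 ^ (k + 4 * t)) ∧
        (∀ a i, Q (k + 4 * t) ((P.run s).reals a i)) := by
  induction P with
  | setInt a i v =>
    intro s k h0 hs hr
    simp only [wf, Bool.and_eq_true, bne_iff_ne, decide_eq_true_eq] at hP
    have h1 := IntExpr.eval_lt hP.2 hs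
    have h2 : v.eval s < 2 ^ (k + 4 * 1) :=
      h1.trans_le (Nat.pow_le_pow_right (by norm_num) (by omega))
    refine ⟨1, by simp [costPoly], fun B R hB _ => ?_, ?_, fun b j => ?_, fun b j => ?_⟩
    · refine Exec.setInt _ _ _ _ ((Nat.size_le.2 h2).trans hB)
    · exact ints_setInt_ne _ (Ne.symm hP.1) _ _
    · simp only [run, ints_setInt]
      split_ifs
      · exact h2
      · exact (hs _ _).trans_le (Nat.pow_le_pow_right (by norm_num) (by omega))
    · exact hQ.mono (by omega) (hr _ _)
  | setReal a i v =>
    intro s k h0 hs hr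
    simp only [wf, decide_eq_true_eq] at hP
    have h2 : Q (k + 4 * 1) (v.eval s) := hQ.mono (by omega) (RealExpr.eval_graded hQ hP hs hr)
    refine ⟨1, by simp [costPoly], fun B R hB hR => ?_, rfl, fun b j => ?_, fun b j => ?_⟩
    · exact Exec.setReal _ _ _ _ (hR _ h2)
    · exact (hs _ _).trans_le (Nat.pow_le_pow_right (by norm_num) (by omega))
    · simp only [run, reals_setReal]
      split_ifs
      · exact h2
      · exact hQ.mono (by omega) (hr _ _)
  | seq P P' ih ih' =>
    intro s k h0 hs hr
    simp only [wf, Bool.and_eq_true] at hP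
    obtain ⟨t, ht, hE, h0', hs', hr'⟩ := ih hP.1 s k h0 hs hr
    obtain ⟨t', ht', hE', h0'', hs'', hr''⟩ := ih' hP.2 (P.run s) _ (by rwa [h0']) hs' hr'
    refine ⟨t + t', ?_, fun B R hB hR => ?_, h0''.trans h0', ?_, ?_⟩
    · simpa [costPoly] using add_le_add ht ht'
    · exact Exec.seq (hE B R (by omega) fun r hr => hR r (hQ.mono (by omega) hr))
        (hE' B R (by omega) fun r hr => hR r (hQ.mono (by omega) hr))
    · rw [show k + 4 * (t + t') = k + 4 * t + 4 * t' by ring]; exact hs''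
    · rw [show k + 4 * (t + t') = k + 4 * t + 4 * t' by ring]; exact hr''
  | cond b P P' ih ih' =>
    intro s k h0 hs hr
    simp only [wf, Bool.and_eq_true] at hP
    by_cases hb : b.holds s
    · obtain ⟨t, ht, hE, h0', hs', hr'⟩ := ih hP.1 s k h0 hs hr
      simp only [run, hb, if_true]
      refine ⟨t + 1, ?_, fun B R hB hR => ?_, h0', fun a i => ?_, fun a i => ?_⟩
      · simp only [costPoly, Polynomial.eval_add, Polynomial.eval_one]; omega
      · exact Exec.condTrue hb (hE B R (by omega) fun r hr => hR r (hQ.mono (by omega) hr))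
      · exact (hs' a i).trans_le (Nat.pow_le_pow_right (by norm_num) (by omega))
      · exact hQ.mono (by omega) (hr' a i)
    · obtain ⟨t, ht, hE, h0', hs', hr'⟩ := ih' hP.2 s k h0 hs hr
      simp only [run, hb, if_false]
      refine ⟨t + 1, ?_, fun B R hB hR => ?_, h0', fun a i => ?_, fun a i => ?_⟩
      · simp only [costPoly, Polynomial.eval_add, Polynomial.eval_one]; omega
      · exact Exec.condFalse hb (hE B R (by omega) fun r hr => hR r (hQ.mono (by omega) hr))
      · exact (hs' a i).trans_le (Nat.pow_le_pow_right (by norm_num) (by omega))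
      · exact hQ.mono (by omega) (hr' a i)
  | iter a N P ih =>
    intro s k h0 hs hr
    simp only [wf, Bool.and_eq_true, bne_iff_ne, Bool.not_eq_true'] at hP
    obtain ⟨⟨⟨ha, hw⟩, hN⟩, hP⟩ := hP
    have hcount : ∀ i, (loopState a P.run s i).ints a 0 = i := by
      intro i; cases i <;> simp [loopState]
    -- The compiled loop evaluates its bound anew in every round, whereas `run` does so only once.
    have hN' : ∀ u : State, u.ints 0 = s.ints 0 → N.eval u = N.eval s :=
      fun u hu => IntExpr.eval_static hN hu
    -- the rounds from `i` on
    have key : ∀ d i k, i + d = N.eval s → (loopState a P.run s i).ints 0 = s.ints 0 →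
        (∀ b j, (loopState a P.run s i).ints b j < 2 ^ k) →
        (∀ b j, Q k ((loopState a P.run s i).reals b j)) →
        ∃ t, t ≤ d * (P.costPoly.eval n + 2) + 1 ∧
        (∀ (B : ℕ) (R : ℝ → Prop), k + 4 * t ≤ B → (∀ r, Q (k + 4 * t) r → R r) →
          Exec B R (.loop (.ltInt (.get a (.const 0)) N)
            (.seq P.compile (.setInt a (.const 0) (.add (.get a (.const 0)) (.const 1)))))
            (loopState a P.run s i) (loopState a P.run s (N.eval s)) t) ∧
        (loopState a P.run s (N.eval s)).ints 0 = s.ints 0 ∧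
        (∀ b j, (loopState a P.run s (N.eval s)).ints b j < 2 ^ (k + 4 * t)) ∧
        (∀ b j, Q (k + 4 * t) ((loopState a P.run s (N.eval s)).reals b j)) := by
      intro d
      induction d with
      | zero =>
        intro i k hi h0' hs' hr'
        obtain rfl : i = N.eval s := by omega
        refine ⟨1, by omega, fun B R _ _ => ?_, h0', fun b j => ?_, fun b j => ?_⟩
        · refine Exec.loopDone ?_
          simp only [Test.holds, IntExpr.eval, hcount, hN' _ h0', lt_irrefl, not_false_eq_true]
        · exact (hs' _ _).trans_le (Nat.pow_le_pow_right (by norm_num) (by omega))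
        · exact hQ.mono (by omega) (hr' _ _)
      | succ d ihd =>
        intro i k hi h0' hs' hr'
        obtain ⟨t, ht, hE, h0'', hs'', hr''⟩ := ih hP (loopState a P.run s i) k
          (by rwa [h0']) hs' hr'
        have hc : (P.run (loopState a P.run s i)).ints a 0 = i := by
          rw [run_ints P hw, hcount]
        -- The counter is itself a cell of the memory, hence already below `2 ^ (k + 4 * t)`;
        -- incrementing it costs one more step and thereby four more digits.
        have hlt : i + 1 < 2 ^ (k + 4 * (t + 1)) := by
          have := hs'' a 0
          rw [hc] at this
          rw [show k + 4 * (t + 1) = k + 4 * t + 4 by ring, pow_add]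
          have h16 : (2 : ℕ) ^ 4 = 16 := by norm_num
          rw [h16]
          omega
        obtain ⟨t', ht', hE', h03, hs3, hr3⟩ := ihd (i + 1) (k + 4 * (t + 1)) (by omega)
          (by
            simp only [loopState]
            rw [ints_setInt_ne _ (Ne.symm ha), h0'', h0'])
          (by
            intro b j
            simp only [loopState, ints_setInt]
            split_ifs
            · exact hlt
            · exact (hs'' _ _).trans_le (Nat.pow_le_pow_right (by norm_num) (by omega)))
          (by
            intro b j
            simp only [loopState, reals_setInt]
            exact hQ.mono (by omega) (hr'' _ _))
        refine ⟨(t + 1) + t' + 1, ?_, fun B R hB hR => ?_, h03, fun b j => ?_, fun b j => ?_⟩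
        · rw [Nat.succ_mul]; omega
        · refine Exec.loopStep ?_ (Exec.seq (hE B R (by omega)
            fun r hr => hR r (hQ.mono (by omega) hr)) ?_)
            (hE' B R (by omega) fun r hr => hR r (hQ.mono (by omega) hr))
          · simp only [Test.holds, IntExpr.eval, hcount, hN' _ h0']; omega
          · have := Exec.setInt (B := B) (R := R) (P.run (loopState a P.run s i)) a (.const 0)
              (.add (.get a (.const 0)) (.const 1))
              (by
                simp only [IntExpr.eval, hc]
                exact (Nat.size_le.2 hlt).trans (by omega))
            simpa only [IntExpr.eval, hc, loopState] using this
        · exact (hs3 _ _).trans_le (Nat.pow_le_pow_right (by norm_num) (by omega))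
        · exact hQ.mono (by omega) (hr3 _ _)
    obtain ⟨t, ht, hE, h03, hs3, hr3⟩ := key (N.eval s) 0 (k + 4 * 1) (by omega)
      (ints_setInt_ne _ (Ne.symm ha) _ _)
      (by
        intro b j
        simp only [loopState, ints_setInt]
        split_ifs
        · positivity
        · exact (hs _ _).trans_le (Nat.pow_le_pow_right (by norm_num) (by omega)))
      (fun b j => hQ.mono (by omega) (hr _ _))
    refine ⟨1 + t, ?_, fun B R hB hR => ?_, h03, fun b j => ?_, fun b j => ?_⟩
    · have := Nat.mul_le_mul_right (P.costPoly.eval n + 2) (IntExpr.eval_le_poly hN h0)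
      simp only [costPoly, Polynomial.eval_add, Polynomial.eval_mul, Polynomial.eval_ofNat]
      omega
    · exact Exec.seq (Exec.setInt _ _ _ _ (by simp [IntExpr.eval]))
        (hE B R (by omega) fun r hr => hR r (hQ.mono (by omega) hr))
    · exact (hs3 _ _).trans_le (Nat.pow_le_pow_right (by norm_num) (by omega))
    · exact hQ.mono (by omega) (hr3 _ _)

end Stmt

end RAM

/-! ### Cuts in weighted graphs on the natural numbers -/

namespace WCut

open Finset

/-- The number `0` if `a` and `b` are on the same side of `S`, and `1` otherwise. -/
def sep (S : Finset ℕ) (a b : ℕ) : ℝ := if (a ∈ S ↔ b ∈ S) then 0 else 1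

/-- The weight of the edges between `S` and its complement in the graph with vertex set `V`. -/
noncomputable def cut (M : ℕ → ℕ → ℝ) (V S : Finset ℕ) : ℝ :=
  1 / 2 * ∑ a ∈ V, ∑ b ∈ V, sep S a b * M a b

theorem sep_nonneg (S : Finset ℕ) (a b : ℕ) : 0 ≤ sep S a b := by
  unfold sep; split_ifs <;> norm_num

theorem sep_self (S : Finset ℕ) (a : ℕ) : sep S a a = 0 := by simp [sep]

theorem sep_comm (S : Finset ℕ) (a b : ℕ) : sep S a b = sep S b a := by
  unfold sep; simp only [iff_comm]

variable {M : ℕ → ℕ → ℝ} {V S : Finset ℕ}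

theorem cut_insert (hM : ∀ a b, M a b = M b a) {b : ℕ} (hb : b ∉ V) :
    cut M (insert b V) S = cut M V S + ∑ c ∈ V, sep S b c * M b c := by
  unfold cut
  rw [sum_insert hb, sum_insert hb, sep_self]
  simp_rw [sum_insert hb, sum_add_distrib]
  have : ∑ x ∈ V, sep S x b * M x b = ∑ x ∈ V, sep S b x * M b x :=
    sum_congr rfl fun c _ => by rw [sep_comm, hM]
  rw [this]; ring

theorem cut_congr_set {S S' : Finset ℕ} (h : ∀ a ∈ V, a ∈ S ↔ a ∈ S') : cut M V S = cut M V S' := by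
  unfold cut
  congr 1
  refine sum_congr rfl fun a ha => sum_congr rfl fun b hb => ?_
  simp only [sep, h a ha, h b hb]

/-- Diagonal entries never contribute to a cut. This allows contractions to leave arbitrary values
there. -/
theorem cut_congr {M M' : ℕ → ℕ → ℝ} (h : ∀ a ∈ V, ∀ b ∈ V, a ≠ b → M a b = M' a b) :
    cut M V S = cut M' V S := by
  unfold cut
  congr 1
  refine sum_congr rfl fun a ha => sum_congr rfl fun b hb => ?_
  by_cases hab : a = b
  · subst hab; simp [sep_self]
  · rw [h a ha b hb hab]

theorem cut_compl : cut M V (V \ S) = cut M V S := by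
  unfold cut
  congr 1
  refine sum_congr rfl fun a ha => sum_congr rfl fun b hb => ?_
  simp only [sep, mem_sdiff, ha, hb, true_and, not_iff_not]

theorem cut_singleton (hM : ∀ a b, M a b = M b a) {t : ℕ} (ht : t ∉ V) (hS : t ∈ S)
    (hV : ∀ a ∈ V, a ∉ S) : cut M (insert t V) S = ∑ c ∈ V, M t c := by
  rw [cut_insert hM ht]
  have : cut M V S = 0 := by
    unfold cut
    rw [sum_eq_zero, mul_zero]
    intro a ha
    refine sum_eq_zero fun b hb => ?_
    simp [sep, hV a ha, hV b hb]
  rw [this, zero_add]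
  refine sum_congr rfl fun c hc => ?_
  simp [sep, hS, hV c hc]

/-- The condition maintained by a maximum adjacency ordering: for the vertices `b` that are still
to come, the star of `b` is a minimum cut between `b` and the last vertex. -/
def Adjacent (M : ℕ → ℕ → ℝ) (A V : Finset ℕ) (last : ℕ) : Prop :=
  ∀ b ∈ A, b ∉ V → ∀ S, (last ∈ S ↔ b ∉ S) → ∑ c ∈ V, M b c ≤ cut M (insert b V) S

theorem adjacent_start (hM : ∀ a b, M a b = M b a) (A : Finset ℕ) (k : ℕ) :
    Adjacent M A {k} k := by
  intro b _ hb S hS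
  rw [cut_insert hM hb]
  have : cut M {k} S = 0 := by simp [cut, sep_self]
  rw [this]
  have : sep S b k = 1 := by
    unfold sep; rw [if_neg]; tauto
  simp [this]

/-- The classical argument for maximum adjacency orderings. Let `S` separate the new last vertex `a`
from a later vertex `b`. If `S` also separates the old last vertex from `b`, the hypothesis for `b`
applies and the edge `ab` adds its weight to both sides. Otherwise `S` separates the old last vertex
from `a`; the hypothesis for `a` applies, and the choice of `a` says that `b` has no larger weight
towards `V`. -/
theorem adjacent_step (hM : ∀ a b, M a b = M b a) (h0 : ∀ a b, 0 ≤ M a b) {A : Finset ℕ}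
    {last a : ℕ} (hA : Adjacent M A V last) (ha : a ∈ A) (haV : a ∉ V)
    (hmax : ∀ b ∈ A, b ∉ V → ∑ c ∈ V, M b c ≤ ∑ c ∈ V, M a c) :
    Adjacent M A (insert a V) a := by
  intro b hb hbV S hS
  have hba : b ≠ a := by rintro rfl; simp at hbV
  have hbV' : b ∉ V := fun h => hbV (mem_insert_of_mem h)
  have haV' : a ∉ insert b V := by simp [haV, hba.symm]
  have hsum : ∑ c ∈ insert a V, M b c = M b a + ∑ c ∈ V, M b c := sum_insert haV
  have hs : sep S a b = 1 := by
    unfold sep; rw [if_neg]; tauto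
  have hnn : ∀ x, 0 ≤ ∑ c ∈ V, sep S x c * M x c := fun x =>
    sum_nonneg fun c _ => mul_nonneg (sep_nonneg _ _ _) (h0 _ _)
  have e1 : cut M (insert b (insert a V)) S =
      cut M (insert b V) S + (M b a + ∑ c ∈ V, sep S a c * M a c) := by
    rw [insert_comm, cut_insert hM haV', sum_insert hbV', hs, one_mul, hM a b]
  have e2 : cut M (insert b (insert a V)) S =
      cut M (insert a V) S + (M b a + ∑ c ∈ V, sep S b c * M b c) := by
    rw [cut_insert hM hbV, sum_insert haV, sep_comm, hs, one_mul]
  rw [hsum]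
  by_cases hl : last ∈ S ↔ b ∉ S
  · have := hA b hb hbV' S hl
    rw [e1]
    linarith [hnn a]
  · have := hA a ha haV S (by tauto)
    rw [e2]
    linarith [hnn b, hmax b hb hbV']

/-- Merging `t` into `s`. -/
theorem cut_merge {M M' : ℕ → ℕ → ℝ} (hM : ∀ a b, M a b = M b a) (hM' : ∀ a b, M' a b = M' b a)
    {s t : ℕ} (hs : s ∈ V) (ht : t ∈ V) (hst : s ≠ t)
    (h1 : ∀ a b, a ≠ s → b ≠ s → a ≠ t → b ≠ t → M' a b = M a b)
    (h2 : ∀ b, b ≠ s → b ≠ t → M' s b = M s b + M t b) (hS : s ∈ S ↔ t ∈ S) :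
    cut M' (V.erase t) S = cut M V S := by
  obtain ⟨V0, hV0⟩ : ∃ V0, V0 = (V.erase t).erase s := ⟨_, rfl⟩
  have hs0 : s ∉ V0 := by simp [hV0]
  have ht0 : t ∉ insert s V0 := by simp [hV0, hst.symm]
  have e1 : V.erase t = insert s V0 := by rw [hV0, insert_erase]; simp [hs, hst]
  have e2 : V = insert t (insert s V0) := by rw [← e1, insert_erase ht]
  have ht1 : t ∉ V0 := fun h => ht0 (mem_insert_of_mem h)
  rw [e1, cut_insert hM' hs0]
  conv_rhs => rw [e2]
  rw [cut_insert hM ht0, cut_insert hM hs0, sum_insert hs0]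
  have e3 : sep S t s = 0 := by simp [sep, hS]
  have e4 : ∀ c, sep S t c = sep S s c := fun c => by simp [sep, hS]
  have e5 : cut M' V0 S = cut M V0 S := cut_congr fun a ha b hb _ =>
    h1 a b (fun h => hs0 (h ▸ ha)) (fun h => hs0 (h ▸ hb)) (fun h => ht1 (h ▸ ha))
      (fun h => ht1 (h ▸ hb))
  have e6 : ∑ c ∈ V0, sep S s c * M' s c =
      ∑ c ∈ V0, sep S s c * M s c + ∑ c ∈ V0, sep S t c * M t c := by
    rw [← sum_add_distrib]
    refine sum_congr rfl fun c hc => ?_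
    rw [h2 c (fun h => hs0 (h ▸ hc)) (fun h => ht1 (h ▸ hc)), e4]; ring
  rw [e3, e5, e6]; ring

/-- The matrix `M` with `δ` added to the weight of the edge `ab`. -/
noncomputable def addEdge (M : ℕ → ℕ → ℝ) (a b : ℕ) (δ : ℝ) : ℕ → ℕ → ℝ :=
  fun i j => M i j + if (i = a ∧ j = b) ∨ (i = b ∧ j = a) then δ else 0

theorem addEdge_comm (hM : ∀ a b, M a b = M b a) (a b : ℕ) (δ : ℝ) (i j : ℕ) :
    addEdge M a b δ i j = addEdge M a b δ j i := by
  unfold addEdge; rw [hM i j]; congr 2; apply propext; tauto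

theorem cut_addEdge {a b : ℕ} (ha : a ∈ V) (hb : b ∈ V) (hab : a ≠ b) (δ : ℝ) :
    cut (addEdge M a b δ) V S = cut M V S + sep S a b * δ := by
  unfold cut addEdge
  simp_rw [mul_add, sum_add_distrib]
  have : ∀ x ∈ V, ∀ y ∈ V, sep S x y * (if (x = a ∧ y = b) ∨ (x = b ∧ y = a) then δ else 0) =
      (if x = a then if y = b then sep S a b * δ else 0 else 0) +
      (if x = b then if y = a then sep S a b * δ else 0 else 0) := by
    intro x _ y _
    have hba := hab.symm
    by_cases h1 : x = a
    · subst h1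
      by_cases h2 : y = b
      · subst h2; simp [hab]
      · simp [h2, hab]
    · by_cases h1' : x = b
      · subst h1'
        by_cases h2 : y = a
        · subst h2; simp [hba, sep_comm]
        · simp [h2, hba]
      · simp [h1, h1']
  rw [sum_congr rfl fun x hx => sum_congr rfl fun y hy => this x hx y hy]
  simp_rw [sum_add_distrib]
  simp only [sum_ite_irrel, sum_const_zero, sum_ite_eq', ha, hb, if_true]
  ring

end WCut

/-! ### Splitting off edges -/

namespace WCut

open Finset

/-- All cuts of the graph on `0, …, K - 1` have weight at least `2`. -/
def Full (K : ℕ) (W : ℕ → ℕ → ℝ) : Prop :=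
  ∀ S ⊆ range K, S.Nonempty → S ≠ range K → 2 ≤ cut W (range K) S

/-- All cuts of the graph on `0, …, k`, except possibly the star of `k`, have weight at
least `2`. -/
def Feasible (k : ℕ) (W : ℕ → ℕ → ℝ) : Prop :=
  ∀ S ⊆ range k, S.Nonempty → S ≠ range k → 2 ≤ cut W (range (k + 1)) S

theorem Full.feasible {k : ℕ} {W : ℕ → ℕ → ℝ} (h : Full (k + 1) W) : Feasible k W := by
  intro S hS hne _
  refine h S (hS.trans (range_subset_range.2 (Nat.le_succ k))) hne fun h => ?_
  have : k ∈ S := by rw [h]; simp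
  simpa using hS this

/-- Splitting off `δ` from the edges `uk` and `wk`. -/
noncomputable def split (k : ℕ) (W : ℕ → ℕ → ℝ) (u w : ℕ) (δ : ℝ) : ℕ → ℕ → ℝ :=
  addEdge (addEdge (addEdge W u k (-δ)) w k (-δ)) u w δ

theorem split_comm {k u w : ℕ} {W : ℕ → ℕ → ℝ} (hW : ∀ a b, W a b = W b a) (δ : ℝ) (a b : ℕ) :
    split k W u w δ a b = split k W u w δ b a :=
  addEdge_comm (addEdge_comm (addEdge_comm hW _ _ _) _ _ _) _ _ _ _ _

/-- Splitting off by a negative amount gives weight back, so an overshoot can be corrected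
afterwards. -/
theorem split_split (k : ℕ) (W : ℕ → ℕ → ℝ) (u w : ℕ) (δ ε : ℝ) :
    split k (split k W u w δ) u w ε = split k W u w (δ + ε) := by
  funext i j
  unfold split addEdge
  split_ifs <;> ring

theorem split_left {k u w : ℕ} {W : ℕ → ℕ → ℝ} (huw : u < w) (hw : w < k)
    (δ : ℝ) : split k W u w δ u k = W u k - δ := by
  unfold split addEdge
  have h1 : k ≠ u := by omega
  have h2 : k ≠ w := by omega
  have h3 : u ≠ w := by omega
  simp [h1, h2, h3, h1.symm]; ring

theorem split_right {k u w : ℕ} {W : ℕ → ℕ → ℝ} (huw : u < w) (hw : w < k)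
    (δ : ℝ) : split k W u w δ w k = W w k - δ := by
  unfold split addEdge
  have h1 : k ≠ u := by omega
  have h2 : k ≠ w := by omega
  have h3 : u ≠ w := by omega
  simp [h1, h2, h3.symm, h2.symm]; ring

theorem split_off {k u w : ℕ} {W : ℕ → ℕ → ℝ} {a : ℕ} (ha : a < k) (hau : a ≠ u) (haw : a ≠ w) (δ : ℝ) :
    split k W u w δ a k = W a k := by
  unfold split addEdge
  simp [hau, haw, ha.ne]

theorem split_inner {k u w : ℕ} {W : ℕ → ℕ → ℝ} {a b : ℕ} (ha : a < k) (hb : b < k) (δ : ℝ) :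
    split k W u w δ a b = W a b + if (a = u ∧ b = w) ∨ (a = w ∧ b = u) then δ else 0 := by
  unfold split addEdge
  simp [ha.ne, hb.ne]

theorem split_nonneg {k u w : ℕ} {W : ℕ → ℕ → ℝ} (huw : u < w) (hw : w < k)
    (h0 : ∀ a b, 0 ≤ W a b) {δ : ℝ} (hδ : 0 ≤ δ) (h1 : δ ≤ W u k)
    (h2 : δ ≤ W w k) (hW : ∀ a b, W a b = W b a) (a b : ℕ) : 0 ≤ split k W u w δ a b := by
  have h1' : δ ≤ W k u := hW u k ▸ h1
  have h2' : δ ≤ W k w := hW w k ▸ h2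
  have h3 : u ≠ w := huw.ne
  have h4 : u ≠ k := by omega
  have h5 : w ≠ k := by omega
  have := h0 a b
  unfold split addEdge
  by_cases c1 : (a = u ∧ b = k) ∨ (a = k ∧ b = u)
  · have c2 : ¬ ((a = w ∧ b = k) ∨ (a = k ∧ b = w)) := by omega
    have c3 : ¬ ((a = u ∧ b = w) ∨ (a = w ∧ b = u)) := by omega
    rw [if_pos c1, if_neg c2, if_neg c3]
    obtain ⟨rfl, rfl⟩ | ⟨rfl, rfl⟩ := c1 <;> linarith
  · rw [if_neg c1]
    by_cases c2 : (a = w ∧ b = k) ∨ (a = k ∧ b = w)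
    · have c3 : ¬ ((a = u ∧ b = w) ∨ (a = w ∧ b = u)) := by omega
      rw [if_pos c2, if_neg c3]
      obtain ⟨rfl, rfl⟩ | ⟨rfl, rfl⟩ := c2 <;> linarith
    · rw [if_neg c2]
      split_ifs <;> linarith

/-- As `k ∉ S`, both removed edges cross `S` when `u` and `w` lie in `S`, and the new edge does not.
If exactly one of them lies in `S`, the new edge makes up for the one removed edge that crosses. -/
theorem cut_split {k u w : ℕ} {W : ℕ → ℕ → ℝ} (huw : u < w) (hw : w < k)
    {S : Finset ℕ} (hS : S ⊆ range k) (δ : ℝ) :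
    cut (split k W u w δ) (range (k + 1)) S =
      cut W (range (k + 1)) S - if u ∈ S ∧ w ∈ S then 2 * δ else 0 := by
  have hk : k ∉ S := fun h => by simpa using hS h
  unfold split
  rw [cut_addEdge (by simp; omega) (by simp; omega) huw.ne,
    cut_addEdge (by simp; omega) (by simp) (by omega),
    cut_addEdge (by simp; omega) (by simp) (by omega)]
  unfold sep
  by_cases h1 : u ∈ S <;> by_cases h2 : w ∈ S <;> simp [h1, h2, hk]
  ring

/-- The graph `W'` arises from `W` by splitting off edges at `k`. -/
structure SplitRel (k : ℕ) (W W' : ℕ → ℕ → ℝ) : Prop where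
  cut_le : ∀ S ⊆ range k, cut W' (range (k + 1)) S ≤ cut W (range (k + 1)) S
  star_le : ∀ a < k, W' a k ≤ W a k
  inner_le : ∀ a < k, ∀ b < k, W a b ≤ W' a b
  degree : ∀ a < k, ∑ b ∈ range k, W' a b + W' a k = ∑ b ∈ range k, W a b + W a k

theorem SplitRel.refl (k : ℕ) (W : ℕ → ℕ → ℝ) : SplitRel k W W :=
  ⟨fun _ _ => le_rfl, fun _ _ => le_rfl, fun _ _ _ _ => le_rfl, fun _ _ => rfl⟩

theorem SplitRel.trans {k : ℕ} {W W' W'' : ℕ → ℕ → ℝ} (h : SplitRel k W W')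
    (h' : SplitRel k W' W'') : SplitRel k W W'' :=
  ⟨fun S hS => (h'.1 S hS).trans (h.1 S hS), fun a ha => (h'.2 a ha).trans (h.2 a ha),
    fun a ha b hb => (h.3 a ha b hb).trans (h'.3 a ha b hb),
    fun a ha => (h'.4 a ha).trans (h.4 a ha)⟩

theorem splitRel_split {k u w : ℕ} (W : ℕ → ℕ → ℝ) (huw : u < w) (hw : w < k) {δ : ℝ}
    (hδ : 0 ≤ δ) : SplitRel k W (split k W u w δ) := by
  have hu : u < k := huw.trans hw
  refine ⟨fun S hS => ?_, fun a ha => ?_, fun a ha b hb => ?_, fun a ha => ?_⟩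
  · rw [cut_split huw hw hS]
    split_ifs <;> linarith
  · by_cases h1 : a = u
    · subst h1; rw [split_left huw hw]; linarith
    · by_cases h2 : a = w
      · subst h2; rw [split_right huw hw]; linarith
      · rw [split_off ha h1 h2]
  · rw [split_inner ha hb]
    split_ifs <;> linarith
  · rw [sum_congr rfl fun b hb => split_inner ha (mem_range.1 hb) δ, sum_add_distrib]
    by_cases h1 : a = u
    · subst h1
      rw [split_left huw hw]
      simp only [true_and, huw.ne, false_and, or_false, sum_ite_eq', mem_range, hw, if_true]; ring
    · by_cases h2 : a = w
      · subst h2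
        rw [split_right huw hw]
        simp only [true_and, huw.ne', false_and, false_or, sum_ite_eq', mem_range, hu, if_true]; ring
      · rw [split_off ha h1 h2]
        simp [h1, h2]

/-- Nothing more can be split off from the pair of edges `uk` and `wk`. -/
def Blocked (k : ℕ) (W : ℕ → ℕ → ℝ) (u w : ℕ) : Prop :=
  W u k = 0 ∨ W w k = 0 ∨
    ∃ S ⊆ range k, S ≠ range k ∧ u ∈ S ∧ w ∈ S ∧ cut W (range (k + 1)) S ≤ 2

/-- Later splitting raises neither star weights nor cuts. Hence a single pass over all pairs is
enough. -/
theorem Blocked.mono {k u w : ℕ} {W W' : ℕ → ℕ → ℝ} (h : Blocked k W u w) (hR : SplitRel k W W')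
    (h0 : ∀ a b, 0 ≤ W' a b) (hu : u < k) (hw : w < k) : Blocked k W' u w := by
  rcases h with h | h | ⟨S, hS, h1, h2, h3, h4⟩
  · exact Or.inl (le_antisymm ((hR.star_le u hu).trans h.le) (h0 _ _))
  · exact Or.inr (Or.inl (le_antisymm ((hR.star_le w hw).trans h.le) (h0 _ _)))
  · exact Or.inr (Or.inr ⟨S, hS, h1, h2, h3, (hR.cut_le S hS).trans h4⟩)

/-- Splitting off as much as the smallest cut allows. -/
theorem split_max {k u w : ℕ} {W : ℕ → ℕ → ℝ} (huw : u < w) (hw : w < k)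
    (h0 : ∀ a b, 0 ≤ W a b) (hF : Feasible k W) {c α : ℝ}
    (hα : α = min (W u k) (W w k))
    (hc : ∀ S ⊆ range k, S.Nonempty → S ≠ range k →
      c ≤ cut (split k W u w α) (range (k + 1)) S)
    (hc' : c = 2 ∨ c ≤ 2 ∧ ∃ S ⊆ range k, S.Nonempty ∧ S ≠ range k ∧
      cut (split k W u w α) (range (k + 1)) S = c) :
    0 ≤ α - (2 - c) / 2 ∧ (2 - c) / 2 ≥ 0 ∧
      Feasible k (split k W u w (α - (2 - c) / 2)) ∧
      Blocked k (split k W u w (α - (2 - c) / 2)) u w := by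
  have hα0 : 0 ≤ α := hα ▸ le_min (h0 _ _) (h0 _ _)
  have hc2 : c ≤ 2 := by rcases hc' with h | h; exacts [h.le, h.1]
  -- After splitting off the whole of `α`, a cut below 2 must contain both `u` and `w`, since it was
  -- at least 2 before and only such cuts have changed. Giving back `(2 - c) / 2` raises each of
  -- these cuts by `2 - c`: the smallest one becomes tight and none remains below 2.
  refine ⟨?_, by linarith, ?_, ?_⟩
  · rcases hc' with rfl | ⟨_, S, hS, hne, hS', rfl⟩
    · simpa using hα0
    · have := hF S hS hne hS'
      rw [cut_split huw hw hS]
      split_ifs <;> linarith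
  · intro S hS hne hS'
    have h1 := hc S hS hne hS'
    have h2 := hF S hS hne hS'
    rw [cut_split huw hw hS] at h1 ⊢
    split_ifs at h1 ⊢ <;> linarith
  · rcases hc' with rfl | ⟨_, S, hS, hne, hS', hcS⟩
    · rcases min_choice (W u k) (W w k) with h | h
      · left; rw [split_left huw hw, hα, h]; ring
      · right; left; rw [split_right huw hw, hα, h]; ring
    · have h2 := hF S hS hne hS'
      rw [cut_split huw hw hS] at hcS
      by_cases hm : u ∈ S ∧ w ∈ S
      · right; right
        refine ⟨S, hS, hS', hm.1, hm.2, ?_⟩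
        rw [cut_split huw hw hS]
        rw [if_pos hm] at hcS ⊢
        linarith
      · rw [if_neg hm] at hcS
        have : c = 2 := by linarith
        subst this
        rcases min_choice (W u k) (W w k) with h | h
        · left; rw [split_left huw hw, hα, h]; ring
        · right; left; rw [split_right huw hw, hα, h]; ring

/-- Posimodularity of the cut function: edges between `X ∩ Y` and the outside of `X ∪ Y` count twice
on the right and not at all on the left, and `uk` is one of them. -/
theorem cut_uncross {W : ℕ → ℕ → ℝ} (hW : ∀ a b, W a b = W b a) (h0 : ∀ a b, 0 ≤ W a b)
    {k u : ℕ} {X Y : Finset ℕ} (hX : X ⊆ range k) (hY : Y ⊆ range k) (huX : u ∈ X) (huY : u ∈ Y) :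
    cut W (range (k + 1)) (X \ Y) + cut W (range (k + 1)) (Y \ X) + 2 * W u k ≤
      cut W (range (k + 1)) X + cut W (range (k + 1)) Y := by
  have hkX : k ∉ X := fun h => by simpa using hX h
  have hkY : k ∉ Y := fun h => by simpa using hY h
  have huk : u < k := mem_range.1 (hX huX)
  -- The extra term is written as a cut of a graph with one edge, so that the inequality can be
  -- compared term by term over ordered pairs.
  have hz : 2 * W u k = cut (addEdge (fun _ _ => 0) u k (2 * W u k)) (range (k + 1)) {u} := by
    rw [cut_addEdge (by simp; omega) (by simp) huk.ne]
    simp [cut, sep, huk.ne']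
  rw [hz]
  unfold cut
  rw [← mul_add, ← mul_add, ← mul_add, ← sum_add_distrib, ← sum_add_distrib, ← sum_add_distrib]
  refine mul_le_mul_of_nonneg_left (sum_le_sum fun a _ => ?_) (by norm_num)
  rw [← sum_add_distrib, ← sum_add_distrib, ← sum_add_distrib]
  refine sum_le_sum fun b _ => ?_
  have hab := h0 a b
  by_cases h1 : a = u ∧ b = k
  · obtain ⟨rfl, rfl⟩ := h1
    simp [sep, addEdge, huX, huY, hkX, hkY, huk.ne']
    linarith
  · by_cases h2 : a = k ∧ b = u
    · obtain ⟨rfl, rfl⟩ := h2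
      simp [sep, addEdge, huX, huY, hkX, hkY, huk.ne, huk.ne']
      rw [hW b a]
      linarith
    · have h3 : addEdge (fun _ _ => (0 : ℝ)) u k (2 * W u k) a b = 0 := by
        simp only [addEdge, zero_add]
        rw [if_neg]; tauto
      rw [h3, mul_zero, add_zero]
      unfold sep
      by_cases c1 : a ∈ X <;> by_cases c2 : b ∈ X <;> by_cases c3 : a ∈ Y <;> by_cases c4 : b ∈ Y <;>
        simp [c1, c2, c3, c4] <;> linarith

theorem cut_succ {W : ℕ → ℕ → ℝ} (hW : ∀ a b, W a b = W b a) {k : ℕ} {S : Finset ℕ}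
    (hS : S ⊆ range k) :
    cut W (range (k + 1)) S = cut W (range k) S + ∑ a ∈ S, W a k := by
  have hk : k ∉ S := fun h => by simpa using hS h
  rw [range_add_one, cut_insert hW (by simp)]
  congr 1
  rw [← sum_subset hS]
  · refine sum_congr rfl fun a ha => ?_
    simp [sep, hk, ha, hW k a]
  · intro a _ ha
    simp [sep, hk, ha]

/-- When nothing can be split off any more, `k` can be deleted. -/
theorem full_of_blocked {W : ℕ → ℕ → ℝ} (hW : ∀ a b, W a b = W b a) (h0 : ∀ a b, 0 ≤ W a b)
    {k : ℕ} (hF : Feasible k W) (hB : ∀ w < k, ∀ u < w, Blocked k W u w) : Full k W := by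
  classical
  intro S hS hne hS'
  by_contra hlt
  push Not at hlt
  -- A cut that is too small without `k` was at least 2 with `k`, so it contains a neighbour of `k`.
  -- This applies to `S` and to its complement, and yields two neighbours of `k` on different sides.
  have pos : ∀ S ⊆ range k, S.Nonempty → S ≠ range k → cut W (range k) S < 2 →
      ∃ a ∈ S, 0 < W a k := by
    intro S hS hne hS' hlt
    have h1 := hF S hS hne hS'
    rw [cut_succ hW hS] at h1
    by_contra hcon
    push Not at hcon
    have := sum_nonpos hcon
    linarith
  obtain ⟨u, huS, hu⟩ := pos S hS hne hS' hlt
  have hcne : (range k \ S).Nonempty := by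
    rw [sdiff_nonempty]; exact fun h => hS' (subset_antisymm hS h)
  obtain ⟨z, hzS, hz⟩ := pos (range k \ S) sdiff_subset hcne
    (by
      intro h
      have : u ∈ range k \ S := by rw [h]; exact hS huS
      simp [huS] at this) (by rwa [cut_compl])
  have huk : u < k := mem_range.1 (hS huS)
  have tight : ∀ b < k, b ≠ u → 0 < W b k → ∃ S ⊆ range k, S ≠ range k ∧ u ∈ S ∧ b ∈ S ∧
      cut W (range (k + 1)) S ≤ 2 := by
    intro b hb hbu hbk
    rcases lt_or_gt_of_ne hbu with h | h
    · rcases hB u huk b h with h' | h' | ⟨S, h1, h2, h3, h4, h5⟩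
      · linarith
      · linarith
      · exact ⟨S, h1, h2, h4, h3, h5⟩
    · rcases hB b hb u h with h' | h' | ⟨S, h1, h2, h3, h4, h5⟩
      · linarith
      · linarith
      · exact ⟨S, h1, h2, h3, h4, h5⟩
  -- a largest tight set that contains `u`
  let C := (range k).powerset.filter fun X => X ≠ range k ∧ u ∈ X ∧ cut W (range (k + 1)) X ≤ 2
  have hz' : z < k ∧ z ∉ S := by simpa using hzS
  obtain ⟨X0, hX0, hX0', hX0u, _, hX0c⟩ := tight z hz'.1 (fun h => hz'.2 (h ▸ huS)) hz
  have hC : C.Nonempty := ⟨X0, by simp only [C, mem_filter, mem_powerset]; exact ⟨hX0, hX0', hX0u, hX0c⟩⟩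
  obtain ⟨X, hXC, hXmax⟩ := exists_max_image C card hC
  simp only [C, mem_filter, mem_powerset] at hXC
  obtain ⟨hX, hX', hXu, hXc⟩ := hXC
  -- A largest tight set `X` through `u` contains all neighbours of `k`. A neighbour `b` outside
  -- would lie with `u` in a tight set `Y`; by maximality `X \ Y` is nonempty, so both differences
  -- have cuts of at least 2, and uncrossing contradicts `W u k > 0`.
  have hall : ∀ b < k, 0 < W b k → b ∈ X := by
    intro b hb hbk
    by_cases hbu : b = u
    · rwa [hbu]
    obtain ⟨Y, hY, hY', hYu, hYb, hYc⟩ := tight b hb hbu hbk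
    by_contra hbX
    have hYX : (Y \ X).Nonempty := ⟨b, mem_sdiff.2 ⟨hYb, hbX⟩⟩
    have hXY : (X \ Y).Nonempty := by
      rw [sdiff_nonempty]
      intro hXY
      have h1 := hXmax Y (by
        simp only [C, mem_filter, mem_powerset]; exact ⟨hY, hY', hYu, hYc⟩)
      exact hbX (eq_of_subset_of_card_le hXY h1 ▸ hYb)
    have h1 := hF (X \ Y) (sdiff_subset.trans hX) hXY (fun h => by
      have : u ∈ X \ Y := by rw [h]; simpa using huk
      simp [hYu] at this)
    have h2 := hF (Y \ X) (sdiff_subset.trans hY) hYX (fun h => by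
      have : u ∈ Y \ X := by rw [h]; simpa using huk
      simp [hXu] at this)
    have h3 := cut_uncross hW h0 hX hY hXu hYu
    linarith
  have hcomp : (range k \ X).Nonempty := by
    rw [sdiff_nonempty]; exact fun h => hX' (subset_antisymm hX h)
  have h1 := cut_succ hW hX
  have h2 : W u k ≤ ∑ a ∈ X, W a k := single_le_sum (f := fun a => W a k) (fun a _ => h0 a k) hXu
  -- Deleting `k` lowers the cut of `X` by at least `W u k`, hence below 2. Its complement then
  -- contains a neighbour of `k`, contrary to what was just shown.
  obtain ⟨b, hb, hbk⟩ := pos (range k \ X) sdiff_subset hcomp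
    (by
      intro h
      have : u ∈ range k \ X := by rw [h]; simpa using huk
      simp [hXu] at this) (by rw [cut_compl]; linarith)
  have hb' : b < k ∧ b ∉ X := by simpa using hb
  exact hb'.2 (hall b hb'.1 hbk)

end WCut

namespace RAM

/-! ### Building blocks of programs -/

/-- An injective pairing function. -/
def pairIndex (i j : ℕ) : ℕ := (i + j) * (i + j) + i

/-- The value lies between the squares of `i + j` and of `i + j + 1`, so it determines `i + j`, and
then `i`. -/
theorem pairIndex_inj {i j i' j' : ℕ} : pairIndex i j = pairIndex i' j' ↔ i = i' ∧ j = j' := by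
  refine ⟨fun h => ?_, by rintro ⟨rfl, rfl⟩; rfl⟩
  unfold pairIndex at h
  have key : i + j = i' + j' := by
    rcases lt_trichotomy (i + j) (i' + j') with h1 | h1 | h1
    · exfalso; nlinarith
    · exact h1
    · exfalso; nlinarith
  rw [key] at h
  omega

/-- The expression for the index of a cell in a two-dimensional array. -/
def IntExpr.pair (e f : IntExpr) : IntExpr := .add (.mul (.add e f) (.add e f)) e

@[simp] theorem IntExpr.eval_pair (s : State) (e f : IntExpr) :
    (e.pair f).eval s = pairIndex (e.eval s) (f.eval s) := rfl

/-- Cell `0` of the integer array `a`, used as a variable. -/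
def var (a : ℕ) : IntExpr := .get a (.const 0)

@[simp] theorem eval_var (s : State) (a : ℕ) : (var a).eval s = s.ints a 0 := rfl

/-- Cell `0` of the real array `a`, used as a variable. -/
def rvar (a : ℕ) : RealExpr := .get a (.const 0)

@[simp] theorem eval_rvar (s : State) (a : ℕ) : (rvar a).eval s = s.reals a 0 := rfl

/-- The number of vertices. -/
def numV : IntExpr := .get 0 (.const 0)

/-- The number of edges. -/
def numE : IntExpr := .get 0 (.const 1)

@[simp] theorem eval_numV (s : State) : numV.eval s = s.ints 0 0 := rfl

@[simp] theorem eval_numE (s : State) : numE.eval s = s.ints 0 1 := rfl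

/-- A natural number as a real expression. -/
def rconst (k : ℕ) : RealExpr := .ofInt (.const k)

@[simp] theorem eval_rconst (s : State) (k : ℕ) : (rconst k).eval s = (k : ℝ) := rfl

/-- Equality of integers. -/
def Test.eqInt (e f : IntExpr) : Test := .and (.not (.ltInt e f)) (.not (.ltInt f e))

@[simp] theorem Test.holds_eqInt (s : State) (e f : IntExpr) :
    (Test.eqInt e f).holds s ↔ e.eval s = f.eval s := by
  simp only [eqInt, holds]; omega

/-- Disjunction of tests. -/
def Test.or (b c : Test) : Test := .not (.and (.not b) (.not c))

@[simp] theorem Test.holds_or (s : State) (b c : Test) :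
    (b.or c).holds s ↔ b.holds s ∨ c.holds s := by
  simp only [or, holds]; tauto

namespace Stmt

/-- The assignment of an integer variable. -/
def assign (a : ℕ) (v : IntExpr) : Stmt := setInt a (.const 0) v

/-- The assignment of a real variable. -/
def rassign (a : ℕ) (v : RealExpr) : Stmt := setReal a (.const 0) v

/-- A statement without any relevant effect. -/
def skip : Stmt := assign 99 (.const 0)

/-- Conditional statement without alternative. -/
def when (b : Test) (P : Stmt) : Stmt := cond b P skip

@[simp] theorem run_assign (a : ℕ) (v : IntExpr) (s : State) :
    (assign a v).run s = s.setInt a 0 (v.eval s) := rfl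

@[simp] theorem run_rassign (a : ℕ) (v : RealExpr) (s : State) :
    (rassign a v).run s = s.setReal a 0 (v.eval s) := rfl

@[simp] theorem run_setInt (a : ℕ) (i v : IntExpr) (s : State) :
    (setInt a i v).run s = s.setInt a (i.eval s) (v.eval s) := rfl

@[simp] theorem run_setReal (a : ℕ) (i : IntExpr) (v : RealExpr) (s : State) :
    (setReal a i v).run s = s.setReal a (i.eval s) (v.eval s) := rfl

@[simp] theorem run_seq (P Q : Stmt) (s : State) : (P ;; Q).run s = Q.run (P.run s) := rfl

theorem run_cond_pos {b : Test} {s : State} (h : b.holds s) (P Q : Stmt) :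
    (cond b P Q).run s = P.run s := by simp [run, h]

theorem run_cond_neg {b : Test} {s : State} (h : ¬ b.holds s) (P Q : Stmt) :
    (cond b P Q).run s = Q.run s := by simp [run, h]

theorem run_when_pos {b : Test} {s : State} (h : b.holds s) (P : Stmt) :
    (when b P).run s = P.run s := run_cond_pos h _ _

theorem run_when_neg {b : Test} {s : State} (h : ¬ b.holds s) (P : Stmt) :
    (when b P).run s = s.setInt 99 0 0 := run_cond_neg h _ _

/-! ### Connected components -/

/-- Computes in the integer array `7` labels of the connected components of the graph on
`0, …, n - 1` with edges `AB`, for those values below `N` of the counter `30` that pass the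
test. -/
def labels (N : IntExpr) (b : Test) (A B : IntExpr) : Stmt :=
  iter 31 numV (setInt 7 (var 31) (var 31)) ;;
  iter 30 N (when b (
    assign 32 (.get 7 A) ;;
    assign 33 (.get 7 B) ;;
    iter 31 numV (when (.eqInt (.get 7 (var 31)) (var 33)) (setInt 7 (var 31) (var 32)))))

/-- When the edge `αβ` is processed, all labels equal to that of `β` are changed into that of `α`.
The invariant has two halves: ends of processed edges share a label, and equal labels imply a
connection by processed edges. The hypotheses on the expressions are required in every state that
agrees with `s` outside the auxiliary arrays, because they are evaluated while those arrays change.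
-/
theorem labels_spec {N : IntExpr} {b : Test} {A B : IntExpr} {s : State} {K n : ℕ}
    (hn : s.ints 0 0 = n) (p : ℕ → Prop) (α β : ℕ → ℕ)
    (hN : ∀ t : State, (∀ b, b ∉ [7, 30, 31, 32, 33, 99] → t.ints b = s.ints b) → N.eval t = K)
    (h : ∀ (t : State) (j : ℕ), (∀ b, b ∉ [7, 30, 31, 32, 33, 99] → t.ints b = s.ints b) →
      t.reals = s.reals → t.ints 30 0 = j → j < K → (b.holds t ↔ p j) ∧
        (p j → A.eval t = α j ∧ B.eval t = β j ∧ α j < n ∧ β j < n)) :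
    ∀ x < n, ∀ y < n,
      ((labels N b A B).run s).ints 7 x = ((labels N b A B).run s).ints 7 y ↔
        Relation.EqvGen (fun u w => ∃ j < K, p j ∧ u = α j ∧ w = β j) x y := by
  obtain ⟨s1, hs1⟩ : ∃ s1, s1 = (iter 31 numV (setInt 7 (var 31) (var 31))).run s := ⟨_, rfl⟩
  have f1 : ∀ b, b ∉ [7, 30, 31, 32, 33, 99] → s1.ints b = s.ints b := by
    intro b hb
    rw [hs1]
    simp only [List.mem_cons, List.not_mem_nil, or_false, not_or] at hb
    exact run_ints _ (by simp [writesInt]; omega) _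
  have f1r : s1.reals = s.reals := by
    funext b; rw [hs1]; exact run_reals _ (by simp [writesReal]) _
  have hlab : ∀ x < n, s1.ints 7 x = x := by
    rw [hs1]
    have := run_iter (a := 31) (N := numV) (P := setInt 7 (var 31) (var 31)) (s := s)
      (fun i t => ∀ x < i, t.ints 7 x = x) (by simp)
      (by
        intro i t hi hc _ _ ih x hx
        simp only [run_setInt, eval_var, ints_setInt, hc]
        norm_num
        split_ifs with h1
        · exact h1.symm
        · exact ih x (by omega))
    simpa [hn] using this
  have main := run_iter (a := 30) (N := N) (s := s1) (P := (when b (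
    assign 32 (.get 7 A) ;;
    assign 33 (.get 7 B) ;;
    iter 31 numV (when (.eqInt (.get 7 (var 31)) (var 33)) (setInt 7 (var 31) (var 32))))))
    (fun i t => (∀ j < i, p j → t.ints 7 (α j) = t.ints 7 (β j)) ∧
      ∀ x < n, ∀ y < n, t.ints 7 x = t.ints 7 y →
        Relation.EqvGen (fun u w => ∃ j < i, p j ∧ u = α j ∧ w = β j) x y)
    (by
      refine ⟨fun j hj => by omega, fun x hx y hy hxy => ?_⟩
      simp only [ints_setInt, show ¬ ((7 : ℕ) = 30) by norm_num, false_and, if_false] at hxy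
      rw [hlab x hx, hlab y hy] at hxy
      rw [hxy]; exact Relation.EqvGen.refl _)
    (by
      intro i t hi hc hfi hfr ⟨ih1, ih2⟩
      rw [hN s1 f1] at hi
      have ft : ∀ b, b ∉ [7, 30, 31, 32, 33, 99] → t.ints b = s.ints b := by
        intro b hb
        rw [← f1 b hb]
        simp only [List.mem_cons, List.not_mem_nil, or_false, not_or] at hb
        exact hfi b (by omega) (by simp [writesInt, assign, when, skip]; omega)
      have ftr : t.reals = s.reals := by
        rw [← f1r]; funext b; exact hfr b (by simp [writesReal, assign, when, skip])
      obtain ⟨hb, hAB⟩ := h t i ft ftr hc hi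
      by_cases hp : p i
      · obtain ⟨hA, hB, hαn, hβn⟩ := hAB hp
        rw [run_when_pos (hb.2 hp)]
        -- Both labels are copied before the relabelling starts, since it overwrites the label of
        -- `β`.
        obtain ⟨la, hla⟩ : ∃ la, la = t.ints 7 (α i) := ⟨_, rfl⟩
        obtain ⟨lb, hlb⟩ : ∃ lb, lb = t.ints 7 (β i) := ⟨_, rfl⟩
        obtain ⟨t1, ht1⟩ : ∃ t1, t1 = (assign 33 (.get 7 B)).run ((assign 32 (.get 7 A)).run t) :=
          ⟨_, rfl⟩
        have hB' : B.eval (t.setInt 32 0 (t.ints 7 (α i))) = β i := by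
          have := (h (t.setInt 32 0 (t.ints 7 (α i))) i (fun b hb => by
            rw [ints_setInt_ne, ft b hb]
            rintro rfl; simp at hb) ftr (by simp [hc]) hi).2 hp
          exact this.2.1
        have ht1' : t1 = (t.setInt 32 0 la).setInt 33 0 lb := by
          rw [ht1, hla, hlb]
          simp [IntExpr.eval, hA, hB']
        have hrel := run_iter (a := 31) (N := numV) (s := t1)
          (P := when (.eqInt (.get 7 (var 31)) (var 33)) (setInt 7 (var 31) (var 32)))
          (fun i' t' => ∀ x, t'.ints 7 x =
            if x < i' ∧ t.ints 7 x = lb then la else t.ints 7 x)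
          (by intro x; simp [ht1'])
          (by
            intro i' t' hi' hc' hfi' hfr' ih' x
            have e32 : t'.ints 32 0 = la := by
              rw [hfi' 32 (by norm_num) (by decide), ht1']; simp
            have e33 : t'.ints 33 0 = lb := by
              rw [hfi' 33 (by norm_num) (by decide), ht1']; simp
            -- Position `i'` has not been visited yet and still carries its old label.
            have hi7 := ih' i'
            simp only [lt_irrefl, false_and, if_false] at hi7
            by_cases hl : t.ints 7 i' = lb
            · rw [run_when_pos (by simp [IntExpr.eval, hc', e33, hi7, hl])]
              simp only [run_setInt, eval_var, hc', e32, ints_setInt, Nat.reduceEqDiff,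
                false_and, if_false, true_and]
              by_cases hx : x = i'
              · subst hx; simp [hl]
              · rw [if_neg hx, ih' x]
                have : x < i' + 1 ↔ x < i' := by omega
                simp [this]
            · rw [run_when_neg (by simp [IntExpr.eval, hc', e33, hi7, hl])]
              simp only [ints_setInt, Nat.reduceEqDiff, false_and, if_false]
              rw [ih' x]
              by_cases hx : x = i'
              · subst hx; simp [hl]
              · have : x < i' + 1 ↔ x < i' := by omega
                simp [this])
        have hn1 : numV.eval t1 = n := by
          rw [ht1', ← hn]; simp [ft 0 (by decide)]
        rw [hn1] at hrel
        simp only [run_seq]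
        rw [← ht1]
        set t2 := (iter 31 numV
          (when (.eqInt (.get 7 (var 31)) (var 33)) (setInt 7 (var 31) (var 32)))).run t1 with ht2
        have e7 : ∀ x, (t2.setInt 30 0 (i + 1)).ints 7 x =
            if x < n ∧ t.ints 7 x = lb then la else t.ints 7 x := by
          intro x; rw [← hrel x]; simp
        refine ⟨fun j hj hpj => ?_, fun x hx y hy hxy => ?_⟩
        · rw [e7, e7]
          by_cases hji : j = i
          · subst hji
            simp only [hαn, hβn, true_and, ← hla, ← hlb, if_true]
            split_ifs <;> rfl
          · obtain ⟨_, _, h3, h4⟩ := (h (t.setInt 30 0 j) j (fun b hb => by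
              rw [ints_setInt_ne, ft b hb]
              rintro rfl; simp at hb) ftr (by simp) (by omega)).2 hpj
            simp only [h3, h4, true_and, ih1 j (by omega) hpj]
        · rw [e7, e7] at hxy
          simp only [hx, hy, true_and] at hxy
          have hm : ∀ x y, Relation.EqvGen (fun u w => ∃ j < i, p j ∧ u = α j ∧ w = β j) x y →
              Relation.EqvGen (fun u w => ∃ j < i + 1, p j ∧ u = α j ∧ w = β j) x y :=
            fun x y => Relation.EqvGen.mono (fun u w ⟨j, hj, hj'⟩ => ⟨j, by omega, hj'⟩) x y
          have hnew : Relation.EqvGen (fun u w => ∃ j < i + 1, p j ∧ u = α j ∧ w = β j)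
              (α i) (β i) := Relation.EqvGen.rel _ _ ⟨i, by omega, hp, rfl, rfl⟩
          by_cases h1 : t.ints 7 x = lb <;> by_cases h2 : t.ints 7 y = lb
          · exact hm _ _ (ih2 x hx y hy (h1.trans h2.symm))
          · simp only [h1, h2, if_true, if_false] at hxy
            exact ((hm _ _ (ih2 x hx _ hβn (h1.trans hlb))).trans _ _ _ (hnew.symm _ _)).trans _ _ _
              (hm _ _ (ih2 _ hαn y hy (hla.symm.trans hxy)))
          · simp only [h1, h2, if_true, if_false] at hxy
            exact ((hm _ _ (ih2 x hx _ hαn (hxy.trans hla))).trans _ _ _ hnew).trans _ _ _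
              (hm _ _ (ih2 _ hβn y hy (hlb.symm.trans h2.symm)))
          · simp only [h1, h2, if_false] at hxy
            exact hm _ _ (ih2 x hx y hy hxy)
      · rw [run_when_neg (fun h => hp (hb.1 h))]
        refine ⟨fun j hj hpj => ?_, fun x hx y hy hxy => ?_⟩
        · have hji : j ≠ i := by rintro rfl; exact hp hpj
          have := ih1 j (by omega) hpj
          simpa using this
        · have := ih2 x hx y hy (by simpa using hxy)
          exact Relation.EqvGen.mono (fun u w ⟨j, hj, hj'⟩ => ⟨j, by omega, hj'⟩) x y this)
  rw [hN s1 f1] at main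
  have hker : ∀ x y, Relation.EqvGen (fun u w => ∃ j < K, p j ∧ u = α j ∧ w = β j) x y →
      ((labels N b A B).run s).ints 7 x = ((labels N b A B).run s).ints 7 y := by
    intro x y hxy
    simp only [labels, run_seq]
    rw [← hs1]
    induction hxy with
    | rel u w h =>
      obtain ⟨j, hj, hpj, rfl, rfl⟩ := h
      exact main.1 j hj hpj
    | refl u => rfl
    | symm u w _ ih => exact ih.symm
    | trans u v w _ _ ih1 ih2 => exact ih1.trans ih2
  intro x hx y hy
  refine ⟨fun hxy => main.2 x hx y hy ?_, hker x y⟩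
  simpa only [labels, run_seq, ← hs1] using hxy

end Stmt

end RAM

/-! ### Minimum cuts by maximum adjacency orderings -/

namespace WCut

open Finset

/-- The state of a maximum adjacency ordering of `A ∪ {k}` that starts with `k`; the vertices in
`C` are still to come, `t` is the last vertex, `s` the one before, `val` the weight of the edges
from `t` to the vertices before it. -/
structure OrderInv (M : ℕ → ℕ → ℝ) (A : Finset ℕ) (k : ℕ) (C : Finset ℕ) (key : ℕ → ℝ) (s t : ℕ)
    (val : ℝ) : Prop where
  sub : C ⊆ A
  key_eq : ∀ b ∈ A, key b = ∑ c ∈ insert k (A \ C), M b c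
  adj : Adjacent M A (insert k (A \ C)) t
  start : t = k → A \ C = ∅
  last_mem : t = k ∨ t ∈ A \ C
  card_le : s = k → (A \ C).card ≤ 1
  pendant : s ≠ k → s ∈ A ∧ t ∈ A ∧ s ≠ t ∧ val = cut M (insert k (A \ C)) {t} ∧
    ∀ S, (s ∈ S ↔ t ∉ S) → val ≤ cut M (insert k (A \ C)) S

/-- The value `k` serves as a marker. As long as `s = k`, there is no pair of vertices other than
`k` that could be contracted, and `val` has no meaning. -/
theorem orderInv_start {M : ℕ → ℕ → ℝ} (hM : ∀ a b, M a b = M b a) {A : Finset ℕ} {k : ℕ}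
    {key : ℕ → ℝ} (hkey : ∀ b ∈ A, key b = M b k) (val : ℝ) :
    OrderInv M A k A key k k val :=
  ⟨Subset.rfl, by simpa using hkey, by simpa using adjacent_start hM A k, by simp, Or.inl rfl,
    by simp, by simp⟩

/-- The key of `a` is the weight of its star among the vertices ordered so far. By adjacency this
star is a minimum cut between the previous last vertex and `a`, which is what a contraction of the
two requires. -/
theorem OrderInv.step {M : ℕ → ℕ → ℝ} (hM : ∀ a b, M a b = M b a) (h0 : ∀ a b, 0 ≤ M a b)
    {A : Finset ℕ} {k : ℕ} {C : Finset ℕ} {key key' : ℕ → ℝ} {s t : ℕ} {val : ℝ} (hk : k ∉ A)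
    (h : OrderInv M A k C key s t val) {a : ℕ} (ha : a ∈ C) (hmax : ∀ b ∈ C, key b ≤ key a)
    (hkey : ∀ b ∈ A, key' b = key b + M b a) :
    OrderInv M A k (C.erase a) key' t a (key a) := by
  have haA := h.sub ha
  have hak : a ≠ k := fun h => hk (h ▸ haA)
  have haV : a ∉ insert k (A \ C) := by simp [hak, ha]
  have hV1 : A \ C.erase a = insert a (A \ C) := by
    ext x; simp only [mem_sdiff, mem_erase, mem_insert, not_and, ne_eq]
    constructor
    · rintro ⟨h1, h2⟩
      by_cases hx : x = a
      · exact Or.inl hx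
      · exact Or.inr ⟨h1, h2 hx⟩
    · rintro (rfl | ⟨h1, h2⟩)
      · exact ⟨haA, fun h => absurd rfl h⟩
      · exact ⟨h1, fun _ => h2⟩
  have hV : insert k (A \ C.erase a) = insert a (insert k (A \ C)) := by
    rw [hV1, insert_comm]
  have hval : key a = ∑ c ∈ insert k (A \ C), M a c := h.key_eq a haA
  refine ⟨(erase_subset _ _).trans h.sub, ?_, ?_, fun h => absurd h hak, ?_, ?_, ?_⟩
  · intro b hb
    rw [hkey b hb, h.key_eq b hb, hV, sum_insert haV]; ring
  · rw [hV]
    refine adjacent_step hM h0 h.adj haA haV fun b hb hbV => ?_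
    rw [← h.key_eq b hb, ← h.key_eq a haA]
    refine hmax b ?_
    by_contra hbC
    exact hbV (by simp [hb, hbC])
  · right; rw [hV1]; exact mem_insert_self _ _
  · intro htk
    rw [hV1, h.start htk]; simp
  · intro htk
    have ht := h.last_mem.resolve_left htk
    rw [mem_sdiff] at ht
    have hta : t ≠ a := by rintro rfl; exact ht.2 ha
    refine ⟨ht.1, haA, hta, ?_, ?_⟩
    · rw [hV, cut_singleton hM haV (by simp) (by
        intro x hx; rw [mem_singleton]; rintro rfl; exact haV hx), hval]
    · intro S hS
      rw [hV, hval]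
      exact h.adj a haA haV S hS

/-- The state of the minimum cut computation: the graph `M` on `A ∪ {k}` arose from the graph `W`
on `0, …, k` by contractions, and `c` is the smallest cut so far. -/
structure MinCutInv (k : ℕ) (W M : ℕ → ℕ → ℝ) (A : Finset ℕ) (c : ℝ) : Prop where
  symm : ∀ a b, M a b = M b a
  nonneg : ∀ a b, 0 ≤ M a b
  sub : A ⊆ range k
  le_two : c ≤ 2
  lower : ∀ S ⊆ range k, S.Nonempty → S ≠ range k → c ≤ cut W (range (k + 1)) S ∨
    ∃ S' ⊆ A, S'.Nonempty ∧ S' ≠ A ∧ cut M (insert k A) S' = cut W (range (k + 1)) S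
  upper : ∀ S' ⊆ A, S'.Nonempty → S' ≠ A → ∃ S ⊆ range k, S.Nonempty ∧ S ≠ range k ∧
    cut W (range (k + 1)) S = cut M (insert k A) S'
  attained : c = 2 ∨ ∃ S ⊆ range k, S.Nonempty ∧ S ≠ range k ∧ cut W (range (k + 1)) S = c

theorem minCutInv_start {k : ℕ} {W M : ℕ → ℕ → ℝ} (hM : ∀ a b, M a b = M b a)
    (h0 : ∀ a b, 0 ≤ M a b) (h : ∀ a ≤ k, ∀ b ≤ k, M a b = W a b) :
    MinCutInv k W M (range k) 2 := by
  have e : ∀ S, cut M (insert k (range k)) S = cut W (range (k + 1)) S := by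
    intro S
    rw [← range_add_one]
    exact cut_congr fun a ha b hb _ => h a (by simpa using Nat.lt_succ_iff.1 (mem_range.1 ha)) b
      (Nat.lt_succ_iff.1 (mem_range.1 hb))
  exact ⟨hM, h0, Subset.rfl, le_rfl, fun S h1 h2 h3 => Or.inr ⟨S, h1, h2, h3, e S⟩,
    fun S h1 h2 h3 => ⟨S, h1, h2, h3, (e S).symm⟩, Or.inl rfl⟩

/-- A cut of the current graph either separates `s` from `t`, and then weighs at least `val`, or it
survives the contraction with the same weight. Conversely `val` is itself the weight of an
admissible cut, namely of `{t}`. -/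
theorem MinCutInv.step {k : ℕ} {W M M' : ℕ → ℕ → ℝ} {A : Finset ℕ} {c val : ℝ}
    (h : MinCutInv k W M A c) {s t : ℕ} (hs : s ∈ A) (ht : t ∈ A) (hst : s ≠ t)
    (hval : val = cut M (insert k A) {t})
    (hle : ∀ S, (s ∈ S ↔ t ∉ S) → val ≤ cut M (insert k A) S)
    (hM' : ∀ a b, M' a b = M' b a) (h0' : ∀ a b, 0 ≤ M' a b)
    (h1 : ∀ a b, a ≠ s → b ≠ s → a ≠ t → b ≠ t → M' a b = M a b)
    (h2 : ∀ b, b ≠ s → b ≠ t → M' s b = M s b + M t b) :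
    MinCutInv k W M' (A.erase t) (min c val) := by
  have hkA : k ∉ A := fun hk => by simpa using h.sub hk
  have hkt : k ≠ t := fun e => hkA (e ▸ ht)
  have hV : insert k (A.erase t) = (insert k A).erase t := by
    rw [erase_insert_of_ne hkt]
  have hmerge : ∀ S, (s ∈ S ↔ t ∈ S) → cut M' (insert k (A.erase t)) S = cut M (insert k A) S := by
    intro S hS
    rw [hV]
    exact cut_merge h.symm hM' (mem_insert_of_mem hs) (mem_insert_of_mem ht) hst h1 h2 hS
  have hsA : s ∈ A.erase t := mem_erase.2 ⟨hst, hs⟩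
  refine ⟨hM', h0', (erase_subset _ _).trans h.sub, (min_le_left _ _).trans h.le_two, ?_, ?_, ?_⟩
  · intro S hS hne hS'
    rcases h.lower S hS hne hS' with h3 | ⟨S', h3, h4, h5, h6⟩
    · exact Or.inl ((min_le_left _ _).trans h3)
    · by_cases hsep : s ∈ S' ↔ t ∈ S'
      · right
        refine ⟨S'.erase t, erase_subset_erase _ h3, ?_, ?_, ?_⟩
        · obtain ⟨x, hx⟩ := h4
          by_cases hxt : x = t
          · subst hxt; exact ⟨s, mem_erase.2 ⟨hst, hsep.2 hx⟩⟩
          · exact ⟨x, mem_erase.2 ⟨hxt, hx⟩⟩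
        · intro he
          have hsS : s ∈ S' := by
            have : s ∈ S'.erase t := by rw [he]; exact hsA
            exact mem_of_mem_erase this
          apply h5
          rw [← insert_erase (hsep.1 hsS), he, insert_erase ht]
        · rw [← h6, ← hmerge S' hsep]
          refine cut_congr_set fun a ha => ?_
          have : a ≠ t := by
            rintro rfl; rw [hV] at ha; simp at ha
          simp [this]
      · left
        rw [← h6]
        exact (min_le_right _ _).trans (hle S' (by tauto))
  · intro S' hS' hne hne'
    -- A cut of the contracted graph is pulled back by putting `t` on the side of `s`.
    obtain ⟨S'', hS''⟩ : ∃ S'', S'' = if s ∈ S' then insert t S' else S' := ⟨_, rfl⟩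
    have htS' : t ∉ S' := fun h => by simpa using hS' h
    have hsub : S'' ⊆ A := by
      rw [hS'']; split_ifs
      · exact insert_subset ht (hS'.trans (erase_subset _ _))
      · exact hS'.trans (erase_subset _ _)
    have hsup : S' ⊆ S'' := by
      rw [hS'']; split_ifs
      · exact subset_insert _ _
      · exact Subset.rfl
    have her : S''.erase t = S' := by
      rw [hS'']; split_ifs
      · exact erase_insert htS'
      · exact erase_eq_of_notMem htS'
    have hsep : s ∈ S'' ↔ t ∈ S'' := by
      rw [hS'']; split_ifs with h3 <;> simp [h3, htS', hst]
    obtain ⟨S, h3, h4, h5, h6⟩ := h.upper S'' hsub (hne.mono hsup) (by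
      intro he; apply hne'; rw [← her, he])
    refine ⟨S, h3, h4, h5, h6.trans ?_⟩
    rw [← hmerge S'' hsep]
    refine cut_congr_set fun a ha => ?_
    have : a ≠ t := by
      rintro rfl; rw [hV] at ha; simp at ha
    rw [← her]; simp [this]
  · rcases le_total c val with hcv | hcv
    · rw [min_eq_left hcv]; exact h.attained
    · rw [min_eq_right hcv, hval]
      right
      refine h.upper {t} (by simpa using ht) (singleton_nonempty _) fun he => ?_
      rw [← he, mem_singleton] at hs
      exact hst hs

theorem MinCutInv.le_cut {k : ℕ} {W M : ℕ → ℕ → ℝ} {A : Finset ℕ} {c : ℝ}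
    (h : MinCutInv k W M A c) (hA : A.card ≤ 1) {S : Finset ℕ} (hS : S ⊆ range k)
    (hne : S.Nonempty) (hS' : S ≠ range k) : c ≤ cut W (range (k + 1)) S := by
  rcases h.lower S hS hne hS' with h3 | ⟨S', h3, h4, h5, _⟩
  · exact h3
  · exact absurd (eq_of_subset_of_card_le h3 (hA.trans h4.card_pos)) h5

end WCut

/-! ### Programs for the ordering and for contractions. -/

namespace RAM

open Finset WCut

/-- The `n × n` matrix in the real array `a`. -/
noncomputable def mat (n a : ℕ) (s : State) : ℕ → ℕ → ℝ :=
  fun i j => if i < n ∧ j < n then s.reals a (pairIndex i j) else 0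

theorem mat_of_lt {n a i j : ℕ} (s : State) (hi : i < n) (hj : j < n) :
    mat n a s i j = s.reals a (pairIndex i j) := by simp [mat, hi, hj]

theorem mat_congr {n a : ℕ} {s t : State} (h : t.reals a = s.reals a) : mat n a t = mat n a s := by
  unfold mat; rw [h]

theorem mat_setReal {n a i j : ℕ} (s : State) (hi : i < n) (hj : j < n) (v : ℝ) (x y : ℕ) :
    mat n a (s.setReal a (pairIndex i j) v) x y = if x = i ∧ y = j then v else mat n a s x y := by
  unfold mat
  simp only [reals_setReal, true_and, pairIndex_inj]
  by_cases h : x = i ∧ y = j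
  · obtain ⟨rfl, rfl⟩ := h; simp [hi, hj]
  · simp [h]

namespace Stmt

/-- The read access to the entry `(i, j)` of the matrix `a`. -/
def entry (a : ℕ) (i j : IntExpr) : RealExpr := .get a (i.pair j)

/-- The write access to the entry `(i, j)` of the matrix `a`. -/
def setEntry (a : ℕ) (i j : IntExpr) (v : RealExpr) : Stmt := setReal a (i.pair j) v

@[simp] theorem eval_entry (a : ℕ) (i j : IntExpr) (s : State) :
    (entry a i j).eval s = s.reals a (pairIndex (i.eval s) (j.eval s)) := rfl

@[simp] theorem run_setEntry (a : ℕ) (i j : IntExpr) (v : RealExpr) (s : State) :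
    (setEntry a i j v).run s = s.setReal a (pairIndex (i.eval s) (j.eval s)) (v.eval s) := rfl

/-- Selects in the variable `15` a candidate with maximum key, or `n` if there is none. The
candidates are marked in the integer array `12`, their keys are in the real array `5`. -/
def select : Stmt :=
  assign 15 numV ;;
  iter 52 numV (when (.and (.ltInt (.const 0) (.get 12 (var 52)))
    (.or (.not (.ltInt (var 15) numV)) (.ltReal (.get 5 (var 15)) (.get 5 (var 52)))))
    (assign 15 (var 52)))

theorem select_spec {s : State} {n : ℕ} (hn : s.ints 0 0 = n) :
    ((select.run s).ints 15 0 = n ∧ ∀ b < n, s.ints 12 b = 0) ∨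
    ((select.run s).ints 15 0 < n ∧ s.ints 12 ((select.run s).ints 15 0) ≠ 0 ∧
      ∀ b < n, s.ints 12 b ≠ 0 → s.reals 5 b ≤ s.reals 5 ((select.run s).ints 15 0)) := by
  obtain ⟨s1, hs1⟩ : ∃ s1, s1 = (assign 15 numV).run s := ⟨_, rfl⟩
  have h12 : s1.ints 12 = s.ints 12 := by rw [hs1]; exact run_ints _ (by decide) _
  have h0 : s1.ints 0 = s.ints 0 := by rw [hs1]; exact run_ints _ (by decide) _
  have h5 : s1.reals = s.reals := by rw [hs1]; rfl
  have h15 : s1.ints 15 0 = n := by rw [hs1]; simp [hn]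
  have := run_iter (a := 52) (N := numV) (s := s1) (P := when (.and (.ltInt (.const 0) (.get 12 (var 52)))
    (.or (.not (.ltInt (var 15) numV)) (.ltReal (.get 5 (var 15)) (.get 5 (var 52)))))
    (assign 15 (var 52)))
    (fun i t => (t.ints 15 0 = n ∧ ∀ b < i, s.ints 12 b = 0) ∨
      (t.ints 15 0 < n ∧ s.ints 12 (t.ints 15 0) ≠ 0 ∧
      ∀ b < i, s.ints 12 b ≠ 0 → s.reals 5 b ≤ s.reals 5 (t.ints 15 0)))
    (by left; simp [h15])
    (by
      intro i t hi hc hfi hfr ih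
      have e12 : t.ints 12 = s.ints 12 := (hfi 12 (by norm_num) (by decide)).trans h12
      have e0 : t.ints 0 0 = n := by rw [hfi 0 (by norm_num) (by decide), h0, hn]
      have e5 : t.reals 5 = s.reals 5 := by rw [hfr 5 (by decide), h5]
      have hin : i < n := by simpa [h0, hn] using hi
      by_cases hb : Test.holds t (.and (.ltInt (.const 0) (.get 12 (var 52)))
          (.or (.not (.ltInt (var 15) numV)) (.ltReal (.get 5 (var 15)) (.get 5 (var 52)))))
      · rw [run_when_pos hb]
        simp only [Test.holds, Test.holds_or, IntExpr.eval, eval_var, hc, e12, eval_numV, e0,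
          RealExpr.eval, e5] at hb
        right
        simp only [run_assign, eval_var, hc, ints_setInt, Nat.reduceEqDiff, false_and, if_false,
          and_self, if_true]
        refine ⟨hin, hb.1.ne', fun b hbi hb0 => ?_⟩
        by_cases hbi' : b = i
        · rw [hbi']
        · rcases ih with ⟨_, ih2⟩ | ⟨ih1, _, ih3⟩
          · exact absurd (ih2 b (by omega)) hb0
          · rcases hb.2 with h | h
            · exact absurd ih1 h
            · exact (ih3 b (by omega) hb0).trans h.le
      · rw [run_when_neg hb]
        simp only [Test.holds, Test.holds_or, IntExpr.eval, eval_var, hc, e12, eval_numV, e0,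
          RealExpr.eval, e5, not_and, not_or, not_lt] at hb
        simp only [ints_setInt, Nat.reduceEqDiff, false_and, if_false]
        rcases ih with ⟨ih1, ih2⟩ | ⟨ih1, ih2, ih3⟩
        · left
          refine ⟨ih1, fun b hbi => ?_⟩
          by_cases hbi' : b = i
          · subst hbi'
            by_contra h0
            have := (hb (Nat.pos_of_ne_zero h0)).1
            omega
          · exact ih2 b (by omega)
        · right
          refine ⟨ih1, ih2, fun b hbi hb0 => ?_⟩
          by_cases hbi' : b = i
          · subst hbi'
            exact (hb (Nat.pos_of_ne_zero hb0)).2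
          · exact ih3 b (by omega) hb0)
  have e : numV.eval s1 = n := by rw [eval_numV, h0, hn]
  rw [e] at this
  simpa only [select, run_seq, ← hs1] using this

/-- One step of the maximum adjacency ordering. -/
def orderStep : Stmt :=
  select ;;
  when (.ltInt (var 15) numV) (
    assign 13 (var 14) ;;
    assign 14 (var 15) ;;
    rassign 6 (.get 5 (var 15)) ;;
    setInt 12 (var 15) (.const 0) ;;
    iter 52 numV (setReal 5 (var 52)
      (.add (.get 5 (var 52)) (entry 4 (var 52) (var 15)))))

/-- The candidates in the maximum adjacency ordering. -/
def candidates (n : ℕ) (s : State) : Finset ℕ := (range n).filter fun b => s.ints 12 b ≠ 0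

/-- The program variables describe a maximum adjacency ordering. -/
def OrderState (n : ℕ) (M : ℕ → ℕ → ℝ) (A : Finset ℕ) (k : ℕ) (s : State) : Prop :=
  OrderInv M A k (candidates n s) (s.reals 5) (s.ints 13 0) (s.ints 14 0) (s.reals 6 0)

/-- The truncated subtraction covers the case without candidates, in which the step is idle. So a
fixed number of `n` rounds works for every size of `A`. -/
theorem orderStep_spec {s : State} {n k : ℕ} {A : Finset ℕ} (hn : s.ints 0 0 = n)
    (hM : ∀ a b, mat n 4 s a b = mat n 4 s b a) (h0 : ∀ a b, 0 ≤ mat n 4 s a b) (hkA : k ∉ A)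
    (hA : A ⊆ range n) (h : OrderState n (mat n 4 s) A k s) :
    OrderState n (mat n 4 s) A k (orderStep.run s) ∧
      (candidates n (orderStep.run s)).card ≤ (candidates n s).card - 1 := by
  obtain ⟨s1, hs1⟩ : ∃ s1, s1 = select.run s := ⟨_, rfl⟩
  have hf : ∀ b, b ≠ 15 → b ≠ 52 → b ≠ 99 → s1.ints b = s.ints b := by
    intro b h1 h2 h3
    rw [hs1]
    exact run_ints _ (by simp [select, writesInt, assign, when, skip]; omega) _
  have hfr : s1.reals = s.reals := by
    funext b; rw [hs1]; exact run_reals _ (by simp [select, writesReal, assign, when, skip]) _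
  have hsel := select_spec hn
  rw [← hs1] at hsel
  have hcs : candidates n s1 = candidates n s := by
    unfold candidates; rw [hf 12 (by norm_num) (by norm_num) (by norm_num)]
  simp only [orderStep, run_seq]
  rw [← hs1]
  rcases hsel with ⟨h1, h2⟩ | ⟨h1, h2, h3⟩
  · rw [run_when_neg (by simp [Test.holds, h1, hf, hn])]
    have hC0 : candidates n s = ∅ := by
      unfold candidates; rw [filter_eq_empty_iff]; simpa using h2
    have hc' : candidates n (s1.setInt 99 0 0) = candidates n s := by
      rw [← hcs]; simp [candidates]
    refine ⟨?_, by rw [hc', hC0]; simp⟩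
    unfold OrderState at h ⊢
    rw [hc']
    simpa [hfr, hf] using h
  · rw [run_when_pos (by simp [Test.holds, hf, hn, h1])]
    obtain ⟨σ, hσ⟩ : ∃ σ, σ = s1.ints 15 0 := ⟨_, rfl⟩
    rw [← hσ] at h1 h2 h3
    obtain ⟨s2, hs2⟩ : ∃ s2, s2 = (setInt 12 (var 15) (.const 0)).run ((rassign 6 (.get 5 (var 15))).run
      ((assign 14 (var 15)).run ((assign 13 (var 14)).run s1))) := ⟨_, rfl⟩
    have hs2' : s2 = (((s1.setInt 13 0 (s.ints 14 0)).setInt 14 0 σ).setReal 6 0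
        (s.reals 5 σ)).setInt 12 σ 0 := by
      rw [hs2]
      simp [RealExpr.eval, IntExpr.eval, ← hσ, hfr, hf]
    simp only [run_seq]
    rw [← hs2]
    have hk := run_iter (a := 52) (N := numV) (s := s2) (P := setReal 5 (var 52)
      (.add (.get 5 (var 52)) (entry 4 (var 52) (var 15))))
      (fun i t => ∀ b, t.reals 5 b =
        if b < i then s.reals 5 b + s.reals 4 (pairIndex b σ) else s.reals 5 b)
      (by intro b; simp [hs2', hfr])
      (by
        intro i t hi hc hfi hfr' ih b
        have e15 : t.ints 15 0 = σ := by
          rw [hfi 15 (by norm_num) (by decide), hs2']; simp [hσ]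
        have e4 : t.reals 4 = s.reals 4 := by
          rw [hfr' 4 (by decide), hs2']; funext j; simp [hfr]
        have hi5 := ih i
        rw [if_neg (lt_irrefl _)] at hi5
        simp only [run_setReal, RealExpr.eval, eval_var, eval_entry, hc, e15, e4, reals_setInt,
          reals_setReal, true_and, hi5]
        by_cases hb : b = i
        · subst hb; simp
        · rw [if_neg hb, ih b]
          have : b < i + 1 ↔ b < i := by omega
          simp [this])
    have e : numV.eval s2 = n := by rw [eval_numV, hs2']; simp [hf, hn]
    rw [e] at hk
    obtain ⟨s3, hs3⟩ : ∃ s3, s3 = (iter 52 numV (setReal 5 (var 52)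
      (.add (.get 5 (var 52)) (entry 4 (var 52) (var 15))))).run s2 := ⟨_, rfl⟩
    rw [← hs3] at hk ⊢
    have g13 : s3.ints 13 0 = s.ints 14 0 := by
      rw [hs3, run_ints _ (by decide), hs2']; simp
    have g14 : s3.ints 14 0 = σ := by
      rw [hs3, run_ints _ (by decide), hs2']; simp
    have g6 : s3.reals 6 0 = s.reals 5 σ := by
      rw [hs3, run_reals _ (by decide), hs2']; simp
    have hσC : σ ∈ candidates n s := by simp [candidates, h1, h2]
    have gC : candidates n s3 = (candidates n s).erase σ := by
      ext b
      have : s3.ints 12 b = if b = σ then 0 else s.ints 12 b := by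
        rw [hs3, run_ints _ (by decide), hs2']; simp [hf]
      simp only [candidates, mem_filter, mem_erase, this]
      by_cases hb : b = σ <;> simp [hb]
    refine ⟨?_, by rw [gC, card_erase_of_mem hσC]⟩
    unfold OrderState
    rw [gC, g13, g14, g6]
    refine OrderInv.step hM h0 hkA h hσC ?_ ?_
    · intro b hb
      simp only [candidates, mem_filter, mem_range] at hb
      exact h3 b hb.1 hb.2
    · intro b hb
      have hbn : b < n := mem_range.1 (hA hb)
      rw [hk b, if_pos hbn, mat_of_lt s hbn h1]

/-- Merges the vertex in the variable `14` into the vertex in the variable `13`. -/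
def merge : Stmt :=
  setInt 11 (var 14) (.const 0) ;;
  iter 52 numV (
    setEntry 4 (var 13) (var 52) (.add (entry 4 (var 13) (var 52)) (entry 4 (var 14) (var 52))) ;;
    setEntry 4 (var 52) (var 13) (entry 4 (var 13) (var 52)))

/-- The entries in the row and column of `y`, and the diagonal entry of `x`, end up with values that
mean nothing. They are excluded here and irrelevant for cuts of the remaining graph; only symmetry
and nonnegativity are kept for all entries. -/
theorem merge_spec {s : State} {n x y : ℕ} (hn : s.ints 0 0 = n)
    (hM : ∀ a b, mat n 4 s a b = mat n 4 s b a) (h0 : ∀ a b, 0 ≤ mat n 4 s a b)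
    (hx : s.ints 13 0 = x) (hy : s.ints 14 0 = y) (hxn : x < n) (hyn : y < n) (hxy : x ≠ y) :
    (∀ a b, mat n 4 (merge.run s) a b = mat n 4 (merge.run s) b a) ∧
    (∀ a b, 0 ≤ mat n 4 (merge.run s) a b) ∧
    (∀ a b, a ≠ x → b ≠ x → a ≠ y → b ≠ y → mat n 4 (merge.run s) a b = mat n 4 s a b) ∧
    (∀ b, b ≠ x → b ≠ y → mat n 4 (merge.run s) x b = mat n 4 s x b + mat n 4 s y b) := by
  obtain ⟨s1, hs1⟩ : ∃ s1, s1 = (setInt 11 (var 14) (.const 0)).run s := ⟨_, rfl⟩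
  have hf : ∀ b, b ≠ 11 → s1.ints b = s.ints b := by
    intro b h1
    rw [hs1]
    exact run_ints _ (by simp [writesInt]; omega) _
  have hfr : mat n 4 s1 = mat n 4 s := by rw [hs1]; rfl
  have := run_iter (a := 52) (N := numV) (s := s1) (P := setEntry 4 (var 13) (var 52)
      (.add (entry 4 (var 13) (var 52)) (entry 4 (var 14) (var 52))) ;;
    setEntry 4 (var 52) (var 13) (entry 4 (var 13) (var 52)))
    (fun i t => (∀ a b, mat n 4 t a b = mat n 4 t b a) ∧ (∀ a b, 0 ≤ mat n 4 t a b) ∧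
      (∀ a b, a ≠ x → b ≠ x → mat n 4 t a b = mat n 4 s a b) ∧
      (∀ b < i, b ≠ x → b ≠ y → mat n 4 t x b = mat n 4 s x b + mat n 4 s y b) ∧
      (∀ b, i ≤ b → b ≠ x → b ≠ y → mat n 4 t x b = mat n 4 s x b))
    (by
      have : mat n 4 (s1.setInt 52 0 0) = mat n 4 s := hfr
      simp only [this]
      exact ⟨hM, h0, fun _ _ _ _ => trivial, fun b hb => by omega, fun _ _ _ _ => trivial⟩)
    (by
      intro i t hi hc hfi hfr' ⟨ih1, ih2, ih3, ih4, ih5⟩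
      have hin : i < n := by rwa [eval_numV, hf 0 (by norm_num), hn] at hi
      have e13 : t.ints 13 0 = x := by
        rw [hfi 13 (by norm_num) (by decide), hf 13 (by norm_num), hx]
      have e14 : t.ints 14 0 = y := by
        rw [hfi 14 (by norm_num) (by decide), hf 14 (by norm_num), hy]
      have hv : ∀ a b, mat n 4 ((((setEntry 4 (var 13) (var 52)
          (.add (entry 4 (var 13) (var 52)) (entry 4 (var 14) (var 52))) ;;
          setEntry 4 (var 52) (var 13) (entry 4 (var 13) (var 52))).run t)).setInt 52 0 (i + 1)) a b =
          if (a = x ∧ b = i) ∨ (a = i ∧ b = x) then mat n 4 t x i + mat n 4 t y i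
          else mat n 4 t a b := by
        intro a b
        change mat n 4 ((setEntry 4 (var 13) (var 52)
          (.add (entry 4 (var 13) (var 52)) (entry 4 (var 14) (var 52))) ;;
          setEntry 4 (var 52) (var 13) (entry 4 (var 13) (var 52))).run t) a b = _
        simp only [run_seq, run_setEntry, eval_var, e13, hc, RealExpr.eval, eval_entry, e14,
          ints_setReal, reals_setReal, and_self, if_true]
        rw [mat_setReal _ hin hxn, mat_setReal _ hxn hin, mat_of_lt t hxn hin, mat_of_lt t hyn hin]
        by_cases c1 : a = i ∧ b = x <;> by_cases c2 : a = x ∧ b = i <;> simp [c1, c2]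
      simp only [hv]
      refine ⟨fun a b => ?_, fun a b => ?_, fun a b ha hb => ?_, fun b hb hbx hby => ?_,
        fun b hb hbx hby => ?_⟩
      · rw [ih1 a b]; congr 1; apply propext; tauto
      · split_ifs
        · exact add_nonneg (ih2 _ _) (ih2 _ _)
        · exact ih2 _ _
      · rw [if_neg (by tauto), ih3 a b ha hb]
      · by_cases hbi : b = i
        · subst hbi
          rw [if_pos (by tauto), ih5 b le_rfl hbx hby, ih3 y b hxy.symm hbx]
        · rw [if_neg (by tauto), ih4 b (by omega) hbx hby]
      · rw [if_neg (by omega), ih5 b (by omega) hbx hby])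
  have e : numV.eval s1 = n := by rw [eval_numV, hf 0 (by norm_num), hn]
  rw [e] at this
  simp only [merge, run_seq, ← hs1]
  obtain ⟨h1, h2, h3, h4, h5⟩ := this
  refine ⟨h1, h2, fun a b ha hb _ _ => h3 a b ha hb, fun b hbx hby => ?_⟩
  by_cases hb : b < n
  · exact h4 b hb hbx hby
  · rw [h5 b (by omega) hbx hby]
    have : mat n 4 s y b = 0 := by simp [mat, hb]
    rw [this, add_zero]

end Stmt

end RAM

/-! ### The minimum cut program. -/

namespace RAM

open Finset WCut

namespace Stmt

/-- Prepares the maximum adjacency ordering. -/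
def startOrder : Stmt :=
  iter 52 numV (setInt 12 (var 52) (.get 11 (var 52)) ;;
    setReal 5 (var 52) (entry 4 (var 52) (var 10))) ;;
  assign 13 (var 10) ;;
  assign 14 (var 10)

/-- Uses the last two vertices of the maximum adjacency ordering. -/
def finishOrder : Stmt :=
  when (.not (.eqInt (var 13) (var 10))) (
    when (.ltReal (rvar 6) (rvar 8)) (rassign 8 (rvar 6)) ;;
    merge)

/-- One phase of the minimum cut computation. -/
def minCutPhase : Stmt := startOrder ;; iter 51 numV orderStep ;; finishOrder

/-- Computes, in the real variable `8`, the smaller one of `2` and the smallest weight of a cut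
`δ(S)` with `∅ ≠ S ⊂ {0, …, k - 1}` in the graph on `0, …, k`, where `k` is in the variable `10`
and the weights are in the real matrix `2`. -/
def minCut : Stmt :=
  iter 52 numV (iter 53 numV (setEntry 4 (var 52) (var 53) (entry 2 (var 52) (var 53)))) ;;
  iter 52 numV (cond (.ltInt (var 52) (var 10)) (setInt 11 (var 52) (.const 1))
    (setInt 11 (var 52) (.const 0))) ;;
  rassign 8 (rconst 2) ;;
  iter 50 numV minCutPhase

/-- The vertices that have not been merged into other ones. -/
def active (n : ℕ) (s : State) : Finset ℕ := (range n).filter fun b => s.ints 11 b ≠ 0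

theorem startOrder_spec {s : State} {n k : ℕ} (hn : s.ints 0 0 = n) (hk : s.ints 10 0 = k)
    (hkn : k < n) (hM : ∀ a b, mat n 4 s a b = mat n 4 s b a) :
    OrderState n (mat n 4 s) (active n s) k (startOrder.run s) ∧
      candidates n (startOrder.run s) = active n s := by
  obtain ⟨s1, hs1⟩ : ∃ s1, s1 = (iter 52 numV (setInt 12 (var 52) (.get 11 (var 52)) ;;
    setReal 5 (var 52) (entry 4 (var 52) (var 10)))).run s := ⟨_, rfl⟩
  have := run_iter (a := 52) (N := numV) (s := s) (P := setInt 12 (var 52) (.get 11 (var 52)) ;;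
    setReal 5 (var 52) (entry 4 (var 52) (var 10)))
    (fun i t => ∀ b < i, t.ints 12 b = s.ints 11 b ∧ t.reals 5 b = s.reals 4 (pairIndex b k))
    (by simp)
    (by
      intro i t hi hc hfi hfr ih b hb
      have e10 : t.ints 10 0 = k := by rw [hfi 10 (by norm_num) (by decide), hk]
      have e11 : t.ints 11 = s.ints 11 := hfi 11 (by norm_num) (by decide)
      have e4 : t.reals 4 = s.reals 4 := hfr 4 (by decide)
      by_cases hbi : b = i
      · subst hbi
        simp [IntExpr.eval, hc, e10, e11, e4]
      · simpa [IntExpr.eval, hc, hbi] using ih b (by omega))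
  rw [eval_numV, hn, ← hs1] at this
  have e12 : ∀ b < n, (startOrder.run s).ints 12 b = s.ints 11 b := by
    intro b hb
    rw [← (this b hb).1, hs1]; simp [startOrder]
  have e5 : ∀ b < n, (startOrder.run s).reals 5 b = s.reals 4 (pairIndex b k) := by
    intro b hb
    rw [← (this b hb).2, hs1]; simp [startOrder]
  have e10 : s1.ints 10 = s.ints 10 := by rw [hs1, run_ints _ (by decide)]
  have e13 : (startOrder.run s).ints 13 0 = k := by
    simp [startOrder, ← hs1, e10, hk]
  have e14 : (startOrder.run s).ints 14 0 = k := by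
    simp [startOrder, ← hs1, e10, hk]
  have hC : candidates n (startOrder.run s) = active n s := by
    unfold candidates active
    exact filter_congr fun b hb => by rw [e12 b (mem_range.1 hb)]
  refine ⟨?_, hC⟩
  unfold OrderState
  rw [hC, e13, e14]
  refine orderInv_start hM (fun b hb => ?_) _
  have hb' : b < n := by
    simp only [active, mem_filter, mem_range] at hb; exact hb.1
  rw [e5 b hb', mat_of_lt s hb' hkn]

theorem order_spec {s : State} {n k : ℕ} {A : Finset ℕ} (hn : s.ints 0 0 = n)
    (hM : ∀ a b, mat n 4 s a b = mat n 4 s b a) (h0 : ∀ a b, 0 ≤ mat n 4 s a b) (hkA : k ∉ A)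
    (hA : A ⊆ range n) (h : OrderState n (mat n 4 s) A k s) :
    OrderState n (mat n 4 s) A k ((iter 51 numV orderStep).run s) ∧
      candidates n ((iter 51 numV orderStep).run s) = ∅ := by
  have hset : ∀ (t : State) (v : ℕ), OrderState n (mat n 4 s) A k t →
      OrderState n (mat n 4 s) A k (t.setInt 51 0 v) := by
    intro t v ht
    unfold OrderState candidates at ht ⊢
    simpa using ht
  have hset' : ∀ (t : State) (v : ℕ), candidates n (t.setInt 51 0 v) = candidates n t := by
    intro t v; simp [candidates]
  have := run_iter (a := 51) (N := numV) (s := s) (P := orderStep)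
    (fun i t => OrderState n (mat n 4 s) A k t ∧ (candidates n t).card + i ≤ n ∨
      OrderState n (mat n 4 s) A k t ∧ candidates n t = ∅)
    (by
      left
      refine ⟨hset _ _ h, ?_⟩
      rw [hset', add_zero]
      exact (card_le_card (filter_subset _ _)).trans (by simp))
    (by
      intro i t hi hc hfi hfr ih
      have e0 : t.ints 0 0 = n := by rw [hfi 0 (by norm_num) (by decide), hn]
      have e4 : mat n 4 t = mat n 4 s := mat_congr (hfr 4 (by decide))
      have hO : OrderState n (mat n 4 s) A k t := by rcases ih with h | h; exacts [h.1, h.1]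
      have hst := orderStep_spec e0 (by rwa [e4]) (by rwa [e4]) hkA hA (by rwa [e4])
      rw [e4] at hst
      simp only [hset']
      rcases ih with ⟨_, ih⟩ | ⟨_, ih⟩
      · by_cases hz : candidates n t = ∅
        · right
          refine ⟨hset _ _ hst.1, ?_⟩
          rw [← card_eq_zero]
          rw [hz, card_empty] at hst
          omega
        · left
          have := card_pos.2 (nonempty_iff_ne_empty.2 hz)
          exact ⟨hset _ _ hst.1, by omega⟩
      · right
        refine ⟨hset _ _ hst.1, ?_⟩
        rw [← card_eq_zero]
        rw [ih, card_empty] at hst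
        omega)
  rw [eval_numV, hn] at this
  rcases this with ⟨h1, h2⟩ | h1
  · exact ⟨h1, by rw [← card_eq_zero]; omega⟩
  · exact h1

/-- With at least two active vertices a phase contracts one of them. With at most one, the ordering
ends with the marker `s = k`, and nothing relevant changes. -/
theorem minCutPhase_spec {s : State} {n k : ℕ} {W : ℕ → ℕ → ℝ} (hn : s.ints 0 0 = n)
    (hk : s.ints 10 0 = k) (hkn : k < n)
    (h : MinCutInv k W (mat n 4 s) (active n s) (s.reals 8 0)) :
    MinCutInv k W (mat n 4 (minCutPhase.run s)) (active n (minCutPhase.run s))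
        ((minCutPhase.run s).reals 8 0) ∧
      ((active n (minCutPhase.run s)).card ≤ 1 ∨
        (active n (minCutPhase.run s)).card + 1 ≤ (active n s).card) := by
  obtain ⟨s1, hs1⟩ : ∃ s1, s1 = startOrder.run s := ⟨_, rfl⟩
  obtain ⟨s2, hs2⟩ : ∃ s2, s2 = (iter 51 numV orderStep).run s1 := ⟨_, rfl⟩
  have hkA : k ∉ active n s := fun h' => by simpa using h.sub h'
  have hA : active n s ⊆ range n := filter_subset _ _
  have m1 : mat n 4 s1 = mat n 4 s := mat_congr (by rw [hs1, run_reals _ (by decide)])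
  have m2 : mat n 4 s2 = mat n 4 s := by
    rw [← m1]; exact mat_congr (by rw [hs2, run_reals _ (by decide)])
  have n1 : s1.ints 0 0 = n := by rw [hs1, run_ints _ (by decide), hn]
  have n2 : s2.ints 0 0 = n := by rw [hs2, run_ints _ (by decide), n1]
  have k2 : s2.ints 10 0 = k := by
    rw [hs2, run_ints _ (by decide), hs1, run_ints _ (by decide), hk]
  have a2 : s2.ints 11 = s.ints 11 := by
    rw [hs2, run_ints _ (by decide), hs1, run_ints _ (by decide)]
  have c2 : s2.reals 8 = s.reals 8 := by
    rw [hs2, run_reals _ (by decide), hs1, run_reals _ (by decide)]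
  obtain ⟨st1, -⟩ := startOrder_spec hn hk hkn h.symm
  rw [← hs1, ← m1] at st1
  obtain ⟨st2, hC⟩ := order_spec n1 (by rw [m1]; exact h.symm) (by rw [m1]; exact h.nonneg) hkA hA st1
  rw [← hs2] at st2 hC
  unfold OrderState at st2
  rw [hC, m1] at st2
  have e : minCutPhase.run s = finishOrder.run s2 := by simp [minCutPhase, hs1, hs2]
  have act2 : active n s2 = active n s := by unfold active; rw [a2]
  rw [e]
  by_cases hsk : s2.ints 13 0 = k
  · have hr : finishOrder.run s2 = s2.setInt 99 0 0 := by
      unfold finishOrder; exact run_when_neg (by simp [Test.holds, hsk, k2]) _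
    have hact : active n (finishOrder.run s2) = active n s := by
      rw [hr, ← act2]; simp [active]
    rw [hact]
    refine ⟨?_, Or.inl (by simpa using st2.card_le hsk)⟩
    rw [hr]
    have : mat n 4 (s2.setInt 99 0 0) = mat n 4 s2 := rfl
    rw [this, m2, reals_setInt, c2]
    exact h
  · obtain ⟨p1, p2, p3, p4, p5⟩ := st2.pendant hsk
    rw [sdiff_empty] at p4 p5
    obtain ⟨x, hx⟩ : ∃ x, x = s2.ints 13 0 := ⟨_, rfl⟩
    obtain ⟨y, hy⟩ : ∃ y, y = s2.ints 14 0 := ⟨_, rfl⟩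
    rw [← hx] at hsk
    rw [← hx, ← hy] at p3 p5
    rw [← hx] at p1
    rw [← hy] at p2 p4
    obtain ⟨s3, hs3⟩ : ∃ s3, s3 = (when (.ltReal (rvar 6) (rvar 8)) (rassign 8 (rvar 6))).run s2 :=
      ⟨_, rfl⟩
    have hr : finishOrder.run s2 = merge.run s3 := by
      unfold finishOrder
      rw [run_when_pos (by simp [Test.holds, ← hx, hsk, k2]), run_seq, hs3]
    have f3 : ∀ b, b ≠ 99 → s3.ints b = s2.ints b := by
      intro b hb
      rw [hs3]
      exact run_ints _ (by simp [writesInt, when, skip, assign, rassign]; omega) _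
    have m3 : mat n 4 s3 = mat n 4 s := by
      rw [← m2]; exact mat_congr (by rw [hs3, run_reals _ (by decide)])
    have c3 : s3.reals 8 0 = min (s.reals 8 0) (s2.reals 6 0) := by
      rw [hs3]
      by_cases hlt : s2.reals 6 0 < s2.reals 8 0
      · rw [run_when_pos (by simpa [Test.holds] using hlt)]
        rw [c2] at hlt
        simp [hlt.le]
      · rw [run_when_neg (by simpa [Test.holds] using hlt)]
        rw [c2] at hlt
        simp [c2, not_lt.1 hlt]
    have hxn : x < n := mem_range.1 (hA p1)
    have hyn : y < n := mem_range.1 (hA p2)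
    obtain ⟨q1, q2, q3, q4⟩ := merge_spec (s := s3) (n := n) (x := x) (y := y)
      (by rw [f3 0 (by norm_num), n2]) (by rw [m3]; exact h.symm) (by rw [m3]; exact h.nonneg)
      (by rw [f3 13 (by norm_num), hx]) (by rw [f3 14 (by norm_num), hy]) hxn hyn p3
    rw [← hr, m3] at q3 q4
    rw [← hr] at q1 q2
    have hact : active n (finishOrder.run s2) = (active n s).erase y := by
      rw [hr]
      ext b
      have : (merge.run s3).ints 11 b = if b = y then 0 else s.ints 11 b := by
        have hi : merge.run s3 = (iter 52 numV (
          setEntry 4 (var 13) (var 52) (.add (entry 4 (var 13) (var 52)) (entry 4 (var 14) (var 52))) ;;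
          setEntry 4 (var 52) (var 13) (entry 4 (var 13) (var 52)))).run
          (s3.setInt 11 y 0) := by
          simp [merge, f3, ← hy, IntExpr.eval]
        rw [hi, run_ints _ (by decide)]
        simp [f3, a2]
      simp only [active, mem_filter, mem_erase, this]
      by_cases hb : b = y <;> simp [hb]
    have c4 : (finishOrder.run s2).reals 8 0 = min (s.reals 8 0) (s2.reals 6 0) := by
      rw [hr, run_reals _ (by decide), c3]
    rw [hact, c4]
    refine ⟨h.step p1 p2 p3 p4 p5 q1 q2 q3 q4, Or.inr ?_⟩
    rw [card_erase_of_mem p2]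
    have := card_pos.2 ⟨y, p2⟩
    omega

/-- Every ordering starts in `k`, and `k` is never contracted. When one active vertex is left, the
only cut not accounted for is the star of `k`, precisely the one that the splitting operation may
violate. The cap at 2 is the initial value of the variable. -/
theorem minCut_spec {s : State} {n k : ℕ} (hn : s.ints 0 0 = n) (hk : s.ints 10 0 = k)
    (hkn : k < n) (hW : ∀ a b, mat n 2 s a b = mat n 2 s b a) (h0 : ∀ a b, 0 ≤ mat n 2 s a b) :
    (∀ S ⊆ range k, S.Nonempty → S ≠ range k →
      (minCut.run s).reals 8 0 ≤ cut (mat n 2 s) (range (k + 1)) S) ∧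
    ((minCut.run s).reals 8 0 = 2 ∨ (minCut.run s).reals 8 0 ≤ 2 ∧ ∃ S ⊆ range k, S.Nonempty ∧
      S ≠ range k ∧ cut (mat n 2 s) (range (k + 1)) S = (minCut.run s).reals 8 0) := by
  obtain ⟨s1, hs1⟩ : ∃ s1, s1 = (iter 52 numV (iter 53 numV
    (setEntry 4 (var 52) (var 53) (entry 2 (var 52) (var 53))))).run s := ⟨_, rfl⟩
  have hcopy := run_iter (a := 52) (N := numV) (s := s) (P := iter 53 numV
    (setEntry 4 (var 52) (var 53) (entry 2 (var 52) (var 53))))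
    (fun i t => ∀ a < i, ∀ b < n, t.reals 4 (pairIndex a b) = s.reals 2 (pairIndex a b))
    (by simp)
    (by
      intro i t hi hc hfi hfr ih
      have := run_iter (a := 53) (N := numV) (s := t)
        (P := setEntry 4 (var 52) (var 53) (entry 2 (var 52) (var 53)))
        (fun j t' => (∀ a < i, ∀ b < n, t'.reals 4 (pairIndex a b) = s.reals 2 (pairIndex a b)) ∧
          ∀ b < j, t'.reals 4 (pairIndex i b) = s.reals 2 (pairIndex i b))
        (by refine ⟨?_, by simp⟩; simpa using ih)
        (by
          intro j t' hj hc' hfi' hfr' ⟨ih1, ih2⟩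
          have e52 : t'.ints 52 0 = i := by rw [hfi' 52 (by norm_num) (by decide), hc]
          have e2 : t'.reals 2 = s.reals 2 := by rw [hfr' 2 (by decide), hfr 2 (by decide)]
          simp only [run_setEntry, eval_var, e52, hc', eval_entry, e2, reals_setInt, reals_setReal,
            true_and, pairIndex_inj]
          refine ⟨fun a ha b hb => ?_, fun b hb => ?_⟩
          · rw [if_neg (by omega)]; exact ih1 a ha b hb
          · by_cases hbj : b = j
            · subst hbj; simp
            · rw [if_neg (by omega)]; exact ih2 b (by omega))
      have e : numV.eval t = n := by rw [eval_numV, hfi 0 (by norm_num) (by decide), hn]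
      rw [e] at this
      intro a ha b hb
      rw [reals_setInt]
      by_cases hai : a = i
      · subst hai; exact this.2 b hb
      · exact this.1 a (by omega) b hb)
  rw [eval_numV, hn, ← hs1] at hcopy
  have m1 : mat n 4 s1 = mat n 2 s := by
    funext a b
    unfold mat
    split_ifs with hab
    · exact hcopy a hab.1 b hab.2
    · rfl
  obtain ⟨s2, hs2⟩ : ∃ s2, s2 = (iter 52 numV (cond (.ltInt (var 52) (var 10))
    (setInt 11 (var 52) (.const 1)) (setInt 11 (var 52) (.const 0)))).run s1 := ⟨_, rfl⟩
  have n1 : s1.ints 0 0 = n := by rw [hs1, run_ints _ (by decide), hn]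
  have k1 : s1.ints 10 0 = k := by rw [hs1, run_ints _ (by decide), hk]
  have hact := run_iter (a := 52) (N := numV) (s := s1) (P := cond (.ltInt (var 52) (var 10))
    (setInt 11 (var 52) (.const 1)) (setInt 11 (var 52) (.const 0)))
    (fun i t => ∀ b < i, t.ints 11 b ≠ 0 ↔ b < k)
    (by simp)
    (by
      intro i t hi hc hfi hfr ih b hb
      have e10 : t.ints 10 0 = k := by rw [hfi 10 (by norm_num) (by decide), k1]
      by_cases hik : i < k
      · rw [run_cond_pos (by simpa [Test.holds, hc, e10] using hik)]
        by_cases hbi : b = i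
        · subst hbi; simp [hc, IntExpr.eval, hik]
        · simpa [hc, hbi] using ih b (by omega)
      · rw [run_cond_neg (by simpa [Test.holds, hc, e10] using hik)]
        by_cases hbi : b = i
        · subst hbi; simp [hc, IntExpr.eval, hik]
        · simpa [hc, hbi] using ih b (by omega))
  rw [eval_numV, n1, ← hs2] at hact
  obtain ⟨s3, hs3⟩ : ∃ s3, s3 = (rassign 8 (rconst 2)).run s2 := ⟨_, rfl⟩
  have n3 : s3.ints 0 0 = n := by
    rw [hs3, run_ints _ (by decide), hs2, run_ints _ (by decide), n1]
  have k3 : s3.ints 10 0 = k := by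
    rw [hs3, run_ints _ (by decide), hs2, run_ints _ (by decide), k1]
  have m3 : mat n 4 s3 = mat n 2 s := by
    rw [← m1]
    exact mat_congr (by rw [hs3, run_reals _ (by decide), hs2, run_reals _ (by decide)])
  have c3 : s3.reals 8 0 = 2 := by rw [hs3]; simp
  have a3 : active n s3 = range k := by
    ext b
    have : s3.ints 11 = s2.ints 11 := by rw [hs3, run_ints _ (by decide)]
    simp only [active, mem_filter, mem_range, this]
    constructor
    · rintro ⟨h1, h2⟩; exact (hact b h1).1 h2
    · intro h1; exact ⟨h1.trans hkn, (hact b (h1.trans hkn)).2 h1⟩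
  have hinv : MinCutInv k (mat n 2 s) (mat n 4 s3) (active n s3) (s3.reals 8 0) := by
    rw [a3, c3, m3]
    exact minCutInv_start hW h0 fun _ _ _ _ => rfl
  have hfin := run_iter (a := 50) (N := numV) (s := s3) (P := minCutPhase)
    (fun i t => MinCutInv k (mat n 2 s) (mat n 4 t) (active n t) (t.reals 8 0) ∧
      ((active n t).card ≤ 1 ∨ (active n t).card + i ≤ n))
    (by
      have ea : active n (s3.setInt 50 0 0) = active n s3 := by simp [active]
      rw [ea]
      refine ⟨hinv, Or.inr ?_⟩
      rw [a3, card_range]; omega)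
    (by
      intro i t hi hc hfi hfr ⟨ih1, ih2⟩
      obtain ⟨h1, h2⟩ := minCutPhase_spec (s := t) (n := n) (k := k)
        (by rw [hfi 0 (by norm_num) (by decide), n3])
        (by rw [hfi 10 (by norm_num) (by decide), k3]) hkn ih1
      have ea : active n ((minCutPhase.run t).setInt 50 0 (i + 1)) = active n (minCutPhase.run t) := by
        simp [active]
      rw [ea]
      exact ⟨h1, by omega⟩)
  rw [eval_numV, n3] at hfin
  have e : minCut.run s = (iter 50 numV minCutPhase).run s3 := by
    simp [minCut, hs1, hs2, hs3]
  rw [e]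
  obtain ⟨h1, h2⟩ := hfin
  refine ⟨fun S hS hne hS' => h1.le_cut (by omega) hS hne hS', ?_⟩
  rcases h1.attained with h3 | h3
  · exact Or.inl h3
  · exact Or.inr ⟨h1.le_two, h3⟩

end Stmt

end RAM

/-! ### Splitting off and elimination of vertices as programs. -/

namespace RAM

open Finset WCut

namespace Stmt

/-- Adds `v` to the weight of the edge `ab` in the real matrix `2`. -/
def incrEdge (a b : IntExpr) (v : RealExpr) : Stmt :=
  setEntry 2 a b (.add (entry 2 a b) v) ;; setEntry 2 b a (entry 2 a b)

theorem incrEdge_spec {s : State} {n : ℕ} {a b : IntExpr} {v : RealExpr} {x y : ℕ} {δ : ℝ}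
    (hx : ∀ t : State, t.ints = s.ints → a.eval t = x)
    (hy : ∀ t : State, t.ints = s.ints → b.eval t = y) (hv : v.eval s = δ) (hxn : x < n)
    (hyn : y < n) (hxy : x ≠ y) (hM : ∀ a b, mat n 2 s a b = mat n 2 s b a) :
    mat n 2 ((incrEdge a b v).run s) = addEdge (mat n 2 s) x y δ := by
  funext i j
  have hx' : ∀ c (v : ℝ), a.eval (s.setReal 2 c v) = x := fun _ _ => hx _ rfl
  have hy' : ∀ c (v : ℝ), b.eval (s.setReal 2 c v) = y := fun _ _ => hy _ rfl
  simp only [incrEdge, run_seq, run_setEntry, hx s rfl, hy s rfl, hx', hy', RealExpr.eval,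
    eval_entry, hv, reals_setReal, and_self, if_true]
  rw [mat_setReal _ hyn hxn, mat_setReal _ hxn hyn]
  unfold addEdge
  by_cases c1 : i = x ∧ j = y
  · obtain ⟨rfl, rfl⟩ := c1
    simp [hxy, hxy.symm, mat_of_lt s hxn hyn]
  · by_cases c2 : i = y ∧ j = x
    · obtain ⟨rfl, rfl⟩ := c2
      simp [hM i j, mat_of_lt s hxn hyn]
    · simp [c1, c2]

theorem ints_incrEdge (a b : IntExpr) (v : RealExpr) (s : State) :
    ((incrEdge a b v).run s).ints = s.ints := rfl

/-- Splits off `v` from the edges `uk` and `wk`, where `k`, `u`, `w` are in the variables `10`,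
`16`, `17`. -/
def splitBy (v : RealExpr) : Stmt :=
  incrEdge (var 16) (var 10) (.sub (rconst 0) v) ;;
  incrEdge (var 17) (var 10) (.sub (rconst 0) v) ;;
  incrEdge (var 16) (var 17) v

theorem splitBy_spec {s : State} {n k u w : ℕ} {v : RealExpr} {δ : ℝ} (hkn : k < n)
    (hk : s.ints 10 0 = k) (hu : s.ints 16 0 = u) (hw : s.ints 17 0 = w) (huw : u < w) (hwk : w < k)
    (hv : ∀ t : State, t.ints = s.ints → (∀ b, b ≠ 2 → t.reals b = s.reals b) → v.eval t = δ)
    (hM : ∀ a b, mat n 2 s a b = mat n 2 s b a) :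
    mat n 2 ((splitBy v).run s) = split k (mat n 2 s) u w δ := by
  have hfr : ∀ (a b : IntExpr) (v : RealExpr) (s : State) (c : ℕ), c ≠ 2 →
      ((incrEdge a b v).run s).reals c = s.reals c := fun a b v s c hc =>
    run_reals _ (by simp [incrEdge, writesReal, setEntry]; omega) _
  simp only [splitBy, run_seq]
  obtain ⟨s1, hs1⟩ : ∃ s1, s1 = (incrEdge (var 16) (var 10) (.sub (rconst 0) v)).run s := ⟨_, rfl⟩
  obtain ⟨s2, hs2⟩ : ∃ s2, s2 = (incrEdge (var 17) (var 10) (.sub (rconst 0) v)).run s1 := ⟨_, rfl⟩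
  have i1 : s1.ints = s.ints := by rw [hs1, ints_incrEdge]
  have i2 : s2.ints = s.ints := by rw [hs2, ints_incrEdge, i1]
  have r1 : ∀ b, b ≠ 2 → s1.reals b = s.reals b := fun b hb => by rw [hs1, hfr _ _ _ _ _ hb]
  have r2 : ∀ b, b ≠ 2 → s2.reals b = s.reals b := fun b hb => by
    rw [hs2, hfr _ _ _ _ _ hb, r1 b hb]
  have m1 : mat n 2 s1 = addEdge (mat n 2 s) u k (-δ) := by
    rw [hs1]
    exact incrEdge_spec (fun t ht => by simp [ht, hu]) (fun t ht => by simp [ht, hk])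
      (by simp [RealExpr.eval, hv s rfl fun _ _ => rfl]) (by omega) hkn (by omega) hM
  have m2 : mat n 2 s2 = addEdge (addEdge (mat n 2 s) u k (-δ)) w k (-δ) := by
    rw [hs2, ← m1]
    refine incrEdge_spec (fun t ht => by simp [ht, i1, hw]) (fun t ht => by simp [ht, i1, hk])
      (by simp [RealExpr.eval, hv s1 i1 r1]) (by omega) hkn (by omega) ?_
    rw [m1]; exact addEdge_comm hM _ _ _
  rw [← hs1, ← hs2]
  unfold split
  rw [← m2]
  refine incrEdge_spec (fun t ht => by simp [ht, i2, hu]) (fun t ht => by simp [ht, i2, hw])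
      (hv s2 i2 r2) (by omega) (by omega) huw.ne ?_
  rw [m2]; exact addEdge_comm (addEdge_comm hM _ _ _) _ _ _

/-- Splits off as much as possible from the edges `uk` and `wk`. -/
def splitPair : Stmt :=
  cond (.ltReal (entry 2 (var 16) (var 10)) (entry 2 (var 17) (var 10)))
    (rassign 9 (entry 2 (var 16) (var 10))) (rassign 9 (entry 2 (var 17) (var 10))) ;;
  splitBy (rvar 9) ;;
  minCut ;;
  rassign 10 (.div (.sub (rconst 2) (rvar 8)) (rconst 2)) ;;
  splitBy (.sub (rconst 0) (rvar 10))

/-- The program first splits off `α`, the largest amount that keeps the weights nonnegative, then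
measures by a minimum cut how far this goes too far, and gives `(2 - c) / 2` back. The intermediate
graph is nonnegative, as the minimum cut computation requires. -/
theorem splitPair_spec {s : State} {n k u w : ℕ} (hn : s.ints 0 0 = n) (hkn : k < n)
    (hk : s.ints 10 0 = k) (hu : s.ints 16 0 = u) (hw : s.ints 17 0 = w) (huw : u < w) (hwk : w < k)
    (hM : ∀ a b, mat n 2 s a b = mat n 2 s b a) (h0 : ∀ a b, 0 ≤ mat n 2 s a b)
    (hF : Feasible k (mat n 2 s)) :
    (∀ a b, mat n 2 (splitPair.run s) a b = mat n 2 (splitPair.run s) b a) ∧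
    (∀ a b, 0 ≤ mat n 2 (splitPair.run s) a b) ∧
    Feasible k (mat n 2 (splitPair.run s)) ∧ Blocked k (mat n 2 (splitPair.run s)) u w ∧
    SplitRel k (mat n 2 s) (mat n 2 (splitPair.run s)) := by
  obtain ⟨s1, hs1⟩ : ∃ s1, s1 = (cond (.ltReal (entry 2 (var 16) (var 10))
    (entry 2 (var 17) (var 10))) (rassign 9 (entry 2 (var 16) (var 10)))
    (rassign 9 (entry 2 (var 17) (var 10)))).run s := ⟨_, rfl⟩
  obtain ⟨α, hα⟩ : ∃ α, α = min (mat n 2 s u k) (mat n 2 s w k) := ⟨_, rfl⟩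
  have hun : u < n := by omega
  have hwn : w < n := by omega
  have i1 : s1.ints = s.ints := by
    funext b; rw [hs1]; exact run_ints _ (by simp [writesInt, rassign]) _
  have m1 : mat n 2 s1 = mat n 2 s := mat_congr (by rw [hs1, run_reals _ (by decide)])
  have α1 : s1.reals 9 0 = α := by
    rw [hs1, hα, mat_of_lt s hun hkn, mat_of_lt s hwn hkn]
    by_cases hlt : s.reals 2 (pairIndex u k) < s.reals 2 (pairIndex w k)
    · rw [run_cond_pos (by simpa [Test.holds, hk, hu, hw] using hlt), min_eq_left hlt.le]
      simp [hk, hu]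
    · rw [run_cond_neg (by simpa [Test.holds, hk, hu, hw] using hlt), min_eq_right (not_lt.1 hlt)]
      simp [hk, hw]
  obtain ⟨s2, hs2⟩ : ∃ s2, s2 = (splitBy (rvar 9)).run s1 := ⟨_, rfl⟩
  have i2 : s2.ints = s.ints := by rw [hs2, ← i1]; rfl
  have m2 : mat n 2 s2 = split k (mat n 2 s) u w α := by
    rw [hs2, ← m1]
    exact splitBy_spec hkn (by rw [i1, hk]) (by rw [i1, hu]) (by rw [i1, hw]) huw hwk
      (fun t _ ht => by simp [ht 9 (by norm_num), α1]) (by rwa [m1])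
  have hα0 : 0 ≤ α := by rw [hα]; exact le_min (h0 _ _) (h0 _ _)
  have nn2 := split_nonneg huw hwk h0 hα0 (hα ▸ min_le_left _ _) (hα ▸ min_le_right _ _) hM
  obtain ⟨c, hc⟩ : ∃ c, c = (minCut.run s2).reals 8 0 := ⟨_, rfl⟩
  have hcut := minCut_spec (s := s2) (n := n) (k := k) (by rw [i2, hn]) (by rw [i2, hk]) hkn
    (by rw [m2]; exact split_comm hM _) (by rw [m2]; exact nn2)
  rw [m2, ← hc] at hcut
  obtain ⟨g1, g2, g3, g4⟩ := split_max huw hwk h0 hF hα hcut.1 hcut.2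
  obtain ⟨s3, hs3⟩ : ∃ s3, s3 = minCut.run s2 := ⟨_, rfl⟩
  have m3 : mat n 2 s3 = split k (mat n 2 s) u w α := by
    rw [← m2]; exact mat_congr (by rw [hs3, run_reals _ (by decide)])
  have f3 : ∀ b ∈ [10, 16, 17], s3.ints b = s.ints b := by
    intro b hb
    rw [hs3, ← i2]
    simp only [List.mem_cons, List.not_mem_nil, or_false] at hb
    rcases hb with rfl | rfl | rfl <;> exact run_ints _ (by decide) _
  obtain ⟨s4, hs4⟩ : ∃ s4, s4 = (rassign 10 (.div (.sub (rconst 2) (rvar 8)) (rconst 2))).run s3 :=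
    ⟨_, rfl⟩
  have i4 : s4.ints = s3.ints := by rw [hs4]; rfl
  have m4 : mat n 2 s4 = split k (mat n 2 s) u w α := by
    rw [← m3]; exact mat_congr (by rw [hs4, run_reals _ (by decide)])
  have β4 : s4.reals 10 0 = (2 - c) / 2 := by
    rw [hs4, hc, hs3]; simp [RealExpr.eval]
  have m5 : mat n 2 (splitPair.run s) = split k (mat n 2 s) u w (α - (2 - c) / 2) := by
    have e : splitPair.run s = (splitBy (.sub (rconst 0) (rvar 10))).run s4 := by
      simp only [splitPair, run_seq, hs4, hs3, hs2, hs1]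
    rw [e, splitBy_spec (n := n) (k := k) (u := u) (w := w) (δ := -((2 - c) / 2)) hkn
      (by rw [i4, f3 10 (by simp), hk]) (by rw [i4, f3 16 (by simp), hu])
      (by rw [i4, f3 17 (by simp), hw]) huw hwk
      (fun t _ ht => by simp [RealExpr.eval, ht 10 (by norm_num), β4])
      (by rw [m4]; exact split_comm hM _), m4, split_split, ← sub_eq_add_neg]
  rw [m5]
  refine ⟨split_comm hM _, split_nonneg huw hwk h0 g1 ?_ ?_ hM, g3, g4, splitRel_split _ huw hwk g1⟩
  · have := hα ▸ min_le_left (mat n 2 s u k) (mat n 2 s w k); linarith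
  · have := hα ▸ min_le_right (mat n 2 s u k) (mat n 2 s w k); linarith

/-- Saves the current graph as level `k` and then eliminates the vertex `k`. -/
def eliminate : Stmt :=
  iter 52 numV (iter 53 numV
    (setReal 3 ((var 10).pair ((var 52).pair (var 53))) (entry 2 (var 52) (var 53)))) ;;
  iter 54 (.mul numV numV) (
    assign 16 (.div (var 54) numV) ;;
    assign 17 (.mod (var 54) numV) ;;
    when (.and (.ltInt (var 16) (var 17)) (.ltInt (var 17) (var 10))) splitPair)

end Stmt

/-- The graph saved as level `k`. -/
noncomputable def level (n k : ℕ) (s : State) : ℕ → ℕ → ℝ :=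
  fun i j => if i < n ∧ j < n then s.reals 3 (pairIndex k (pairIndex i j)) else 0

/-- The part of the relation between consecutive levels that is needed for undoing the
elimination of the vertex `k`. -/
structure LevelRel (k : ℕ) (H W : ℕ → ℕ → ℝ) : Prop where
  le : ∀ a < k, ∀ b < k, H a b ≤ W a b
  sum_le : ∀ a < k, ∑ b ∈ range k, (W a b - H a b) ≤ H a k

/-- Splitting off preserves the degree of `a`, so what the pairs below `k` gain at `a` is `H a k - W
a k`, and `W a k` is not negative. -/
theorem _root_.WCut.SplitRel.levelRel {k : ℕ} {H W : ℕ → ℕ → ℝ} (h : SplitRel k H W)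
    (h0 : ∀ a b, 0 ≤ W a b) : LevelRel k H W := by
  refine ⟨h.inner_le, fun a ha => ?_⟩
  rw [sum_sub_distrib]
  linarith [h.degree a ha, h0 a k]

namespace Stmt

/-- Every pair is blocked at the moment of its treatment and stays so, hence at the end of the pass
all pairs are blocked and `k` can be dropped. -/
theorem eliminate_spec {s : State} {n k : ℕ} (hn : s.ints 0 0 = n) (hkn : k < n)
    (hk : s.ints 10 0 = k) (hM : ∀ a b, mat n 2 s a b = mat n 2 s b a)
    (h0 : ∀ a b, 0 ≤ mat n 2 s a b) (hF : Full (k + 1) (mat n 2 s)) :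
    level n k (eliminate.run s) = mat n 2 s ∧
    (∀ k', k' ≠ k → level n k' (eliminate.run s) = level n k' s) ∧
    (∀ a b, mat n 2 (eliminate.run s) a b = mat n 2 (eliminate.run s) b a) ∧
    (∀ a b, 0 ≤ mat n 2 (eliminate.run s) a b) ∧
    Full k (mat n 2 (eliminate.run s)) ∧ LevelRel k (mat n 2 s) (mat n 2 (eliminate.run s)) := by
  obtain ⟨s1, hs1⟩ : ∃ s1, s1 = (iter 52 numV (iter 53 numV
    (setReal 3 ((var 10).pair ((var 52).pair (var 53))) (entry 2 (var 52) (var 53))))).run s :=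
    ⟨_, rfl⟩
  have hcopy := run_iter (a := 52) (N := numV) (s := s) (P := iter 53 numV
    (setReal 3 ((var 10).pair ((var 52).pair (var 53))) (entry 2 (var 52) (var 53))))
    (fun i t => (∀ a < i, ∀ b < n, t.reals 3 (pairIndex k (pairIndex a b)) =
      s.reals 2 (pairIndex a b)) ∧
      ∀ k', k' ≠ k → ∀ j, t.reals 3 (pairIndex k' j) = s.reals 3 (pairIndex k' j))
    (by simp)
    (by
      intro i t hi hc hfi hfr ⟨ih, ih'⟩
      have := run_iter (a := 53) (N := numV) (s := t)
        (P := setReal 3 ((var 10).pair ((var 52).pair (var 53))) (entry 2 (var 52) (var 53)))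
        (fun j t' => (∀ a < i, ∀ b < n, t'.reals 3 (pairIndex k (pairIndex a b)) =
            s.reals 2 (pairIndex a b)) ∧
          (∀ b < j, t'.reals 3 (pairIndex k (pairIndex i b)) = s.reals 2 (pairIndex i b)) ∧
          ∀ k', k' ≠ k → ∀ j, t'.reals 3 (pairIndex k' j) = s.reals 3 (pairIndex k' j))
        (by refine ⟨?_, by simp, ?_⟩; simpa using ih; simpa using ih')
        (by
          intro j t' hj hc' hfi' hfr' ⟨ih1, ih2, ih3⟩
          have e52 : t'.ints 52 0 = i := by rw [hfi' 52 (by norm_num) (by decide), hc]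
          have e10 : t'.ints 10 0 = k := by
            rw [hfi' 10 (by norm_num) (by decide), hfi 10 (by norm_num) (by decide), hk]
          have e2 : t'.reals 2 = s.reals 2 := by rw [hfr' 2 (by decide), hfr 2 (by decide)]
          simp only [run_setReal, IntExpr.eval_pair, eval_var, e52, e10, hc', eval_entry, e2,
            reals_setInt, reals_setReal, true_and, pairIndex_inj]
          refine ⟨fun a ha b hb => ?_, fun b hb => ?_, fun k' hk' j' => ?_⟩
          · rw [if_neg (by omega)]; exact ih1 a ha b hb
          · by_cases hbj : b = j
            · subst hbj; simp
            · rw [if_neg (by omega)]; exact ih2 b (by omega)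
          · rw [if_neg (by tauto)]; exact ih3 k' hk' j')
      have e : numV.eval t = n := by rw [eval_numV, hfi 0 (by norm_num) (by decide), hn]
      rw [e] at this
      refine ⟨fun a ha b hb => ?_, fun k' hk' j => ?_⟩
      · rw [reals_setInt]
        by_cases hai : a = i
        · subst hai; exact this.2.1 b hb
        · exact this.1 a (by omega) b hb
      · rw [reals_setInt]; exact this.2.2 k' hk' j)
  rw [eval_numV, hn, ← hs1] at hcopy
  obtain ⟨c1, c2⟩ := hcopy
  have m1 : mat n 2 s1 = mat n 2 s := mat_congr (by rw [hs1, run_reals _ (by decide)])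
  have n1 : s1.ints 0 = s.ints 0 := by rw [hs1, run_ints _ (by decide)]
  have k1 : s1.ints 10 = s.ints 10 := by rw [hs1, run_ints _ (by decide)]
  obtain ⟨s2, hs2⟩ : ∃ s2, s2 = eliminate.run s := ⟨_, rfl⟩
  have e3 : s2.reals 3 = s1.reals 3 := by
    rw [hs2]; simp only [eliminate, run_seq]; rw [← hs1, run_reals _ (by decide)]
  have main := run_iter (a := 54) (N := .mul numV numV) (s := s1) (P := assign 16 (.div (var 54) numV) ;;
    assign 17 (.mod (var 54) numV) ;;
    when (.and (.ltInt (var 16) (var 17)) (.ltInt (var 17) (var 10))) splitPair)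
    (fun i t => (∀ a b, mat n 2 t a b = mat n 2 t b a) ∧ (∀ a b, 0 ≤ mat n 2 t a b) ∧
      Feasible k (mat n 2 t) ∧ SplitRel k (mat n 2 s) (mat n 2 t) ∧
      ∀ j < i, j / n < j % n → j % n < k → Blocked k (mat n 2 t) (j / n) (j % n))
    (by
      have e : mat n 2 (s1.setInt 54 0 0) = mat n 2 s := m1
      simp only [e]
      exact ⟨hM, h0, hF.feasible, SplitRel.refl _ _, fun j hj => by omega⟩)
    (by
      intro i t hi hc hfi hfr ⟨ih1, ih2, ih3, ih4, ih5⟩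
      have e0 : t.ints 0 0 = n := by rw [hfi 0 (by norm_num) (by decide), n1, hn]
      have e10 : t.ints 10 0 = k := by rw [hfi 10 (by norm_num) (by decide), k1, hk]
      obtain ⟨t1, ht1⟩ : ∃ t1, t1 = (assign 17 (.mod (var 54) numV)).run
        ((assign 16 (.div (var 54) numV)).run t) := ⟨_, rfl⟩
      have mt : mat n 2 t1 = mat n 2 t := by rw [ht1]; rfl
      have f0 : t1.ints 0 0 = n := by rw [ht1]; simp [e0]
      have f10 : t1.ints 10 0 = k := by rw [ht1]; simp [e10]
      have f16 : t1.ints 16 0 = i / n := by rw [ht1]; simp [IntExpr.eval, hc, e0]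
      have f17 : t1.ints 17 0 = i % n := by rw [ht1]; simp [IntExpr.eval, hc, e0]
      have hset : ∀ (r : State) (v : ℕ), mat n 2 (r.setInt 54 0 v) = mat n 2 r := fun _ _ => rfl
      simp only [hset, run_seq, ← ht1]
      by_cases hcd : i / n < i % n ∧ i % n < k
      · rw [run_when_pos (by simpa [Test.holds, f10, f16, f17] using hcd)]
        obtain ⟨g1, g2, g3, g4, g5⟩ := splitPair_spec f0 hkn f10 f16 f17 hcd.1 hcd.2
          (by rwa [mt]) (by rwa [mt]) (by rwa [mt])
        rw [mt] at g5
        refine ⟨g1, g2, g3, ih4.trans g5, fun j hj hj1 hj2 => ?_⟩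
        by_cases hji : j = i
        · rw [hji]; exact g4
        · exact (ih5 j (by omega) hj1 hj2).mono g5 g2 (by omega) hj2
      · rw [run_when_neg (by simpa [Test.holds, f10, f16, f17] using hcd)]
        have : mat n 2 (t1.setInt 99 0 0) = mat n 2 t := mt
        rw [this]
        refine ⟨ih1, ih2, ih3, ih4, fun j hj hj1 hj2 => ?_⟩
        by_cases hji : j = i
        · subst hji; exact absurd ⟨hj1, hj2⟩ hcd
        · exact ih5 j (by omega) hj1 hj2)
  have e : (IntExpr.mul numV numV).eval s1 = n * n := by simp [IntExpr.eval, n1, hn]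
  have e2 : (iter 54 (.mul numV numV) (assign 16 (.div (var 54) numV) ;;
    assign 17 (.mod (var 54) numV) ;;
    when (.and (.ltInt (var 16) (var 17)) (.ltInt (var 17) (var 10))) splitPair)).run s1 = s2 := by
    rw [hs2, hs1]; rfl
  rw [e, e2] at main
  obtain ⟨g1, g2, g3, g4, g5⟩ := main
  rw [← hs2]
  refine ⟨?_, fun k' hk' => ?_, g1, g2, full_of_blocked g1 g2 g3 fun w hw u hu => ?_, g4.levelRel g2⟩
  · funext a b
    unfold level mat
    split_ifs with hab
    · rw [e3]; exact c1 a hab.1 b hab.2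
    · rfl
  · funext a b
    unfold level
    rw [e3, c2 k' hk']
  · have hlt : u * n + w < n * n := by nlinarith
    have hd : (u * n + w) / n = u := by
      rw [mul_comm, Nat.mul_add_div (by omega), Nat.div_eq_of_lt (by omega), add_zero]
    have hm : (u * n + w) % n = w := by
      rw [Nat.mul_add_mod', Nat.mod_eq_of_lt (by omega)]
    have := g5 _ hlt
    rw [hd, hm] at this
    exact this hu hw

/-- Eliminates all vertices. -/
def eliminateAll : Stmt :=
  iter 55 numV (assign 10 (.sub (.sub numV (.const 1)) (var 55)) ;; eliminate)

end Stmt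

/-- The sequence of graphs that is produced by the elimination of the vertices. -/
structure Levels (n : ℕ) (W : ℕ → ℕ → ℝ) (H : ℕ → ℕ → ℕ → ℝ) : Prop where
  top : H (n - 1) = W
  symm : ∀ k < n, ∀ a b, H k a b = H k b a
  nonneg : ∀ k < n, ∀ a b, 0 ≤ H k a b
  full : ∀ k < n, Full (k + 1) (H k)
  rel : ∀ k, k + 1 < n → LevelRel (k + 1) (H (k + 1)) (H k)

namespace Stmt

/-- Level `k` is the graph on `0, …, k` just before `k` is eliminated. In the last round `k = 0`:
there is no pair to split, and only level `0` is saved. -/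
theorem eliminateAll_spec {s : State} {n : ℕ} (hn : s.ints 0 0 = n) (hpos : 0 < n)
    (hM : ∀ a b, mat n 2 s a b = mat n 2 s b a) (h0 : ∀ a b, 0 ≤ mat n 2 s a b)
    (hF : Full n (mat n 2 s)) :
    Levels n (mat n 2 s) (fun k => level n k (eliminateAll.run s)) := by
  have main := run_iter (a := 55) (N := numV) (s := s)
    (P := assign 10 (.sub (.sub numV (.const 1)) (var 55)) ;; eliminate)
    (fun i t => (∀ a b, mat n 2 t a b = mat n 2 t b a) ∧ (∀ a b, 0 ≤ mat n 2 t a b) ∧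
      Full (n - i) (mat n 2 t) ∧ (i = 0 → mat n 2 t = mat n 2 s) ∧
      (0 < i → level n (n - 1) t = mat n 2 s) ∧
      (∀ k, n - i ≤ k → k < n → (∀ a b, level n k t a b = level n k t b a) ∧
        (∀ a b, 0 ≤ level n k t a b) ∧ Full (k + 1) (level n k t)) ∧
      (∀ k, n - i ≤ k → k + 1 < n → LevelRel (k + 1) (level n (k + 1) t) (level n k t)) ∧
      -- This clause holds the relation to the matrix that is about to be saved; in the next round
      -- it becomes the relation between two saved levels.
      (0 < i → LevelRel (n - i) (level n (n - i) t) (mat n 2 t)))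
    (by
      have e : mat n 2 (s.setInt 55 0 0) = mat n 2 s := rfl
      simp only [e]
      exact ⟨hM, h0, hF, fun _ => trivial, fun h => absurd h (lt_irrefl _), fun k h1 h2 => by omega,
        fun k h1 h2 => by omega, fun h => absurd h (lt_irrefl _)⟩)
    (by
      intro i t hi hc hfi hfr ⟨ih1, ih2, ih3, ih4, ih5, ih6, ih7, ih8⟩
      rw [eval_numV, hn] at hi
      have e0 : t.ints 0 0 = n := by rw [hfi 0 (by norm_num) (by decide), hn]
      obtain ⟨k, hk⟩ : ∃ k, n - i = k + 1 := ⟨n - i - 1, by omega⟩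
      have hk' : n - (i + 1) = k := by omega
      obtain ⟨t1, ht1⟩ : ∃ t1, t1 = (assign 10 (.sub (.sub numV (.const 1)) (var 55))).run t := ⟨_, rfl⟩
      have m1 : mat n 2 t1 = mat n 2 t := by rw [ht1]; rfl
      have l1 : ∀ k, level n k t1 = level n k t := by intro k; rw [ht1]; rfl
      obtain ⟨g1, g2, g3, g4, g5, g6⟩ := eliminate_spec (s := t1) (n := n) (k := k)
        (by rw [ht1]; simp [e0]) (by omega)
        (by rw [ht1]; simp only [run_assign, IntExpr.eval, eval_numV, e0, eval_var, hc,
              ints_setInt, and_self, if_true]; omega)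
        (by rwa [m1]) (by rwa [m1]) (by rwa [m1, ← hk])
      have hset : ∀ (r : State) (v : ℕ), mat n 2 (r.setInt 55 0 v) = mat n 2 r := fun _ _ => rfl
      have hset' : ∀ (r : State) (k v : ℕ), level n k (r.setInt 55 0 v) = level n k r :=
        fun _ _ _ => rfl
      rw [m1] at g1 g6
      simp only [l1] at g2
      simp only [hset, hset', run_seq, ← ht1, hk']
      refine ⟨g3, g4, g5, fun h => absurd h (by omega), fun _ => ?_, fun k' h1 h2 => ?_,
        fun k' h1 h2 => ?_, fun _ => by rwa [g1]⟩
      · by_cases hz : i = 0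
        · have : n - 1 = k := by omega
          rw [this, g1, ih4 hz]
        · rw [g2 (n - 1) (by omega), ih5 (by omega)]
      · by_cases hkk : k' = k
        · rw [hkk, g1, ← hk]; exact ⟨ih1, ih2, ih3⟩
        · rw [g2 k' hkk]; exact ih6 k' (by omega) h2
      · rw [g2 (k' + 1) (by omega)]
        by_cases hkk : k' = k
        · rw [hkk, g1, ← hk]; exact ih8 (by omega)
        · rw [g2 k' hkk]; exact ih7 k' (by omega) h2)
  rw [eval_numV, hn] at main
  obtain ⟨-, -, -, -, h5, h6, h7, -⟩ := main
  exact ⟨h5 hpos, fun k hk => (h6 k (by omega) hk).1, fun k hk => (h6 k (by omega) hk).2.1,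
    fun k hk => (h6 k (by omega) hk).2.2, fun k hk => h7 k (by omega) hk⟩

end Stmt

end RAM

/-! ### Weighted families and the transfer of weight. -/

namespace RAM

open Finset

/-- A member of the family: a set `T` of pairs of vertices, a set `U` of edges, and the last
level at which the member has been extended. -/
@[ext] structure Member where
  T : ℕ → ℕ → ℕ
  U : ℕ → ℕ
  A : ℕ

/-- The `i`-th member of the family. -/
def member (n m : ℕ) (s : State) (i : ℕ) : Member where
  T a b := if a < n ∧ b < n then s.ints 5 (pairIndex i (pairIndex a b)) else 0
  U e := if e < m then s.ints 6 (pairIndex i e) else 0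
  A := s.ints 8 i

theorem member_congr {n m : ℕ} {s t : State} (h5 : t.ints 5 = s.ints 5) (h6 : t.ints 6 = s.ints 6)
    (h8 : t.ints 8 = s.ints 8) : member n m t = member n m s := by
  funext i; unfold member; rw [h5, h6, h8]

/-- The weighted sum of a function over the family. -/
noncomputable def famSum (n m : ℕ) (s : State) (φ : Member → ℝ) : ℝ :=
  ∑ i ∈ range (s.ints 3 0), s.reals 1 i * φ (member n m s i)

namespace Stmt

/-- A bound for the size of the family. -/
def familyBound : IntExpr :=
  .add (.add (.mul numV (.add (.mul numV numV) numV)) (.mul (.const 2) numE)) (.const 1)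

/-- Appends a copy of the current member to the family; the weight of the current member becomes
the value of the real variable `7`, and the copy gets the rest. -/
def splitMember : Stmt :=
  setReal 1 (var 3) (.sub (.get 1 (var 40)) (rvar 7)) ;;
  setReal 1 (var 40) (rvar 7) ;;
  iter 41 numV (iter 42 numV (setInt 5 ((var 3).pair ((var 41).pair (var 42)))
    (.get 5 ((var 40).pair ((var 41).pair (var 42)))))) ;;
  iter 41 numE (setInt 6 ((var 3).pair (var 41)) (.get 6 ((var 40).pair (var 41)))) ;;
  setInt 8 (var 3) (.get 8 (var 40)) ;;
  assign 3 (.add (var 3) (.const 1))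

theorem splitMember_spec {s : State} {n m ℓ i : ℕ} (hn : s.ints 0 0 = n) (hm : s.ints 0 1 = m)
    (hℓ : s.ints 3 0 = ℓ) (hi : s.ints 40 0 = i) (hiℓ : i < ℓ) :
    (splitMember.run s).ints 3 0 = ℓ + 1 ∧
    (∀ j, (splitMember.run s).reals 1 j =
      if j = ℓ then s.reals 1 i - s.reals 7 0 else if j = i then s.reals 7 0 else s.reals 1 j) ∧
    member n m (splitMember.run s) ℓ = member n m s i ∧
    ∀ j, j ≠ ℓ → member n m (splitMember.run s) j = member n m s j := by
  obtain ⟨s1, hs1⟩ : ∃ s1, s1 = (setReal 1 (var 40) (rvar 7)).run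
    ((setReal 1 (var 3) (.sub (.get 1 (var 40)) (rvar 7))).run s) := ⟨_, rfl⟩
  obtain ⟨s2, hs2⟩ : ∃ s2, s2 = (iter 41 numV (iter 42 numV
    (setInt 5 ((var 3).pair ((var 41).pair (var 42)))
    (.get 5 ((var 40).pair ((var 41).pair (var 42))))))).run s1 := ⟨_, rfl⟩
  obtain ⟨s3, hs3⟩ : ∃ s3, s3 = (iter 41 numE
    (setInt 6 ((var 3).pair (var 41)) (.get 6 ((var 40).pair (var 41))))).run s2 := ⟨_, rfl⟩
  have e : splitMember.run s = (s3.setInt 8 ℓ (s.ints 8 i)).setInt 3 0 (ℓ + 1) := by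
    have h3 : s3.ints 3 0 = ℓ := by
      rw [hs3, run_ints _ (by decide), hs2, run_ints _ (by decide), hs1]; simp [hℓ]
    have h40 : s3.ints 40 0 = i := by
      rw [hs3, run_ints _ (by decide), hs2, run_ints _ (by decide), hs1]; simp [hi]
    have h8 : s3.ints 8 = s.ints 8 := by
      rw [hs3, run_ints _ (by decide), hs2, run_ints _ (by decide), hs1]; rfl
    simp only [splitMember, run_seq, ← hs1, ← hs2, ← hs3]
    simp [IntExpr.eval, h3, h40, h8]
  have i1 : s1.ints = s.ints := by rw [hs1]; rfl
  have r3 : s3.reals 1 = s1.reals 1 := by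
    rw [hs3, run_reals _ (by decide), hs2, run_reals _ (by decide)]
  have n1 : numV.eval s1 = n := by rw [eval_numV, i1, hn]
  have c5 := run_iter (a := 41) (N := numV) (s := s1) (P := iter 42 numV
    (setInt 5 ((var 3).pair ((var 41).pair (var 42)))
    (.get 5 ((var 40).pair ((var 41).pair (var 42))))))
    (fun a t => (∀ a' < a, ∀ b < n, t.ints 5 (pairIndex ℓ (pairIndex a' b)) =
      s.ints 5 (pairIndex i (pairIndex a' b))) ∧
      ∀ j, j ≠ ℓ → ∀ y, t.ints 5 (pairIndex j y) = s.ints 5 (pairIndex j y))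
    (by simp [i1])
    (by
      intro a t ha hc hfi hfr ⟨ih, ih'⟩
      have := run_iter (a := 42) (N := numV) (s := t)
        (P := setInt 5 ((var 3).pair ((var 41).pair (var 42)))
          (.get 5 ((var 40).pair ((var 41).pair (var 42)))))
        (fun b t' => (∀ a' < a, ∀ b < n, t'.ints 5 (pairIndex ℓ (pairIndex a' b)) =
          s.ints 5 (pairIndex i (pairIndex a' b))) ∧
          (∀ b' < b, t'.ints 5 (pairIndex ℓ (pairIndex a b')) =
            s.ints 5 (pairIndex i (pairIndex a b'))) ∧
          ∀ j, j ≠ ℓ → ∀ y, t'.ints 5 (pairIndex j y) = s.ints 5 (pairIndex j y))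
        (by refine ⟨?_, by simp, ?_⟩; simpa using ih; simpa using ih')
        (by
          intro b t' hb hc' hfi' hfr' ⟨ih1, ih2, ih3⟩
          have e41 : t'.ints 41 0 = a := by rw [hfi' 41 (by norm_num) (by decide), hc]
          have e3 : t'.ints 3 0 = ℓ := by
            rw [hfi' 3 (by norm_num) (by decide), hfi 3 (by norm_num) (by decide), i1, hℓ]
          have e40 : t'.ints 40 0 = i := by
            rw [hfi' 40 (by norm_num) (by decide), hfi 40 (by norm_num) (by decide), i1, hi]
          simp only [run_setInt, IntExpr.eval_pair, IntExpr.eval, eval_var, e41, e3, e40, hc',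
            ints_setInt, true_and, pairIndex_inj, Nat.reduceEqDiff, false_and, if_false]
          refine ⟨fun a' ha' b' hb' => ?_, fun b' hb' => ?_, fun j hj y => ?_⟩
          · rw [if_neg (by omega)]; exact ih1 a' ha' b' hb'
          · by_cases hbb : b' = b
            · subst hbb; simp [ih3 i hiℓ.ne]
            · rw [if_neg (by omega)]; exact ih2 b' (by omega)
          · rw [if_neg (by tauto)]; exact ih3 j hj y)
      have e : numV.eval t = n := by
        rw [eval_numV, hfi 0 (by norm_num) (by decide), i1, hn]
      rw [e] at this
      simp only [ints_setInt, Nat.reduceEqDiff, false_and, if_false]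
      refine ⟨fun a' ha' b hb => ?_, this.2.2⟩
      by_cases haa : a' = a
      · subst haa; exact this.2.1 b hb
      · exact this.1 a' (by omega) b hb)
  rw [n1, ← hs2] at c5
  have m2 : numE.eval s2 = m := by
    rw [eval_numE, hs2, run_ints _ (by decide), i1, hm]
  have f2 : s2.ints 6 = s.ints 6 := by rw [hs2, run_ints _ (by decide), i1]
  have c6 := run_iter (a := 41) (N := numE) (s := s2)
    (P := setInt 6 ((var 3).pair (var 41)) (.get 6 ((var 40).pair (var 41))))
    (fun a t => (∀ a' < a, t.ints 6 (pairIndex ℓ a') = s.ints 6 (pairIndex i a')) ∧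
      ∀ j, j ≠ ℓ → ∀ y, t.ints 6 (pairIndex j y) = s.ints 6 (pairIndex j y))
    (by simp [f2])
    (by
      intro a t' ha hc' hfi' hfr' ⟨ih2, ih3⟩
      have e3 : t'.ints 3 0 = ℓ := by
        rw [hfi' 3 (by norm_num) (by decide), hs2, run_ints _ (by decide), i1, hℓ]
      have e40 : t'.ints 40 0 = i := by
        rw [hfi' 40 (by norm_num) (by decide), hs2, run_ints _ (by decide), i1, hi]
      simp only [run_setInt, IntExpr.eval_pair, IntExpr.eval, eval_var, e3, e40, hc',
        ints_setInt, true_and, pairIndex_inj, Nat.reduceEqDiff, false_and, if_false]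
      refine ⟨fun b' hb' => ?_, fun j hj y => ?_⟩
      · by_cases hbb : b' = a
        · subst hbb; simp [ih3 i hiℓ.ne]
        · rw [if_neg (by omega)]; exact ih2 b' (by omega)
      · rw [if_neg (by tauto)]; exact ih3 j hj y)
  rw [m2, ← hs3] at c6
  have g5 : s3.ints 5 = s2.ints 5 := by rw [hs3, run_ints _ (by decide)]
  have g8 : s3.ints 8 = s.ints 8 := by
    rw [hs3, run_ints _ (by decide), hs2, run_ints _ (by decide), i1]
  rw [e]
  refine ⟨by simp, fun j => ?_, ?_, fun j hj => ?_⟩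
  · simp only [reals_setInt, r3, hs1, run_setReal, eval_var, RealExpr.eval, ints_setReal, hℓ, hi,
      reals_setReal, eval_rvar]
    by_cases h1 : j = ℓ
    · subst h1; simp [hiℓ.ne']
    · by_cases h2 : j = i <;> simp [h1, h2, hiℓ.ne]
  · unfold member
    ext a
    · simp only [ints_setInt, Nat.reduceEqDiff, false_and, if_false, g5]
      split_ifs with h
      · exact c5.1 a h.1 _ h.2
      · rfl
    · simp only [ints_setInt, Nat.reduceEqDiff, false_and, if_false]
      split_ifs with h
      · exact c6.1 a h
      · rfl
    · simp
  · unfold member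
    ext a
    · simp only [ints_setInt, Nat.reduceEqDiff, false_and, if_false, g5]
      rw [c5.2 j hj]
    · simp only [ints_setInt, Nat.reduceEqDiff, false_and, if_false]
      rw [c6.2 j hj]
    · simp [hj, g8]

/-- Applies `act` to members that satisfy the test `b`, of total weight equal to the value of the
real variable `7` if there are enough of them. -/
def transfer (b : Test) (act : Stmt) : Stmt :=
  iter 40 familyBound (when (.and (.and (.ltInt (var 40) (var 3)) (.ltReal (rconst 0) (rvar 7))) b) (
    when (.ltReal (rvar 7) (.get 1 (var 40))) splitMember ;;
    rassign 7 (.sub (rvar 7) (.get 1 (var 40))) ;;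
    act))

/-- The two states agree except for the family and auxiliary variables. -/
structure SameEnv (s t : State) : Prop where
  ints : ∀ c, c ∉ [3, 5, 6, 7, 8, 30, 31, 32, 33, 40, 41, 42, 99] → t.ints c = s.ints c
  reals : ∀ c, c ∉ [1, 7] → t.reals c = s.reals c

theorem SameEnv.trans {s t u : State} (h : SameEnv s t) (h' : SameEnv t u) : SameEnv s u :=
  ⟨fun c hc => (h'.1 c hc).trans (h.1 c hc), fun c hc => (h'.2 c hc).trans (h.2 c hc)⟩

theorem SameEnv.of_run {P : Stmt} (s : State)
    (h : ∀ c, c ∉ [3, 5, 6, 7, 8, 30, 31, 32, 33, 40, 41, 42, 99] → P.writesInt c = false)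
    (h' : ∀ c, c ∉ [1, 7] → P.writesReal c = false) : SameEnv s (P.run s) :=
  ⟨fun c hc => run_ints P (h c hc) s, fun c hc => run_reals P (h' c hc) s⟩

/-- The statement only modifies the current member (and auxiliary variables). -/
structure IsAction (act : Stmt) : Prop where
  ints : ∀ c, c ∉ [5, 6, 7, 8, 30, 31, 32, 33, 99] → act.writesInt c = false
  reals : ∀ c, act.writesReal c = false

theorem splitMember_writesInt {c : ℕ} (hc : c ∉ [3, 5, 6, 8, 41, 42]) :
    splitMember.writesInt c = false := by
  simp only [List.mem_cons, List.not_mem_nil, or_false, not_or] at hc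
  simp [splitMember, writesInt, assign]; omega

theorem splitMember_writesReal {c : ℕ} (hc : c ≠ 1) : splitMember.writesReal c = false := by
  simp [splitMember, writesReal, assign]; omega

/-- The properties of the family that hold all the time. -/
structure IsFamily (n m : ℕ) (Good : Member → Prop) (s : State) : Prop where
  good : ∀ i < s.ints 3 0, Good (member n m s i)
  pos : ∀ i < s.ints 3 0, 0 < s.reals 1 i

/-- The value `r` is a budget. Eligible members are treated one after the other until it is used up;
a member heavier than the rest of the budget is divided first, so that the budget is met exactly.
This division empties the budget, so it happens at most once. A treated member is no longer
eligible, hence a remaining budget means that no eligible member is left. The last clause is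
one-sided, but for a `φ` that changes by exactly `c` it can be used for `φ` and `-φ` and then gives
an equality. -/
theorem transfer_spec {b : Test} {act : Stmt} {s : State} {n m ℓ : ℕ} {r : ℝ}
    (Good pred : Member → Prop) (f : Member → Member)
    (hn : s.ints 0 0 = n) (hm : s.ints 0 1 = m) (hℓ : s.ints 3 0 = ℓ) (hr : s.reals 7 0 = r)
    (hbound : ℓ ≤ familyBound.eval s) (hA : IsAction act)
    (hb : ∀ t, SameEnv s t → (b.holds t ↔ pred (member n m t (t.ints 40 0))))
    (hact : ∀ t, SameEnv s t → Good (member n m t (t.ints 40 0)) →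
      pred (member n m t (t.ints 40 0)) →
      member n m (act.run t) (t.ints 40 0) = f (member n m t (t.ints 40 0)) ∧
      ∀ j, j ≠ t.ints 40 0 → member n m (act.run t) j = member n m t j)
    (hGood : ∀ o, Good o → pred o → Good (f o) ∧ ¬ pred (f o)) (hF : IsFamily n m Good s) :
    ∃ μ, 0 ≤ μ ∧ μ ≤ max 0 r ∧ IsFamily n m Good ((transfer b act).run s) ∧
      ((transfer b act).run s).ints 3 0 ≤ ℓ + 1 ∧
      (μ = max 0 r ∨ ∀ i < ((transfer b act).run s).ints 3 0,
        ¬ pred (member n m ((transfer b act).run s) i)) ∧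
      ∀ (φ : Member → ℝ) (c : ℝ), (∀ o, Good o → pred o → φ (f o) ≤ φ o + c) →
        famSum n m ((transfer b act).run s) φ ≤ famSum n m s φ + c * μ := by
  have hset : ∀ (t : State) (v : ℕ), member n m (t.setInt 40 0 v) = member n m t := by
    intro t v; refine member_congr ?_ ?_ ?_ <;> exact ints_setInt_ne _ (by norm_num) _ _
  have hset' : ∀ (t : State) (v : ℕ) (φ : Member → ℝ),
      famSum n m (t.setInt 40 0 v) φ = famSum n m t φ := by
    intro t v φ; unfold famSum; rw [hset]; simp
  have main := run_iter (a := 40) (N := familyBound) (s := s)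
    (P := when (.and (.and (.ltInt (var 40) (var 3)) (.ltReal (rconst 0) (rvar 7))) b) (
      when (.ltReal (rvar 7) (.get 1 (var 40))) splitMember ;;
      rassign 7 (.sub (rvar 7) (.get 1 (var 40))) ;;
      act))
    (fun i t => ∃ μ, 0 ≤ μ ∧ t.reals 7 0 = r - μ ∧ μ ≤ max 0 r ∧ IsFamily n m Good t ∧
      -- A new member appears only together with the end of the budget. As long as budget is left,
      -- the size is still `ℓ`, so the loop bound covers the whole family.
      t.ints 3 0 ≤ ℓ + 1 ∧ (t.ints 3 0 = ℓ ∨ t.reals 7 0 ≤ 0) ∧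
      (t.reals 7 0 ≤ 0 ∨ ∀ j < i, j < t.ints 3 0 → ¬ pred (member n m t j)) ∧
      ∀ (φ : Member → ℝ) (c : ℝ), (∀ o, Good o → pred o → φ (f o) ≤ φ o + c) →
        famSum n m t φ ≤ famSum n m s φ + c * μ)
    (by
      refine ⟨0, le_rfl, by simp [hr], le_max_left _ _, ⟨?_, ?_⟩, by simp [hℓ], by simp [hℓ],
        by simp, fun φ c _ => by simp [hset']⟩
      · simpa [hset] using hF.good
      · simpa using hF.pos)
    (by
      intro i t hi hc hfi hfr ⟨μ, ih1, ih2, ih3, ih4, ih5, ih6, ih7, ih8⟩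
      have henv : SameEnv s t := by
        refine ⟨fun c hc => ?_, fun c hc => ?_⟩
        · simp only [List.mem_cons, List.not_mem_nil, or_false, not_or] at hc
          refine hfi c (by omega) ?_
          have h1 := hA.ints c (by simp; omega)
          have h2 := splitMember_writesInt (c := c) (by simp; omega)
          simp [writesInt, when, skip, assign, rassign, h1, h2]; omega
        · simp only [List.mem_cons, List.not_mem_nil, or_false, not_or] at hc
          refine hfr c ?_
          have h2 := splitMember_writesReal (c := c) (by omega)
          simp [writesReal, when, skip, assign, rassign, hA.reals c, h2]; omega
      by_cases hcond : i < t.ints 3 0 ∧ 0 < t.reals 7 0 ∧ pred (member n m t i)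
      · obtain ⟨hiℓ, hrt, hp⟩ := hcond
        have hℓt : t.ints 3 0 = ℓ := ih6.resolve_right (not_le.2 hrt)
        rw [run_when_pos (by
          simp only [Test.holds, eval_var, hc, eval_rconst, Nat.cast_zero, eval_rvar]
          exact ⟨⟨hiℓ, hrt⟩, (hb t henv).2 (by rwa [hc])⟩)]
        have hgi := ih4.good i hiℓ
        -- the state after the current member has been split if necessary
        obtain ⟨t1, ht1⟩ : ∃ t1, t1 =
          (when (.ltReal (rvar 7) (.get 1 (var 40))) splitMember).run t := ⟨_, rfl⟩
        have h0t : t.ints 0 = s.ints 0 := henv.ints 0 (by decide)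
        have key : SameEnv t t1 ∧ t1.ints 40 0 = i ∧ t1.reals 7 0 = t.reals 7 0 ∧
            t.ints 3 0 ≤ t1.ints 3 0 ∧ t1.ints 3 0 ≤ ℓ + 1 ∧ 0 < t1.reals 1 i ∧
            t1.reals 1 i ≤ t.reals 7 0 ∧
            (t1.ints 3 0 = ℓ ∨ t1.reals 1 i = t.reals 7 0) ∧ IsFamily n m Good t1 ∧
            (∀ j < t.ints 3 0, member n m t1 j = member n m t j) ∧
            ∀ φ, famSum n m t1 φ = famSum n m t φ := by
          by_cases hlt : t.reals 7 0 < t.reals 1 i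
          · have hst : t1 = splitMember.run t := by
              rw [ht1]
              exact run_when_pos (by simpa [Test.holds, RealExpr.eval, hc] using hlt) _
            obtain ⟨g1, g2, g3, g4⟩ := splitMember_spec (s := t) (n := n) (m := m)
              (by rw [h0t, hn]) (by rw [h0t, hm]) hℓt hc (hℓt ▸ hiℓ)
            rw [← hst] at g1 g2 g3 g4
            rw [hℓt] at hiℓ ⊢
            have hl : ∀ j < ℓ, j ≠ ℓ := fun j hj => hj.ne
            have g2i : t1.reals 1 i = t.reals 7 0 := by rw [g2, if_neg hiℓ.ne, if_pos rfl]
            refine ⟨?_, ?_, ?_, by omega, by omega, by rw [g2i]; exact hrt, g2i.le, Or.inr g2i,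
              ⟨?_, ?_⟩, fun j hj => g4 j (hl j hj), fun φ => ?_⟩
            · rw [hst]
              refine SameEnv.of_run t (fun c hc => ?_) (fun c hc => ?_)
              · simp only [List.mem_cons, List.not_mem_nil, or_false, not_or] at hc
                exact splitMember_writesInt (by simp; omega)
              · simp only [List.mem_cons, List.not_mem_nil, or_false, not_or] at hc
                exact splitMember_writesReal (by omega)
            · rw [hst, run_ints _ (by decide), hc]
            · rw [hst, run_reals _ (by decide)]
            · intro j hj
              rw [g1] at hj
              by_cases hjℓ : j = ℓ
              · rw [hjℓ, g3]; exact hgi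
              · rw [g4 j hjℓ]; exact ih4.good j (by omega)
            · intro j hj
              rw [g1] at hj
              rw [g2]
              by_cases hjℓ : j = ℓ
              · rw [if_pos hjℓ]; linarith
              · rw [if_neg hjℓ]
                split_ifs
                · exact hrt
                · exact ih4.pos j (by omega)
            · unfold famSum
              rw [g1, hℓt, sum_range_succ, g3, g2 ℓ, if_pos rfl]
              rw [sum_congr rfl (fun j hj => by
                rw [g2, if_neg (hl j (mem_range.1 hj)), g4 j (hl j (mem_range.1 hj))])]
              have hmem : i ∈ range ℓ := mem_range.2 hiℓ
              rw [← add_sum_erase _ _ hmem, ← add_sum_erase (range ℓ) (fun j => t.reals 1 j * _) hmem,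
                if_pos rfl]
              rw [sum_congr rfl (fun j hj => by rw [if_neg (ne_of_mem_erase hj)])]
              ring
          · have hst : t1 = t.setInt 99 0 0 := by
              rw [ht1]
              exact run_when_neg (by simpa [Test.holds, RealExpr.eval, hc] using hlt) _
            have hmem : member n m t1 = member n m t := by
              rw [hst]; refine member_congr ?_ ?_ ?_ <;> exact ints_setInt_ne _ (by norm_num) _ _
            have e3 : t1.ints 3 0 = t.ints 3 0 := by rw [hst]; simp
            have e1 : t1.reals = t.reals := by rw [hst]; rfl
            refine ⟨⟨fun c hc => ?_, fun c _ => by rw [e1]⟩, by rw [hst]; simp [hc], by rw [e1],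
              e3.ge, by omega, by rw [e1]; exact ih4.pos i hiℓ, by rw [e1]; exact not_lt.1 hlt,
              Or.inl (by omega), ⟨?_, ?_⟩, fun j _ => by rw [hmem], fun φ => ?_⟩
            · rw [hst]
              refine ints_setInt_ne _ ?_ _ _
              rintro rfl; simp at hc
            · rw [e3, hmem]; exact ih4.good
            · rw [e3, e1]; exact ih4.pos
            · unfold famSum; rw [e3, e1, hmem]
        obtain ⟨k1, k2, k3, k4, k5, k6, k7, k8, k9, k10, k11⟩ := key
        obtain ⟨t2, ht2⟩ : ∃ t2, t2 = (rassign 7 (.sub (rvar 7) (.get 1 (var 40)))).run t1 := ⟨_, rfl⟩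
        have i2 : t2.ints = t1.ints := by rw [ht2]; rfl
        have m2 : member n m t2 = member n m t1 := by
          refine member_congr ?_ ?_ ?_ <;> rw [i2]
        have l2 : t2.reals 1 = t1.reals 1 := by rw [ht2, run_reals _ (by decide)]
        have r2 : t2.reals 7 0 = t.reals 7 0 - t1.reals 1 i := by
          rw [ht2]; simp [RealExpr.eval, k2, k3]
        have henv2 : SameEnv s t2 := by
          refine (henv.trans k1).trans ⟨fun c _ => by rw [i2], fun c hc => ?_⟩
          rw [ht2]
          refine run_reals _ ?_ _
          simp only [List.mem_cons, List.not_mem_nil, or_false, not_or] at hc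
          simp [rassign, writesReal]; omega
        have hi2 : t2.ints 40 0 = i := by rw [i2, k2]
        have hm2 : member n m t2 i = member n m t i := by rw [m2, k10 i hiℓ]
        obtain ⟨a1, a2⟩ := hact t2 henv2 (by rwa [hi2, hm2]) (by rwa [hi2, hm2])
        rw [hi2, hm2] at a1
        rw [hi2] at a2
        simp only [m2] at a2
        simp only [run_seq, ← ht1, ← ht2]
        obtain ⟨t3, ht3⟩ : ∃ t3, t3 = act.run t2 := ⟨_, rfl⟩
        rw [← ht3] at a1 a2 ⊢
        have l3 : t3.reals = t2.reals := by
          funext c; rw [ht3]; exact run_reals _ (hA.reals c) _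
        have e3 : t3.ints 3 = t1.ints 3 := by
          rw [ht3, run_ints _ (hA.ints 3 (by decide)), i2]
        have e1 : t3.reals 1 = t1.reals 1 := by rw [l3, l2]
        have e7 : t3.reals 7 0 = t.reals 7 0 - t1.reals 1 i := by rw [l3, r2]
        obtain ⟨hg, hnp⟩ := hGood _ hgi hp
        have hr' : max 0 r = r := max_eq_right (by linarith)
        simp only [hset, hset', reals_setInt, ints_setInt, Nat.reduceEqDiff, false_and, if_false, e3]
        refine ⟨μ + t1.reals 1 i, by linarith, by rw [e7, ih2]; ring, by rw [hr']; linarith,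
          ⟨?_, ?_⟩, k5, ?_, ?_, fun φ c hφ => ?_⟩
        · simp only [hset, ints_setInt, Nat.reduceEqDiff, false_and, if_false, e3]
          intro j hj
          by_cases hji : j = i
          · rw [hji, a1]; exact hg
          · rw [a2 j hji]; exact k9.good j hj
        · simp only [ints_setInt, Nat.reduceEqDiff, false_and, if_false, e3, reals_setInt, e1]
          exact k9.pos
        · rcases k8 with h | h
          · exact Or.inl h
          · right; rw [e7, h]; linarith
        · rcases k8 with h | h
          · right
            intro j hj hjℓ
            by_cases hji : j = i
            · rw [hji, a1]; exact hnp
            · rw [a2 j hji, k10 j (by omega)]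
              exact ih7.resolve_left (not_le.2 hrt) j (by omega) (by omega)
          · left; rw [e7, h]; linarith
        · have h1 := ih8 φ c hφ
          rw [← k11] at h1
          have h2 := hφ _ hgi hp
          have hmem : i ∈ range (t1.ints 3 0) := mem_range.2 (by omega)
          have h3 : famSum n m t3 φ = famSum n m t1 φ +
              t1.reals 1 i * (φ (f (member n m t i)) - φ (member n m t i)) := by
            unfold famSum
            rw [e3, e1, ← add_sum_erase _ _ hmem,
              ← add_sum_erase (range _) (fun j => t1.reals 1 j * φ (member n m t1 j)) hmem, a1,
              k10 i hiℓ]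
            rw [sum_congr rfl (fun j hj => by rw [a2 j (ne_of_mem_erase hj)])]
            ring
          rw [h3]
          nlinarith
      · rw [run_when_neg (by
          simp only [Test.holds, eval_var, hc, eval_rconst, Nat.cast_zero, eval_rvar]
          intro h
          exact hcond ⟨h.1.1, h.1.2, by have := (hb t henv).1 h.2; rwa [hc] at this⟩)]
        have hmem : member n m (t.setInt 99 0 0) = member n m t := by
          refine member_congr ?_ ?_ ?_ <;> exact ints_setInt_ne _ (by norm_num) _ _
        have hfs : ∀ φ, famSum n m (t.setInt 99 0 0) φ = famSum n m t φ := by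
          intro φ; unfold famSum; rw [hmem]; simp
        simp only [hset, hset', hmem, hfs, reals_setInt, ints_setInt, Nat.reduceEqDiff, false_and,
          if_false]
        refine ⟨μ, ih1, ih2, ih3, ⟨?_, ?_⟩, ih5, ih6, ?_, ih8⟩
        · simpa [hset, hmem] using ih4.good
        · simpa using ih4.pos
        · rcases ih7 with h | h
          · exact Or.inl h
          · by_cases hrt : t.reals 7 0 ≤ 0
            · exact Or.inl hrt
            · right
              intro j hj hjℓ
              by_cases hji : j = i
              · subst hji
                exact fun hp => hcond ⟨hjℓ, not_le.1 hrt, hp⟩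
              · exact h j (by omega) hjℓ)
  obtain ⟨μ, h1, h2, h3, h4, h5, h6, h7, h8⟩ := main
  refine ⟨μ, h1, h3, h4, h5, ?_, h8⟩
  by_cases hr0 : r - μ ≤ 0
  · left
    refine le_antisymm h3 (max_le h1 (by linarith))
  · right
    intro i hi
    have h6' := h6.resolve_right (by rw [h2]; exact hr0)
    exact h7.resolve_left (by rw [h2]; exact hr0) i (by
      have : i < ℓ := by rw [← h6']; exact hi
      omega) hi

end Stmt

end RAM

namespace RAM

open Finset WCut

/-! ### Undoing the elimination of a vertex -/

/-- The pairs in `T` connect `x` and `y`. -/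
def Conn (T : ℕ → ℕ → ℕ) : ℕ → ℕ → Prop := Relation.EqvGen fun p q => p < q ∧ T p q ≠ 0

theorem Conn.refl {T : ℕ → ℕ → ℕ} (x : ℕ) : Conn T x x := Relation.EqvGen.refl x

theorem Conn.symm {T : ℕ → ℕ → ℕ} {x y : ℕ} (h : Conn T x y) : Conn T y x :=
  Relation.EqvGen.symm _ _ h

theorem Conn.trans {T : ℕ → ℕ → ℕ} {x y z : ℕ} (h : Conn T x y) (h' : Conn T y z) : Conn T x z :=
  Relation.EqvGen.trans _ _ _ h h'

theorem Conn.single {T : ℕ → ℕ → ℕ} {x y : ℕ} (hxy : x < y) (h : T x y ≠ 0) : Conn T x y :=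
  Relation.EqvGen.rel _ _ ⟨hxy, h⟩

theorem Conn.mono {T T' : ℕ → ℕ → ℕ} (h : ∀ a b, a < b → T a b ≠ 0 → T' a b ≠ 0) {x y : ℕ}
    (hxy : Conn T x y) : Conn T' x y :=
  Relation.EqvGen.mono (fun a b hab => ⟨hab.1, h a b hab.1 hab.2⟩) x y hxy

/-- Removing the pair `uw` breaks its component into at most two parts, each of which contains `u`
or `w`. -/
theorem eqvGen_remove {α : Type*} {R R' : α → α → Prop} {u w : α}
    (h : ∀ a b, R a b → R' a b ∨ a = u ∧ b = w) {x y : α} (hxy : Relation.EqvGen R x y) :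
    Relation.EqvGen R' x y ∨ (Relation.EqvGen R' x u ∨ Relation.EqvGen R' x w) ∧
      (Relation.EqvGen R' y u ∨ Relation.EqvGen R' y w) := by
  induction hxy with
  | rel a b hab =>
    rcases h a b hab with h | ⟨rfl, rfl⟩
    · exact Or.inl (.rel _ _ h)
    · exact Or.inr ⟨Or.inl (.refl _), Or.inr (.refl _)⟩
  | refl a => exact Or.inl (.refl _)
  | symm a b _ ih =>
    rcases ih with h | ⟨h1, h2⟩
    · exact Or.inl (.symm _ _ h)
    · exact Or.inr ⟨h2, h1⟩
  | trans a b c _ _ ih1 ih2 =>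
    rcases ih1 with h1 | ⟨h1, h1'⟩
    · rcases ih2 with h2 | ⟨h2, h2'⟩
      · exact Or.inl (.trans _ _ _ h1 h2)
      · exact Or.inr ⟨h2.imp (.trans _ _ _ h1) (.trans _ _ _ h1), h2'⟩
    · rcases ih2 with h2 | ⟨h2, h2'⟩
      · exact Or.inr ⟨h1, h1'.imp (.trans _ _ _ (.symm _ _ h2)) (.trans _ _ _ (.symm _ _ h2))⟩
      · exact Or.inr ⟨h1, h2'⟩

/-- A vertex that is connected with a different one is not isolated. -/
theorem eqvGen_incident {α : Type*} {R : α → α → Prop} {x y : α} (h : Relation.EqvGen R x y) :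
    x = y ∨ (∃ z, R x z ∨ R z x) ∧ ∃ z, R y z ∨ R z y := by
  induction h with
  | rel a b hab => exact Or.inr ⟨⟨b, Or.inl hab⟩, ⟨a, Or.inr hab⟩⟩
  | refl a => exact Or.inl rfl
  | symm a b _ ih =>
    rcases ih with rfl | ⟨h1, h2⟩
    · exact Or.inl rfl
    · exact Or.inr ⟨h2, h1⟩
  | trans a b c _ _ ih1 ih2 =>
    rcases ih1 with rfl | ⟨h1, h2⟩
    · exact ih2
    · rcases ih2 with rfl | ⟨h3, h4⟩
      · exact Or.inr ⟨h1, h2⟩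
      · exact Or.inr ⟨h1, h4⟩

/-- The condition on the members at level `k`: the pairs form a connected graph on
`0, …, k - 1` or on `0, …, k`. -/
structure LevelGood (k : ℕ) (o : Member) : Prop where
  supp : ∀ a b, o.T a b ≠ 0 → a < b ∧ b ≤ k
  conn : ∀ x < k, ∀ y < k, Conn o.T x y
  le : o.A ≤ k
  attached : o.A = k ↔ ∃ a < k, o.T a k ≠ 0
  empty : ∀ e, o.U e = 0

/-- The set of pairs without the pair `uw`. -/
def removePair (u w : ℕ) (T : ℕ → ℕ → ℕ) : ℕ → ℕ → ℕ :=
  fun a b => if a = u ∧ b = w then 0 else T a b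

/-- The set of pairs `T` without the pair `uw`, and with `ak` for those ends `a` of `uw` that are
then not connected with `k`. -/
noncomputable def reroutePairs (k u w : ℕ) (T : ℕ → ℕ → ℕ) : ℕ → ℕ → ℕ := open Classical in
  fun a b => if b = k ∧ (a = u ∨ a = w) ∧ ¬ Conn (removePair u w T) a k then 1
    else removePair u w T a b

/-- Replacement of the pair `uw` by one or two pairs that contain `k`. -/
noncomputable def reroute (k u w : ℕ) (o : Member) : Member where
  T := reroutePairs k u w o.T
  U := o.U
  A := k

/-- Addition of the pair `uk`. -/
def attach (k u : ℕ) (o : Member) : Member where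
  T a b := if a = u ∧ b = k then 1 else o.T a b
  U := o.U
  A := k

/-- The indicator function of the pair `ab`. -/
noncomputable def pairInd (a b : ℕ) (o : Member) : ℝ := if o.T a b ≠ 0 then 1 else 0

/-- The degree of `k`. -/
noncomputable def degAt (k : ℕ) (o : Member) : ℝ := ∑ a ∈ range k, pairInd a k o

/-- The number of superfluous pairs that contain `k`. -/
noncomputable def excessAt (k : ℕ) (o : Member) : ℝ := max (degAt k o - 1) 0

theorem pairInd_nonneg (a b : ℕ) (o : Member) : 0 ≤ pairInd a b o := by
  unfold pairInd; split_ifs <;> norm_num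

theorem pairInd_le_one (a b : ℕ) (o : Member) : pairInd a b o ≤ 1 := by
  unfold pairInd; split_ifs <;> norm_num

theorem conn_removePair {k u w : ℕ} {o : Member} (h : LevelGood k o) (hu : u < k) {x : ℕ}
    (hx : x < k) : Conn (removePair u w o.T) x u ∨ Conn (removePair u w o.T) x w := by
  have := eqvGen_remove (R := fun p q => p < q ∧ o.T p q ≠ 0)
    (R' := fun p q => p < q ∧ removePair u w o.T p q ≠ 0) (u := u) (w := w)
    (by
      intro a b hab
      by_cases hc : a = u ∧ b = w
      · exact Or.inr hc
      · left; simpa [removePair, hc] using hab) (h.conn x hx u hu)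
  rcases this with h | h
  · exact Or.inl h
  · exact h.1

theorem removePair_le_reroute {k u w : ℕ} {T : ℕ → ℕ → ℕ} (a b : ℕ)
    (h : removePair u w T a b ≠ 0) : reroutePairs k u w T a b ≠ 0 := by
  unfold reroutePairs; split_ifs
  · norm_num
  · exact h

theorem conn_reroute {k u w : ℕ} {T : ℕ → ℕ → ℕ} {a : ℕ} (ha : a = u ∨ a = w) (hk : a < k) :
    Conn (reroutePairs k u w T) a k := by
  by_cases hc : Conn (removePair u w T) a k
  · exact hc.mono fun a b _ => removePair_le_reroute a b
  · refine Conn.single hk ?_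
    unfold reroutePairs
    rw [if_pos ⟨rfl, ha, hc⟩]; norm_num

/-- Without `uw`, every vertex below `k` is still connected with `u` or `w`. Both of these are
connected with `k` afterwards, either because they already were or by a new pair. So everything is
connected through `k`. -/
theorem reroute_good {k u w : ℕ} {o : Member} (huw : u < w) (hw : w < k) (h : LevelGood k o) :
    LevelGood k (reroute k u w o) := by
  have hu : u < k := huw.trans hw
  have hk : ∀ x < k, Conn (reroute k u w o).T x k := by
    intro x hx
    rcases conn_removePair (w := w) h hu hx with h1 | h1
    · exact (h1.mono fun a b _ => removePair_le_reroute a b).trans (conn_reroute (Or.inl rfl) hu)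
    · exact (h1.mono fun a b _ => removePair_le_reroute a b).trans (conn_reroute (Or.inr rfl) hw)
  have hsupp : ∀ a b, (reroute k u w o).T a b ≠ 0 → a < b ∧ b ≤ k := by
    intro a b hab
    simp only [reroute, reroutePairs, removePair] at hab
    split_ifs at hab with h1 h2
    · omega
    · exact absurd rfl hab
    · exact h.supp a b hab
  refine ⟨hsupp, fun x hx y hy => (hk x hx).trans (hk y hy).symm, le_rfl, ⟨fun _ => ?_, fun _ => rfl⟩,
    h.empty⟩
  -- That `k` has a pair is not obvious from the construction, as possibly none was added; it
  -- follows from the connection with `u ≠ k`.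
  rcases eqvGen_incident (hk u hu) with h1 | ⟨_, z, hz⟩
  · omega
  · rcases hz with hz | hz
    · have := hsupp _ _ hz.2; omega
    · exact ⟨z, hz.1, hz.2⟩

theorem reroute_not_mem {k u w : ℕ} {o : Member} (hw : w < k) : (reroute k u w o).T u w = 0 := by
  simp only [reroute, reroutePairs, removePair]
  rw [if_neg fun h => hw.ne h.1]
  simp

theorem pairInd_congr {a b : ℕ} {o o' : Member} (h : o.T a b = o'.T a b) :
    pairInd a b o = pairInd a b o' := by
  unfold pairInd; simp only [h]

theorem pairInd_reroute {k u w a b : ℕ} {o : Member} (hb : b < k) (hab : ¬ (a = u ∧ b = w)) :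
    pairInd a b (reroute k u w o) = pairInd a b o := by
  refine pairInd_congr ?_
  simp only [reroute, reroutePairs, removePair]
  rw [if_neg fun h => hb.ne h.1, if_neg hab]

open Classical in
theorem pairInd_reroute_star {k u w a : ℕ} {o : Member} (hw : w < k) :
    pairInd a k (reroute k u w o) ≤ pairInd a k o +
      (if a = u then if Conn (removePair u w o.T) u k then 0 else 1 else 0) +
      (if a = w then if Conn (removePair u w o.T) w k then 0 else 1 else 0) := by
  have h0 := pairInd_nonneg a k o
  have h1 := pairInd_le_one a k (reroute k u w o)
  have h2 : (0 : ℝ) ≤ (if a = u then if Conn (removePair u w o.T) u k then 0 else 1 else 0) := by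
    split_ifs <;> norm_num
  have h3 : (0 : ℝ) ≤ (if a = w then if Conn (removePair u w o.T) w k then 0 else 1 else 0) := by
    split_ifs <;> norm_num
  by_cases hc : (a = u ∨ a = w) ∧ ¬ Conn (removePair u w o.T) a k
  · rcases hc with ⟨rfl | rfl, hc⟩
    · rw [if_pos rfl, if_neg hc]; linarith
    · rw [if_pos (rfl : a = a), if_neg hc]; linarith
  · have : pairInd a k (reroute k u w o) = pairInd a k o := by
      refine pairInd_congr ?_
      simp only [reroute, reroutePairs, removePair]
      rw [if_neg fun h => hc h.2, if_neg fun h => hw.ne' h.2]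
    linarith

-- If a pair `ak` is present, then `a` remains connected with `u` or `w`, so one of these is still
-- connected with `k`, and at most one pair is added. If `k` has no pair, two may be added, but the
-- first of them is not superfluous. In both cases the excess rises by at most 1.
open Classical in
theorem excessAt_reroute {k u w : ℕ} {o : Member} (huw : u < w) (hw : w < k) (h : LevelGood k o) :
    excessAt k (reroute k u w o) ≤ excessAt k o + 1 := by
  have hu : u < k := huw.trans hw
  have hle : degAt k (reroute k u w o) ≤ degAt k o +
      (if Conn (removePair u w o.T) u k then 0 else 1) +
      (if Conn (removePair u w o.T) w k then 0 else 1) := by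
    unfold degAt
    refine (sum_le_sum fun a _ => pairInd_reroute_star (a := a) (u := u) (o := o) hw).trans ?_
    rw [sum_add_distrib, sum_add_distrib, sum_ite_eq', sum_ite_eq', if_pos (mem_range.2 hu),
      if_pos (mem_range.2 hw)]
  unfold excessAt
  have hdeg0 : 0 ≤ degAt k o := sum_nonneg fun a _ => pairInd_nonneg _ _ _
  by_cases hatt : o.A = k
  · obtain ⟨a, ha, hak⟩ := h.attached.1 hatt
    have h1 : 1 ≤ degAt k o := by
      have := single_le_sum (f := fun a => pairInd a k o) (fun a _ => pairInd_nonneg a k o)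
        (mem_range.2 ha)
      have e : pairInd a k o = 1 := by simp [pairInd, hak]
      unfold degAt; linarith
    -- The pair `ak` differs from the removed pair because `w < k`.
    have hak' : Conn (removePair u w o.T) a k := by
      refine Conn.single ha ?_
      unfold removePair
      rw [if_neg (by omega)]; exact hak
    have h2 : degAt k (reroute k u w o) ≤ degAt k o + 1 := by
      rcases conn_removePair (w := w) h hu ha with h3 | h3
      · rw [if_pos (h3.symm.trans hak')] at hle
        split_ifs at hle <;> linarith
      · rw [if_pos (c := Conn (removePair u w o.T) w k) (h3.symm.trans hak')] at hle
        split_ifs at hle <;> linarith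
    refine max_le ?_ ?_
    · have := le_max_left (degAt k o - 1) 0; linarith
    · have := le_max_right (degAt k o - 1) 0; linarith
  · have h1 : degAt k o = 0 := by
      unfold degAt
      refine sum_eq_zero fun a ha => ?_
      unfold pairInd
      rw [if_neg]
      intro hak
      exact hatt (h.attached.2 ⟨a, mem_range.1 ha, hak⟩)
    have h2 : degAt k (reroute k u w o) ≤ 2 := by
      split_ifs at hle <;> linarith
    have := le_max_right (degAt k o - 1) 0
    refine max_le ?_ ?_ <;> linarith

theorem degAt_eq_zero {k : ℕ} {o : Member} (h : LevelGood k o) (hA : o.A ≠ k) : degAt k o = 0 := by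
  unfold degAt
  refine sum_eq_zero fun a ha => ?_
  unfold pairInd
  rw [if_neg]
  intro hak
  exact hA (h.attached.2 ⟨a, mem_range.1 ha, hak⟩)

theorem attach_good {k u : ℕ} {o : Member} (hu : u < k) (h : LevelGood k o) :
    LevelGood k (attach k u o) := by
  refine ⟨fun a b hab => ?_, fun x hx y hy => ?_, le_rfl,
    ⟨fun _ => ⟨u, hu, ?_⟩, fun _ => rfl⟩, h.empty⟩
  · simp only [attach] at hab
    split_ifs at hab with h1
    · omega
    · exact h.supp a b hab
  · refine (h.conn x hx y hy).mono fun a b _ hab => ?_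
    simp only [attach]; split_ifs
    · norm_num
    · exact hab
  · simp [attach]

theorem pairInd_attach {k u a b : ℕ} {o : Member} (hab : ¬ (a = u ∧ b = k)) :
    pairInd a b (attach k u o) = pairInd a b o := by
  refine pairInd_congr ?_
  simp only [attach]
  rw [if_neg hab]

theorem pairInd_attach_self {k u : ℕ} {o : Member} (hu : u < k) (h : LevelGood k o) (hA : o.A ≠ k) :
    pairInd u k (attach k u o) = pairInd u k o + 1 := by
  have : o.T u k = 0 := by
    by_contra hne; exact hA (h.attached.2 ⟨u, hu, hne⟩)
  simp [pairInd, attach, this]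

/-- The degree of `k` rises from 0 to 1, and a single pair is not superfluous. -/
theorem excessAt_attach {k u : ℕ} {o : Member} (hu : u < k) (h : LevelGood k o) (hA : o.A ≠ k) :
    excessAt k (attach k u o) ≤ excessAt k o := by
  have h1 : degAt k (attach k u o) = degAt k o + 1 := by
    unfold degAt
    have hm : u ∈ range k := mem_range.2 hu
    rw [← add_sum_erase _ _ hm, ← add_sum_erase (range k) (fun a => pairInd a k o) hm,
      pairInd_attach_self hu h hA]
    rw [sum_congr rfl fun a ha => pairInd_attach (o := o) (k := k) (b := k) (u := u) (by
      have := ne_of_mem_erase ha; tauto)]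
    ring
  have h2 := degAt_eq_zero h hA
  unfold excessAt
  rw [h1, h2]; norm_num

/-- Sums over pairs of numbers below `k` that are enumerated by division with remainder. -/
theorem sum_divMod (n : ℕ) (g : ℕ → ℕ → ℝ) :
    ∑ j ∈ range (n * n), g (j / n) (j % n) = ∑ u ∈ range n, ∑ w ∈ range n, g u w := by
  have key : ∀ i ≤ n, ∑ j ∈ range (i * n), g (j / n) (j % n) =
      ∑ u ∈ range i, ∑ w ∈ range n, g u w := by
    intro i
    induction i with
    | zero => simp
    | succ i ih =>
      intro hi
      rw [Nat.succ_mul, sum_range_add, ih (by omega), sum_range_succ]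
      congr 1
      refine sum_congr rfl fun w hw => ?_
      have hw' := mem_range.1 hw
      have hd : (i * n + w) / n = i := by
        rw [mul_comm, Nat.mul_add_div (by omega), Nat.div_eq_of_lt hw', add_zero]
      have hm : (i * n + w) % n = w := by
        rw [Nat.mul_add_mod', Nat.mod_eq_of_lt hw']
      rw [hd, hm]
  exact key n le_rfl

/-- Each pair that contains `a` is enumerated once, with its smaller element as quotient. Only the
diagonal term of the right side is lost. -/
theorem sum_pairs_star_le {n k a : ℕ} (hkn : k < n) (ha : a < k) {α : ℕ → ℕ → ℝ}
    (hα : ∀ x < k, ∀ y < k, 0 ≤ α x y) (hs : ∀ x y, α x y = α y x) :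
    ∑ j ∈ range (n * n), (if (j / n < j % n ∧ j % n < k) ∧ (a = j / n ∨ a = j % n) then
      α (j / n) (j % n) else 0) ≤ ∑ b ∈ range k, α a b := by
  rw [sum_divMod n fun u w => if (u < w ∧ w < k) ∧ (a = u ∨ a = w) then α u w else 0]
  have e : ∀ u w, (if (u < w ∧ w < k) ∧ (a = u ∨ a = w) then α u w else 0) =
      (if u = a then if a < w ∧ w < k then α a w else 0 else 0) +
      (if w = a then if u < a then α a u else 0 else 0) := by
    intro u w
    by_cases h1 : u = a
    · subst h1
      by_cases h2 : w = u
      · subst h2; simp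
      · simp [h2]
    · by_cases h2 : w = a
      · subst h2; simp [h1, ha, hs u w]
      · simp [h1, h2, Ne.symm h1, Ne.symm h2]
  simp_rw [e, sum_add_distrib]
  have han : a < n := ha.trans hkn
  have e1 : ∑ u ∈ range n, ∑ w ∈ range n, (if u = a then if a < w ∧ w < k then α a w else 0 else 0) =
      ∑ w ∈ range n, if a < w ∧ w < k then α a w else 0 := by
    rw [sum_comm]; refine sum_congr rfl fun w _ => ?_
    rw [sum_ite_eq', if_pos (mem_range.2 han)]
  have e2 : ∑ u ∈ range n, ∑ w ∈ range n, (if w = a then if u < a then α a u else 0 else 0) =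
      ∑ u ∈ range n, if u < a then α a u else 0 := by
    refine sum_congr rfl fun w _ => ?_
    rw [sum_ite_eq', if_pos (mem_range.2 han)]
  rw [e1, e2, ← sum_add_distrib]
  have e3 : ∑ b ∈ range k, α a b = ∑ b ∈ range n, if b < k then α a b else 0 := by
    rw [← sum_filter]
    refine sum_congr ?_ fun _ _ => rfl
    ext b; simp; omega
  rw [e3]
  refine sum_le_sum fun b _ => ?_
  by_cases h1 : b < k
  · have := hα a ha b h1
    by_cases h2 : b < a
    · have h3 : ¬ a < b := by omega
      simp [h1, h2, h3]
    · split_ifs <;> linarith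
  · have h2 : ¬ b < a := by omega
    simp [h1, h2]

/-- The double sum counts every unordered pair twice. This factor 2 is what bounds the excess by
half of the degree of `k`. -/
theorem sum_pairs_le {n k : ℕ} (hkn : k < n) {α : ℕ → ℕ → ℝ}
    (hα : ∀ x < k, ∀ y < k, 0 ≤ α x y) (hs : ∀ x y, α x y = α y x) :
    2 * ∑ j ∈ range (n * n), (if j / n < j % n ∧ j % n < k then α (j / n) (j % n) else 0) ≤
      ∑ a ∈ range k, ∑ b ∈ range k, α a b := by
  rw [sum_divMod n fun u w => if u < w ∧ w < k then α u w else 0]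
  have e1 : ∑ u ∈ range n, ∑ w ∈ range n, (if u < w ∧ w < k then α u w else 0) =
      ∑ u ∈ range k, ∑ w ∈ range k, if u < w then α u w else 0 := by
    have hsub : range k ⊆ range n := range_subset_range.2 hkn.le
    rw [← sum_subset hsub]
    · refine sum_congr rfl fun u hu => ?_
      rw [← sum_subset hsub]
      · refine sum_congr rfl fun w hw => ?_
        have := mem_range.1 hw
        simp [this]
      · intro w _ hw
        rw [if_neg]; simp at hw; omega
    · intro u _ hu
      refine sum_eq_zero fun w _ => ?_
      rw [if_neg]; simp at hu; omega
  have e2 : ∑ u ∈ range k, ∑ w ∈ range k, (if u < w then α u w else 0) =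
      ∑ u ∈ range k, ∑ w ∈ range k, if w < u then α u w else 0 := by
    rw [sum_comm]
    refine sum_congr rfl fun u _ => sum_congr rfl fun w _ => ?_
    rw [hs]
  rw [e1, two_mul]
  nth_rewrite 2 [e2]
  rw [← sum_add_distrib]
  refine sum_le_sum fun u hu => ?_
  rw [← sum_add_distrib]
  refine sum_le_sum fun w hw => ?_
  have := hα u (mem_range.1 hu) w (mem_range.1 hw)
  split_ifs <;> first | omega | linarith

end RAM

/-! ### Programs that evaluate the family or modify one member. -/

namespace RAM

open Finset WCut

namespace Stmt

/-- Puts the total weight of the members that pass the test into the real variable `7`. -/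
def sumWeights (b : Test) : Stmt :=
  rassign 7 (rconst 0) ;;
  iter 43 familyBound (when (.and (.ltInt (var 43) (var 3)) b)
    (rassign 7 (.add (rvar 7) (.get 1 (var 43)))))

theorem familyBound_congr {s t : State} (h : t.ints 0 = s.ints 0) :
    familyBound.eval t = familyBound.eval s := IntExpr.eval_static (by decide) h

theorem sumWeights_spec {b : Test} {s : State} {n m ℓ : ℕ} (φ : Member → ℝ)
    (hℓ : s.ints 3 0 = ℓ) (hbound : ℓ ≤ familyBound.eval s)
    (hb : ∀ t : State, (∀ c, c ∉ [43, 99] → t.ints c = s.ints c) →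
      (∀ c, c ≠ 7 → t.reals c = s.reals c) → t.ints 43 0 < ℓ →
      (b.holds t → φ (member n m s (t.ints 43 0)) = 1) ∧
      (¬ b.holds t → φ (member n m s (t.ints 43 0)) = 0)) :
    ((sumWeights b).run s).reals 7 0 = famSum n m s φ := by
  have e : familyBound.eval (s.setReal 7 0 0) = familyBound.eval s := familyBound_congr rfl
  have := run_iter (a := 43) (N := familyBound) (s := s.setReal 7 0 0)
    (P := when (.and (.ltInt (var 43) (var 3)) b) (rassign 7 (.add (rvar 7) (.get 1 (var 43)))))
    -- The loop runs up to the static bound on the family size; rounds beyond the actual size add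
    -- nothing.
    (fun i t => t.reals 7 0 = ∑ j ∈ range (min i ℓ), s.reals 1 j * φ (member n m s j))
    (by simp)
    (by
      intro i t hi hc hfi hfr ih
      have g1 : ∀ c, c ∉ [43, 99] → t.ints c = s.ints c := by
        intro c hc
        simp only [List.mem_cons, List.not_mem_nil, or_false, not_or] at hc
        rw [hfi c hc.1 (by simp [writesInt, when, skip, assign, rassign]; omega)]; rfl
      have g2 : ∀ c, c ≠ 7 → t.reals c = s.reals c := by
        intro c hc
        rw [hfr c (by simp [writesReal, when, skip, assign, rassign]; omega)]
        funext j; simp [hc]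
      rw [reals_setInt]
      by_cases hil : i < ℓ
      · have hb' := hb t g1 g2 (by rwa [hc])
        rw [hc] at hb'
        have hl : t.ints 43 0 < t.ints 3 0 := by rw [hc, g1 3 (by decide), hℓ]; exact hil
        rw [min_eq_left hil.le] at ih
        rw [min_eq_left (by omega : i + 1 ≤ ℓ), sum_range_succ]
        by_cases hbt : b.holds t
        · have hh : (Test.and (.ltInt (var 43) (var 3)) b).holds t := by
            simp only [Test.holds]; exact ⟨hl, hbt⟩
          rw [run_when_pos hh, hb'.1 hbt]
          simp [RealExpr.eval, ih, hc, g2 1 (by norm_num)]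
        · have hh : ¬ (Test.and (.ltInt (var 43) (var 3)) b).holds t := by
            simp only [Test.holds]; exact fun h => hbt h.2
          rw [run_when_neg hh, hb'.2 hbt]
          simp [ih]
      · have hh : ¬ (Test.and (.ltInt (var 43) (var 3)) b).holds t := by
          simp only [Test.holds, eval_var, hc, g1 3 (by decide), hℓ]; exact fun h => hil h.1
        rw [run_when_neg hh]
        rw [min_eq_right (by omega)] at ih ⊢
        simpa using ih)
  rw [e, min_eq_right hbound] at this
  simp only [sumWeights, run_seq, run_rassign, eval_rconst, Nat.cast_zero]
  rw [this, famSum, hℓ]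

theorem sumWeights_writesInt (b : Test) {c : ℕ} (hc : c ∉ [43, 99]) :
    (sumWeights b).writesInt c = false := by
  simp only [List.mem_cons, List.not_mem_nil, or_false, not_or] at hc
  simp [sumWeights, writesInt, when, skip, assign, rassign]; omega

theorem sumWeights_writesReal (b : Test) {c : ℕ} (hc : c ≠ 7) :
    (sumWeights b).writesReal c = false := by
  simp [sumWeights, writesReal, when, skip, assign, rassign]; omega

/-- Whether the current member contains the pair `ef`. -/
def hasPair (i e f : IntExpr) : Test := .ltInt (.const 0) (.get 5 (i.pair (e.pair f)))

/-- Replaces the pair `uw` of the current member by pairs that contain `k`, where `k`, `u`, `w`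
are in the variables `10`, `16`, `17`. -/
def rerouteMember : Stmt :=
  setInt 5 ((var 40).pair ((var 16).pair (var 17))) (.const 0) ;;
  labels (.mul numV numV)
    (.and (.ltInt (.div (var 30) numV) (.mod (var 30) numV))
      (hasPair (var 40) (.div (var 30) numV) (.mod (var 30) numV)))
    (.div (var 30) numV) (.mod (var 30) numV) ;;
  when (.not (.eqInt (.get 7 (var 16)) (.get 7 (var 10))))
    (setInt 5 ((var 40).pair ((var 16).pair (var 10))) (.const 1)) ;;
  when (.not (.eqInt (.get 7 (var 17)) (.get 7 (var 10))))
    (setInt 5 ((var 40).pair ((var 17).pair (var 10))) (.const 1)) ;;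
  setInt 8 (var 40) (var 10)

theorem div_mod_surj {n p q : ℕ} (hp : p < n) (hq : q < n) :
    ∃ j < n * n, j / n = p ∧ j % n = q := by
  refine ⟨p * n + q, ?_, ?_, ?_⟩
  · nlinarith
  · rw [mul_comm, Nat.mul_add_div (by omega), Nat.div_eq_of_lt hq, add_zero]
  · rw [Nat.mul_add_mod', Nat.mod_eq_of_lt hq]

theorem member_of_lt {n m : ℕ} (s : State) {i a b : ℕ} (ha : a < n) (hb : b < n) :
    (member n m s i).T a b = s.ints 5 (pairIndex i (pairIndex a b)) := by
  simp [member, ha, hb]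

/-- The components are computed once, after the removal of `uw` and before any insertion. So
inserting `uk` does not influence the decision about `wk`, in accordance with `reroutePairs`. -/
theorem rerouteMember_spec {t : State} {n m i k u w : ℕ} (hn : t.ints 0 0 = n)
    (hi : t.ints 40 0 = i) (hk : t.ints 10 0 = k) (hu : t.ints 16 0 = u) (hw : t.ints 17 0 = w)
    (huw : u < w) (hwk : w < k) (hkn : k < n) :
    member n m (rerouteMember.run t) i = reroute k u w (member n m t i) ∧
    ∀ j, j ≠ i → member n m (rerouteMember.run t) j = member n m t j := by
  obtain ⟨t1, ht1⟩ : ∃ t1, t1 = t.setInt 5 (pairIndex i (pairIndex u w)) 0 := ⟨_, rfl⟩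
  obtain ⟨t2, ht2⟩ : ∃ t2, t2 = (labels (.mul numV numV)
    (.and (.ltInt (.div (var 30) numV) (.mod (var 30) numV))
      (hasPair (var 40) (.div (var 30) numV) (.mod (var 30) numV)))
    (.div (var 30) numV) (.mod (var 30) numV)).run t1 := ⟨_, rfl⟩
  have f1 : ∀ c, c ≠ 5 → t1.ints c = t.ints c := fun c hc => by
    rw [ht1]; exact ints_setInt_ne _ hc _ _
  have f2 : ∀ c, c ∉ [7, 30, 31, 32, 33, 99] → t2.ints c = t1.ints c := by
    intro c hc
    simp only [List.mem_cons, List.not_mem_nil, or_false, not_or] at hc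
    rw [ht2]
    exact run_ints _ (by simp [labels, writesInt, when, skip, assign]; omega) _
  have T1 : ∀ a b, a < n → b < n → t1.ints 5 (pairIndex i (pairIndex a b)) =
      removePair u w (member n m t i).T a b := by
    intro a b ha hb
    rw [ht1, removePair, member_of_lt t ha hb]
    simp [pairIndex_inj]
  have hlab : ∀ z < n, t2.ints 7 z = t2.ints 7 k ↔
      Conn (removePair u w (member n m t i).T) z k := by
    intro z hz
    rw [ht2]
    rw [labels_spec (s := t1) (K := n * n) (n := n) (by rw [f1 0 (by norm_num), hn])
      (fun j => j / n < j % n ∧ removePair u w (member n m t i).T (j / n) (j % n) ≠ 0)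
      (fun j => j / n) (fun j => j % n)
      (by
        intro r hr
        simp [IntExpr.eval, hr 0 (by decide), f1 0 (by norm_num), hn])
      (by
        intro r j hr _ hj hjn
        have e0 : r.ints 0 0 = n := by rw [hr 0 (by decide), f1 0 (by norm_num), hn]
        have e40 : r.ints 40 0 = i := by rw [hr 40 (by decide), f1 40 (by norm_num), hi]
        have hd : j / n < n := Nat.div_lt_of_lt_mul hjn
        have hm : j % n < n := Nat.mod_lt _ (by omega)
        simp only [Test.holds, hasPair, IntExpr.eval, IntExpr.eval_pair, eval_var, eval_numV, e0,
          e40, hj, hr 5 (by decide), T1 _ _ hd hm, Nat.pos_iff_ne_zero, true_and]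
        exact fun _ => ⟨hd, hm⟩) z hz k hkn]
    refine ⟨Relation.EqvGen.mono ?_ z k, Relation.EqvGen.mono ?_ z k⟩
    · rintro p q ⟨j, -, hj, rfl, rfl⟩
      exact hj
    -- A member has no pairs outside `0, …, n - 1`, so every pair occurs in the enumeration by
    -- quotient and remainder.
    · rintro p q ⟨hpq, hT⟩
      have hlt : p < n ∧ q < n := by
        by_contra hc
        exact hT (by simp [removePair, member, hc])
      obtain ⟨j, hj, rfl, rfl⟩ := div_mod_surj hlt.1 hlt.2
      exact ⟨j, hj, ⟨hpq, hT⟩, rfl, rfl⟩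
  have e10 : t2.ints 10 0 = k := by rw [f2 10 (by decide), f1 10 (by norm_num), hk]
  have e16 : t2.ints 16 0 = u := by rw [f2 16 (by decide), f1 16 (by norm_num), hu]
  have e17 : t2.ints 17 0 = w := by rw [f2 17 (by decide), f1 17 (by norm_num), hw]
  have e40 : t2.ints 40 0 = i := by rw [f2 40 (by decide), f1 40 (by norm_num), hi]
  obtain ⟨t3, ht3⟩ : ∃ t3, t3 = (when (.not (.eqInt (.get 7 (var 16)) (.get 7 (var 10))))
    (setInt 5 ((var 40).pair ((var 16).pair (var 10))) (.const 1))).run t2 := ⟨_, rfl⟩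
  have f3 : ∀ c, c ≠ 5 → c ≠ 99 → t3.ints c = t2.ints c := by
    intro c h1 h2
    rw [ht3]
    exact run_ints _ (by simp [writesInt, when, skip, assign]; omega) _
  obtain ⟨t4, ht4⟩ : ∃ t4, t4 = (when (.not (.eqInt (.get 7 (var 17)) (.get 7 (var 10))))
    (setInt 5 ((var 40).pair ((var 17).pair (var 10))) (.const 1))).run t3 := ⟨_, rfl⟩
  have f4 : ∀ c, c ≠ 5 → c ≠ 99 → t4.ints c = t3.ints c := by
    intro c h1 h2
    rw [ht4]
    exact run_ints _ (by simp [writesInt, when, skip, assign]; omega) _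
  have T3 : ∀ y, t3.ints 5 y = if y = pairIndex i (pairIndex u k) ∧
      ¬ t2.ints 7 u = t2.ints 7 k then 1 else t2.ints 5 y := by
    intro y
    rw [ht3]
    by_cases hc : t2.ints 7 u = t2.ints 7 k
    · rw [run_when_neg (by simp [Test.holds, IntExpr.eval, e10, e16, hc])]
      simp [hc]
    · rw [run_when_pos (by simp [Test.holds, IntExpr.eval, e10, e16, hc])]
      simp [hc, e40, e16, e10, IntExpr.eval]
  have T4 : ∀ y, t4.ints 5 y = if y = pairIndex i (pairIndex w k) ∧
      ¬ t2.ints 7 w = t2.ints 7 k then 1 else t3.ints 5 y := by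
    intro y
    have g10 : t3.ints 10 0 = k := by rw [f3 10 (by norm_num) (by norm_num), e10]
    have g17 : t3.ints 17 0 = w := by rw [f3 17 (by norm_num) (by norm_num), e17]
    have g40 : t3.ints 40 0 = i := by rw [f3 40 (by norm_num) (by norm_num), e40]
    have g7 : t3.ints 7 = t2.ints 7 := f3 7 (by norm_num) (by norm_num)
    rw [ht4]
    by_cases hc : t2.ints 7 w = t2.ints 7 k
    · rw [run_when_neg (by simp [Test.holds, IntExpr.eval, g10, g17, g7, hc])]
      simp [hc]
    · rw [run_when_pos (by simp [Test.holds, IntExpr.eval, g10, g17, g7, hc])]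
      simp [hc, g40, g17, g10, IntExpr.eval]
  have g40 : t4.ints 40 0 = i := by
    rw [f4 40 (by norm_num) (by norm_num), f3 40 (by norm_num) (by norm_num), e40]
  have g10 : t4.ints 10 0 = k := by
    rw [f4 10 (by norm_num) (by norm_num), f3 10 (by norm_num) (by norm_num), e10]
  have g6 : t4.ints 6 = t.ints 6 := by
    rw [f4 6 (by norm_num) (by norm_num), f3 6 (by norm_num) (by norm_num), f2 6 (by decide),
      f1 6 (by norm_num)]
  have g8 : t4.ints 8 = t.ints 8 := by
    rw [f4 8 (by norm_num) (by norm_num), f3 8 (by norm_num) (by norm_num), f2 8 (by decide),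
      f1 8 (by norm_num)]
  have hrun : rerouteMember.run t = t4.setInt 8 i k := by
    simp only [rerouteMember, run_seq]
    have : (setInt 5 ((var 40).pair ((var 16).pair (var 17))) (.const 0)).run t = t1 := by
      rw [ht1]; simp [hi, hu, hw, IntExpr.eval]
    rw [this, ← ht2, ← ht3, ← ht4]
    simp [g40, g10]
  have T2 : t2.ints 5 = t1.ints 5 := f2 5 (by decide)
  have hu' := hlab u (by omega)
  have hw' := hlab w (by omega)
  have d58 : ∀ y, (t4.setInt 8 i k).ints 5 y = t4.ints 5 y := fun y => by simp
  have d68 : ∀ y, (t4.setInt 8 i k).ints 6 y = t4.ints 6 y := fun y => by simp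
  rw [hrun]
  refine ⟨?_, fun j hj => ?_⟩
  · refine Member.ext ?_ ?_ ?_
    · funext a b
      by_cases hab : a < n ∧ b < n
      · rw [member_of_lt _ hab.1 hab.2, d58, T4, T3, T2, T1 a b hab.1 hab.2]
        simp only [reroute, reroutePairs, pairIndex_inj, true_and]
        by_cases hbk : b = k
        · subst hbk
          by_cases hau : a = u
          · subst hau
            simp only [hu', huw.ne]; split_ifs <;> first | rfl | (exfalso; tauto)
          · by_cases haw : a = w
            · subst haw; simp only [hw', hau]; split_ifs <;> first | rfl | (exfalso; tauto)
            · simp [hau, haw]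
        · simp [hbk]
      · have : (reroute k u w (member n m t i)).T a b = 0 := by
          simp only [reroute, reroutePairs]
          rw [if_neg (by omega)]
          simp [removePair, member, hab]
        rw [this]; simp [member, hab]
    · funext e; simp only [member, reroute, d68, g6]
    · simp [member, reroute]
  · refine Member.ext ?_ ?_ ?_
    · funext a b
      simp only [member, d58, T4, T3, T2, ht1, ints_setInt, pairIndex_inj, hj, false_and, and_false,
        if_false]
    · funext e; simp only [member, d68, g6]
    · simp [member, hj, g8]

theorem rerouteMember_isAction : IsAction rerouteMember := by
  refine ⟨fun c hc => ?_, fun c => ?_⟩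
  · simp only [List.mem_cons, List.not_mem_nil, or_false, not_or] at hc
    simp [rerouteMember, labels, writesInt, when, skip, assign]; omega
  · simp [rerouteMember, labels, writesReal, when, skip, assign]

/-- Adds the pair `uk` to the current member. -/
def attachMember : Stmt :=
  setInt 5 ((var 40).pair ((var 16).pair (var 10))) (.const 1) ;;
  setInt 8 (var 40) (var 10)

theorem attachMember_spec {t : State} {n m i k u : ℕ}
    (hi : t.ints 40 0 = i) (hk : t.ints 10 0 = k) (hu : t.ints 16 0 = u)
    (huk : u < k) (hkn : k < n) :
    member n m (attachMember.run t) i = attach k u (member n m t i) ∧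
    ∀ j, j ≠ i → member n m (attachMember.run t) j = member n m t j := by
  have hrun : attachMember.run t =
      (t.setInt 5 (pairIndex i (pairIndex u k)) 1).setInt 8 i k := by
    simp [attachMember, hi, hk, hu, IntExpr.eval]
  rw [hrun]
  refine ⟨?_, fun j hj => ?_⟩
  · refine Member.ext ?_ ?_ ?_
    · funext a b
      by_cases hab : a < n ∧ b < n
      · rw [member_of_lt _ hab.1 hab.2]
        simp [pairIndex_inj, attach, member, hab.1, hab.2]
      · have : ¬ (a = u ∧ b = k) := by omega
        simp [member, hab, attach, this]
    · funext e; simp [member, attach]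
    · simp [member, attach]
  · refine Member.ext ?_ ?_ ?_
    · funext a b; simp [member, pairIndex_inj, hj]
    · funext e; simp [member]
    · simp [member, hj]

theorem attachMember_isAction : IsAction attachMember := by
  refine ⟨fun c hc => ?_, fun c => ?_⟩
  · simp only [List.mem_cons, List.not_mem_nil, or_false, not_or] at hc
    simp [attachMember, writesInt]; omega
  · simp [attachMember, writesReal]

end Stmt

end RAM

/-! ### Weighted sums over the family, and transfers for one pair. -/

namespace RAM

open Finset WCut

namespace Stmt

theorem famSum_add (n m : ℕ) (s : State) (φ ψ : Member → ℝ) :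
    famSum n m s (fun o => φ o + ψ o) = famSum n m s φ + famSum n m s ψ := by
  simp only [famSum, mul_add, sum_add_distrib]

theorem famSum_neg (n m : ℕ) (s : State) (φ : Member → ℝ) :
    famSum n m s (fun o => -φ o) = -famSum n m s φ := by
  simp only [famSum, mul_neg, sum_neg_distrib]

theorem famSum_sum (n m : ℕ) (s : State) {ι : Type*} (A : Finset ι) (φ : ι → Member → ℝ) :
    famSum n m s (fun o => ∑ a ∈ A, φ a o) = ∑ a ∈ A, famSum n m s (φ a) := by
  simp only [famSum, mul_sum]; rw [sum_comm]

theorem IsFamily.famSum_le {n m : ℕ} {Good : Member → Prop} {s : State}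
    (h : IsFamily n m Good s) {φ ψ : Member → ℝ} (hφ : ∀ o, Good o → φ o ≤ ψ o) :
    famSum n m s φ ≤ famSum n m s ψ :=
  sum_le_sum fun i hi => mul_le_mul_of_nonneg_left (hφ _ (h.good i (mem_range.1 hi)))
    (h.pos i (mem_range.1 hi)).le

theorem IsFamily.famSum_nonneg {n m : ℕ} {Good : Member → Prop} {s : State}
    (h : IsFamily n m Good s) {φ : Member → ℝ} (hφ : ∀ o, Good o → 0 ≤ φ o) :
    0 ≤ famSum n m s φ :=
  sum_nonneg fun i hi => mul_nonneg (h.pos i (mem_range.1 hi)).le (hφ _ (h.good i (mem_range.1 hi)))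

theorem famSum_eq_zero {n m : ℕ} {s : State} {φ : Member → ℝ}
    (hφ : ∀ i < s.ints 3 0, φ (member n m s i) = 0) : famSum n m s φ = 0 :=
  sum_eq_zero fun i hi => by rw [hφ i (mem_range.1 hi), mul_zero]

/-- All multipliers are positive. This converts bounds on total weight into statements about every
single member. -/
theorem IsFamily.eq_zero {n m : ℕ} {Good : Member → Prop} {s : State}
    (h : IsFamily n m Good s) {φ : Member → ℝ} (hφ : ∀ o, Good o → 0 ≤ φ o)
    (hs : famSum n m s φ ≤ 0) : ∀ i < s.ints 3 0, φ (member n m s i) = 0 := by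
  intro i hi
  have h1 := (sum_eq_zero_iff_of_nonneg (s := range (s.ints 3 0))
    (f := fun i => s.reals 1 i * φ (member n m s i)) fun i hi =>
    mul_nonneg (h.pos i (mem_range.1 hi)).le (hφ _ (h.good i (mem_range.1 hi)))).1
    (le_antisymm hs (h.famSum_nonneg hφ)) i (mem_range.2 hi)
  exact (mul_eq_zero.1 h1).resolve_left (h.pos i hi).ne'

theorem famSum_congr {n m : ℕ} {s t : State} (h3 : t.ints 3 = s.ints 3) (h5 : t.ints 5 = s.ints 5)
    (h6 : t.ints 6 = s.ints 6) (h8 : t.ints 8 = s.ints 8) (h1 : t.reals 1 = s.reals 1) :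
    famSum n m t = famSum n m s := by
  funext φ; unfold famSum; rw [h3, h1, member_congr h5 h6 h8]

theorem IsFamily.congr {n m : ℕ} {Good : Member → Prop} {s t : State}
    (h : IsFamily n m Good s) (h3 : t.ints 3 = s.ints 3) (h5 : t.ints 5 = s.ints 5)
    (h6 : t.ints 6 = s.ints 6) (h8 : t.ints 8 = s.ints 8) (h1 : t.reals 1 = s.reals 1) :
    IsFamily n m Good t := by
  refine ⟨fun i hi => ?_, fun i hi => ?_⟩
  · rw [member_congr h5 h6 h8]; rw [h3] at hi; exact h.good i hi
  · rw [h1]; rw [h3] at hi; exact h.pos i hi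

/-- A step in which members of total weight `μ` change: functions that grow by at most `c` on each
changed member grow by at most `cμ` on the family. -/
structure Moves (n m : ℕ) (Good pred : Member → Prop) (f : Member → Member) (μ : ℝ)
    (s t : State) : Prop where
  nonneg : 0 ≤ μ
  fam : IsFamily n m Good t
  size : t.ints 3 0 ≤ s.ints 3 0 + 1
  sum_le : ∀ (φ : Member → ℝ) (c : ℝ), (∀ o, Good o → pred o → φ (f o) ≤ φ o + c) →
    famSum n m t φ ≤ famSum n m s φ + c * μ

/-- The constants `1` and `-1` do not grow on any member, so the total weight grows in neither
direction. -/
theorem Moves.total {n m : ℕ} {Good pred : Member → Prop} {f : Member → Member} {μ : ℝ}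
    {s t : State} (h : Moves n m Good pred f μ s t) :
    famSum n m t (fun _ => 1) = famSum n m s (fun _ => 1) := by
  have h1 := h.sum_le (fun _ => 1) 0 fun _ _ _ => by norm_num
  have h2 := h.sum_le (fun _ => -1) 0 fun _ _ _ => by norm_num
  have h3 := famSum_neg n m t fun _ => 1
  have h4 := famSum_neg n m s fun _ => 1
  linarith

theorem Moves.congr {n m : ℕ} {Good pred : Member → Prop} {f : Member → Member} {μ : ℝ}
    {s s' t : State} (h : Moves n m Good pred f μ s t)
    (h3 : s'.ints 3 = s.ints 3) (h5 : s'.ints 5 = s.ints 5)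
    (h6 : s'.ints 6 = s.ints 6) (h8 : s'.ints 8 = s.ints 8) (h1 : s'.reals 1 = s.reals 1) :
    Moves n m Good pred f μ s' t :=
  ⟨h.nonneg, h.fam, by rw [h3]; exact h.size, by rw [famSum_congr h3 h5 h6 h8 h1]; exact h.sum_le⟩

theorem transfer_moves {b : Test} {act : Stmt} {s : State} {n m : ℕ}
    (Good pred : Member → Prop) (f : Member → Member)
    (hn : s.ints 0 0 = n) (hm : s.ints 0 1 = m)
    (hbound : s.ints 3 0 ≤ familyBound.eval s) (hA : IsAction act)
    (hb : ∀ t, SameEnv s t → (b.holds t ↔ pred (member n m t (t.ints 40 0))))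
    (hact : ∀ t, SameEnv s t → Good (member n m t (t.ints 40 0)) →
      pred (member n m t (t.ints 40 0)) →
      member n m (act.run t) (t.ints 40 0) = f (member n m t (t.ints 40 0)) ∧
      ∀ j, j ≠ t.ints 40 0 → member n m (act.run t) j = member n m t j)
    (hGood : ∀ o, Good o → pred o → Good (f o) ∧ ¬ pred (f o)) (hF : IsFamily n m Good s) :
    ∃ μ, Moves n m Good pred f μ s ((transfer b act).run s) ∧ μ ≤ max 0 (s.reals 7 0) ∧
      (μ = max 0 (s.reals 7 0) ∨ ∀ i < ((transfer b act).run s).ints 3 0,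
        ¬ pred (member n m ((transfer b act).run s) i)) := by
  obtain ⟨μ, h1, h2, h3, h4, h5, h6⟩ :=
    transfer_spec Good pred f hn hm rfl rfl hbound hA hb hact hGood hF
  exact ⟨μ, ⟨h1, h3, h4, h6⟩, h2, h5⟩

/-- The weight of the pair `ab` at the level in the variable `10`. -/
def levelEntry (a b : IntExpr) : RealExpr := .get 3 ((var 10).pair (a.pair b))

/-- Reduces the weight of the members with the pair `uw` to its weight at level `k`, where `k`,
`u`, `w` are in the variables `10`, `16`, `17`. -/
def reducePair : Stmt :=
  sumWeights (hasPair (var 43) (var 16) (var 17)) ;;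
  rassign 7 (.sub (rvar 7) (levelEntry (var 16) (var 17))) ;;
  transfer (hasPair (var 40) (var 16) (var 17)) rerouteMember

theorem sumPair_spec {s : State} {n m u w : ℕ} {eu ew : IntExpr}
    (hu : ∀ t : State, (∀ c, c ∉ [43, 99] → t.ints c = s.ints c) → eu.eval t = u)
    (hw : ∀ t : State, (∀ c, c ∉ [43, 99] → t.ints c = s.ints c) → ew.eval t = w)
    (hun : u < n) (hwn : w < n) (hbound : s.ints 3 0 ≤ familyBound.eval s) :
    ((sumWeights (hasPair (var 43) eu ew)).run s).reals 7 0 = famSum n m s (pairInd u w) := by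
  refine sumWeights_spec _ rfl hbound fun t h1 _ _ => ?_
  simp only [hasPair, Test.holds, IntExpr.eval, IntExpr.eval_pair, eval_var, hu t h1, hw t h1,
    h1 5 (by decide), pairInd, member_of_lt s hun hwn, Nat.pos_iff_ne_zero]
  exact ⟨fun h => if_pos h, fun h => if_neg h⟩

/-- The effect of `sumWeights` on the memory. -/
theorem sumWeights_frame (b : Test) (s : State) :
    (∀ c, c ∉ [43, 99] → ((sumWeights b).run s).ints c = s.ints c) ∧
    ∀ c, c ≠ 7 → ((sumWeights b).run s).reals c = s.reals c :=
  ⟨fun _ hc => run_ints _ (sumWeights_writesInt b hc) s,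
    fun _ hc => run_reals _ (sumWeights_writesReal b hc) s⟩

/-- The budget is the excess of the weight of `uw` over its weight at level `k`. If it is spent, the
weight has come down to the level; if not, no member contains `uw` any more, and the weight is zero.
-/
theorem reducePair_spec {s : State} {n m k u w : ℕ} (hn : s.ints 0 0 = n) (hm : s.ints 0 1 = m)
    (hk : s.ints 10 0 = k) (hu : s.ints 16 0 = u) (hw : s.ints 17 0 = w) (huw : u < w) (hwk : w < k)
    (hkn : k < n) (hbound : s.ints 3 0 ≤ familyBound.eval s) (hH : 0 ≤ level n k s u w)
    (hF : IsFamily n m (LevelGood k) s) :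
    ∃ μ, Moves n m (LevelGood k) (fun o => o.T u w ≠ 0) (reroute k u w) μ s (reducePair.run s) ∧
      μ ≤ max 0 (famSum n m s (pairInd u w) - level n k s u w) ∧
      famSum n m (reducePair.run s) (pairInd u w) ≤ level n k s u w := by
  have hun : u < n := by omega
  have hwn : w < n := by omega
  obtain ⟨s1, hs1⟩ : ∃ s1, s1 = (sumWeights (hasPair (var 43) (var 16) (var 17))).run s := ⟨_, rfl⟩
  obtain ⟨s2, hs2⟩ : ∃ s2, s2 =
    (rassign 7 (.sub (rvar 7) (levelEntry (var 16) (var 17)))).run s1 := ⟨_, rfl⟩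
  have hrun : reducePair.run s =
      (transfer (hasPair (var 40) (var 16) (var 17)) rerouteMember).run s2 := by
    simp only [reducePair, run_seq, ← hs1, ← hs2]
  obtain ⟨i1, r1⟩ := sumWeights_frame (hasPair (var 43) (var 16) (var 17)) s
  rw [← hs1] at i1 r1
  have v1 := sumPair_spec (s := s) (m := m) (eu := var 16) (ew := var 17)
    (fun t ht => by rw [eval_var, ht 16 (by decide), hu])
    (fun t ht => by rw [eval_var, ht 17 (by decide), hw]) hun hwn hbound
  rw [← hs1] at v1
  have i2 : ∀ c, c ∉ [43, 99] → s2.ints c = s.ints c := by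
    intro c hc; rw [hs2]; exact i1 c hc
  have r2 : ∀ c, c ≠ 7 → s2.reals c = s.reals c := by
    intro c hc; rw [hs2, ← r1 c hc]; funext j; simp [hc]
  have v2 : s2.reals 7 0 = famSum n m s (pairInd u w) - level n k s u w := by
    rw [hs2]
    simp [RealExpr.eval, v1, levelEntry, i1 10 (by decide), i1 16 (by decide),
      i1 17 (by decide), hk, hu, hw, r1 3 (by norm_num), level, hun, hwn]
  have e3 := i2 3 (by decide)
  have e5 := i2 5 (by decide)
  have e6 := i2 6 (by decide)
  have e8 := i2 8 (by decide)
  have e1 := r2 1 (by norm_num)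
  obtain ⟨μ, h1, h2, h3⟩ := transfer_moves (b := hasPair (var 40) (var 16) (var 17))
    (act := rerouteMember) (s := s2) (n := n) (m := m) (LevelGood k) (fun o => o.T u w ≠ 0)
    (reroute k u w) (by rw [i2 0 (by decide), hn]) (by rw [i2 0 (by decide), hm])
    (by rw [e3, familyBound_congr (i2 0 (by decide))]; exact hbound)
    rerouteMember_isAction
    (by
      intro t ht
      simp only [hasPair, Test.holds, IntExpr.eval, IntExpr.eval_pair, eval_var,
        ht.ints 16 (by decide), ht.ints 17 (by decide), i2 16 (by decide), i2 17 (by decide), hu, hw,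
        member_of_lt t hun hwn, Nat.pos_iff_ne_zero])
    (by
      intro t ht _ _
      exact rerouteMember_spec (by rw [ht.ints 0 (by decide), i2 0 (by decide), hn]) rfl
        (by rw [ht.ints 10 (by decide), i2 10 (by decide), hk])
        (by rw [ht.ints 16 (by decide), i2 16 (by decide), hu])
        (by rw [ht.ints 17 (by decide), i2 17 (by decide), hw]) huw hwk hkn)
    (fun o ho _ => ⟨reroute_good huw hwk ho, by rw [reroute_not_mem hwk]; simp⟩)
    (hF.congr e3 e5 e6 e8 e1)
  rw [← hrun] at h1 h3
  have h1' := h1.congr (s' := s) e3.symm e5.symm e6.symm e8.symm e1.symm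
  refine ⟨μ, h1', by rwa [v2] at h2, ?_⟩
  rcases h3 with h3 | h3
  · have := h1'.sum_le (pairInd u w) (-1) (fun o _ ho => by
      simp [pairInd, reroute_not_mem hwk, ho])
    have hle := le_max_right 0 (s2.reals 7 0)
    rw [← h3, v2] at hle
    linarith
  · rw [famSum_eq_zero fun i hi => by simpa [pairInd] using h3 i hi]
    exact hH

/-- Adds the pair `uk` to members without pairs at `k` such that its weight is as at level `k`,
where `k`, `u` are in the variables `10`, `16`. -/
def attachPair : Stmt :=
  sumWeights (hasPair (var 43) (var 16) (var 10)) ;;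
  rassign 7 (.sub (levelEntry (var 16) (var 10)) (rvar 7)) ;;
  transfer (.ltInt (.get 8 (var 40)) (var 10)) attachMember

/-- The budget is the unused capacity of `uk`. Both outcomes are kept in the conclusion: either the
capacity is exhausted, or no unattached member is left, which ends the search altogether. -/
theorem attachPair_spec {s : State} {n m k u : ℕ} (hn : s.ints 0 0 = n) (hm : s.ints 0 1 = m)
    (hk : s.ints 10 0 = k) (hu : s.ints 16 0 = u) (huk : u < k)
    (hkn : k < n) (hbound : s.ints 3 0 ≤ familyBound.eval s)
    (hF : IsFamily n m (LevelGood k) s) :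
    ∃ μ, Moves n m (LevelGood k) (fun o => o.A < k) (attach k u) μ s (attachPair.run s) ∧
      μ ≤ max 0 (level n k s u k - famSum n m s (pairInd u k)) ∧
      (μ = max 0 (level n k s u k - famSum n m s (pairInd u k)) ∨
        ∀ i < (attachPair.run s).ints 3 0, ¬ (member n m (attachPair.run s) i).A < k) := by
  have hun : u < n := by omega
  obtain ⟨s1, hs1⟩ : ∃ s1, s1 = (sumWeights (hasPair (var 43) (var 16) (var 10))).run s := ⟨_, rfl⟩
  obtain ⟨s2, hs2⟩ : ∃ s2, s2 =
    (rassign 7 (.sub (levelEntry (var 16) (var 10)) (rvar 7))).run s1 := ⟨_, rfl⟩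
  have hrun : attachPair.run s =
      (transfer (.ltInt (.get 8 (var 40)) (var 10)) attachMember).run s2 := by
    simp only [attachPair, run_seq, ← hs1, ← hs2]
  obtain ⟨i1, r1⟩ := sumWeights_frame (hasPair (var 43) (var 16) (var 10)) s
  rw [← hs1] at i1 r1
  have v1 := sumPair_spec (s := s) (m := m) (eu := var 16) (ew := var 10)
    (fun t ht => by rw [eval_var, ht 16 (by decide), hu])
    (fun t ht => by rw [eval_var, ht 10 (by decide), hk]) hun hkn hbound
  rw [← hs1] at v1
  have i2 : ∀ c, c ∉ [43, 99] → s2.ints c = s.ints c := by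
    intro c hc; rw [hs2]; exact i1 c hc
  have r2 : ∀ c, c ≠ 7 → s2.reals c = s.reals c := by
    intro c hc; rw [hs2, ← r1 c hc]; funext j; simp [hc]
  have v2 : s2.reals 7 0 = level n k s u k - famSum n m s (pairInd u k) := by
    rw [hs2]
    simp [RealExpr.eval, v1, levelEntry, i1 10 (by decide), i1 16 (by decide),
      hk, hu, r1 3 (by norm_num), level, hun, hkn]
  have e3 := i2 3 (by decide)
  have e5 := i2 5 (by decide)
  have e6 := i2 6 (by decide)
  have e8 := i2 8 (by decide)
  have e1 := r2 1 (by norm_num)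
  obtain ⟨μ, h1, h2, h3⟩ := transfer_moves (b := .ltInt (.get 8 (var 40)) (var 10))
    (act := attachMember) (s := s2) (n := n) (m := m) (LevelGood k) (fun o => o.A < k)
    (attach k u) (by rw [i2 0 (by decide), hn]) (by rw [i2 0 (by decide), hm])
    (by rw [e3, familyBound_congr (i2 0 (by decide))]; exact hbound)
    attachMember_isAction
    (by
      intro t ht
      simp only [Test.holds, IntExpr.eval, eval_var, member,
        ht.ints 10 (by decide), i2 10 (by decide), hk])
    (by
      intro t ht _ _
      exact attachMember_spec rfl
        (by rw [ht.ints 10 (by decide), i2 10 (by decide), hk])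
        (by rw [ht.ints 16 (by decide), i2 16 (by decide), hu]) huk hkn)
    (fun o ho _ => ⟨attach_good huk ho, by simp [attach]⟩)
    (hF.congr e3 e5 e6 e8 e1)
  rw [← hrun] at h1 h3
  rw [v2] at h2 h3
  exact ⟨μ, h1.congr (s' := s) e3.symm e5.symm e6.symm e8.symm e1.symm, h2, h3⟩

end Stmt

end RAM

/-! ### Invariants for undoing one elimination. -/

namespace RAM

open Finset WCut

theorem pairInd_reroute_le {k u w a b : ℕ} {o : Member} (hw : w < k) (hb : b < k) :
    pairInd a b (reroute k u w o) ≤ pairInd a b o := by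
  by_cases hab : a = u ∧ b = w
  · obtain ⟨rfl, rfl⟩ := hab
    have : pairInd a b (reroute k a b o) = 0 := by simp [pairInd, reroute_not_mem hw]
    rw [this]; exact pairInd_nonneg _ _ _
  · exact (pairInd_reroute hb hab).le

/-- The indicator function of the members without pairs at `k`. -/
noncomputable def unattached (k : ℕ) (o : Member) : ℝ := if o.A < k then 1 else 0

theorem degAt_le {k : ℕ} {o : Member} (h : LevelGood k o) :
    degAt k o ≤ excessAt k o + 1 - unattached k o := by
  unfold unattached
  split_ifs with hA
  · have h1 := degAt_eq_zero h hA.ne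
    have h2 : 0 ≤ excessAt k o := le_max_right _ _
    linarith
  · have : degAt k o - 1 ≤ excessAt k o := le_max_left _ _
    linarith

theorem LevelGood.succ {k : ℕ} {o : Member} (h : LevelGood k o) (hA : o.A = k) :
    LevelGood (k + 1) o := by
  obtain ⟨a, ha, hT⟩ := h.attached.1 hA
  have hk : ∀ x < k + 1, Conn o.T x k := by
    intro x hx
    rcases Nat.lt_succ_iff_lt_or_eq.1 hx with hx | rfl
    · exact (h.conn x hx a ha).trans (Conn.single ha hT)
    · exact Conn.refl _
  refine ⟨fun a b hab => ⟨(h.supp a b hab).1, (h.supp a b hab).2.trans (by omega)⟩,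
    fun x hx y hy => (hk x hx).trans (hk y hy).symm, by omega, ⟨fun h => by omega, ?_⟩, h.empty⟩
  rintro ⟨b, _, hb⟩
  have := (h.supp b (k + 1) hb).2
  omega

namespace Stmt

/-- The state of the family while the pairs below `k` are reduced from the weights `W` to the
weights `H`, when the first `j` pairs have been treated. -/
structure PairPhase (n m ℓ k : ℕ) (H W : ℕ → ℕ → ℝ) (j : ℕ) (t : State) : Prop where
  fam : IsFamily n m (LevelGood k) t
  size : t.ints 3 0 ≤ ℓ + j
  total : famSum n m t (fun _ => 1) = 1
  le : ∀ a b, a < b → b < k → famSum n m t (pairInd a b) ≤ W a b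
  treated : ∀ i < j, i / n < i % n → i % n < k → famSum n m t (pairInd (i / n) (i % n)) ≤
    H (i / n) (i % n)
  star : ∀ a < k, famSum n m t (pairInd a k) ≤ ∑ i ∈ range j,
    if (i / n < i % n ∧ i % n < k) ∧ (a = i / n ∨ a = i % n) then
      W (i / n) (i % n) - H (i / n) (i % n) else 0
  excess : famSum n m t (excessAt k) ≤ ∑ i ∈ range j,
    if i / n < i % n ∧ i % n < k then W (i / n) (i % n) - H (i / n) (i % n) else 0

theorem PairPhase.congr {n m ℓ k : ℕ} {H W : ℕ → ℕ → ℝ} {j : ℕ} {s t : State}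
    (h : PairPhase n m ℓ k H W j s) (h3 : t.ints 3 = s.ints 3) (h5 : t.ints 5 = s.ints 5)
    (h6 : t.ints 6 = s.ints 6) (h8 : t.ints 8 = s.ints 8) (h1 : t.reals 1 = s.reals 1) :
    PairPhase n m ℓ k H W j t := by
  have e := famSum_congr (n := n) (m := m) h3 h5 h6 h8 h1
  refine ⟨h.fam.congr h3 h5 h6 h8 h1, by rw [h3]; exact h.size, ?_, ?_, ?_, ?_, ?_⟩ <;> rw [e]
  exacts [h.total, h.le, h.treated, h.star, h.excess]

theorem PairPhase.skip {n m ℓ k : ℕ} {H W : ℕ → ℕ → ℝ} {j : ℕ} {s : State}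
    (h : PairPhase n m ℓ k H W j s) (hj : ¬ (j / n < j % n ∧ j % n < k)) :
    PairPhase n m ℓ k H W (j + 1) s := by
  refine ⟨h.fam, by have := h.size; omega, h.total, h.le, fun i hi h1 h2 => ?_, fun a ha => ?_, ?_⟩
  · rcases Nat.lt_succ_iff_lt_or_eq.1 hi with hi | rfl
    · exact h.treated i hi h1 h2
    · exact absurd ⟨h1, h2⟩ hj
  · rw [sum_range_succ, if_neg fun h => hj h.1, add_zero]; exact h.star a ha
  · rw [sum_range_succ, if_neg hj, add_zero]; exact h.excess

/-- The rerouted weight `μ` is at most `W - H` for this pair, because the pair has weight at most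
`W` beforehand. Rerouting raises the pairs `uk` and `wk` and the excess by at most `μ` each, and no
pair below `k` gains weight. -/
theorem PairPhase.step {n m ℓ k : ℕ} {H W : ℕ → ℕ → ℝ} {j : ℕ} {s t : State}
    (h : PairPhase n m ℓ k H W j s) (hu : j / n < j % n) (hw : j % n < k) {μ : ℝ}
    (hHW : H (j / n) (j % n) ≤ W (j / n) (j % n))
    (hM : Moves n m (LevelGood k) (fun o => o.T (j / n) (j % n) ≠ 0)
      (reroute k (j / n) (j % n)) μ s t)
    (hμ : μ ≤ max 0 (famSum n m s (pairInd (j / n) (j % n)) - H (j / n) (j % n)))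
    (hle : famSum n m t (pairInd (j / n) (j % n)) ≤ H (j / n) (j % n)) :
    PairPhase n m ℓ k H W (j + 1) t := by
  have hμ' : μ ≤ W (j / n) (j % n) - H (j / n) (j % n) := by
    refine hμ.trans (max_le (by linarith) ?_)
    linarith [h.le _ _ hu hw]
  have mono : ∀ a b, b < k → famSum n m t (pairInd a b) ≤ famSum n m s (pairInd a b) := by
    intro a b hb
    have := hM.sum_le (pairInd a b) 0 fun o _ _ => by
      rw [add_zero]; exact pairInd_reroute_le hw hb
    linarith
  refine ⟨hM.fam, by have := h.size; have := hM.size; omega, hM.total.trans h.total,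
    fun a b hab hb => (mono a b hb).trans (h.le a b hab hb), fun i hi h1 h2 => ?_,
    fun a ha => ?_, ?_⟩
  · rcases Nat.lt_succ_iff_lt_or_eq.1 hi with hi | rfl
    · exact (mono _ _ h2).trans (h.treated i hi h1 h2)
    · exact hle
  · rw [sum_range_succ]
    have key := hM.sum_le (pairInd a k) (if a = j / n ∨ a = j % n then 1 else 0) fun o ho hp => by
      refine pairInd_reroute_star hw |>.trans ?_
      rw [add_assoc]
      refine add_le_add le_rfl ?_
      by_cases h1 : a = j / n
      · have h2 : a ≠ j % n := by omega
        simp only [h1, true_or, if_true]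
        split_ifs <;> first | (exfalso; omega) | norm_num
      · by_cases h2 : a = j % n
        · rw [if_neg h1, if_pos h2, if_pos (Or.inr h2)]
          split_ifs <;> norm_num
        · simp [h1, h2]
    refine key.trans (add_le_add (h.star a ha) ?_)
    by_cases hc : a = j / n ∨ a = j % n
    · rw [if_pos hc, if_pos ⟨⟨hu, hw⟩, hc⟩]; linarith
    · rw [if_neg hc, if_neg fun h => hc h.2]; simp
  · rw [sum_range_succ, if_pos ⟨hu, hw⟩]
    have := hM.sum_le (excessAt k) 1 fun o ho _ => excessAt_reroute hu hw ho
    linarith [h.excess]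

/-- The state of the family while pairs `ak` are added, when this is done for all `a < i`. -/
structure AttachPhase (n m ℓ k : ℕ) (H : ℕ → ℕ → ℝ) (i : ℕ) (t : State) : Prop where
  fam : IsFamily n m (LevelGood k) t
  size : t.ints 3 0 ≤ ℓ + i
  total : famSum n m t (fun _ => 1) = 1
  le : ∀ a b, a < b → b < k → famSum n m t (pairInd a b) ≤ H a b
  star : ∀ a < k, famSum n m t (pairInd a k) ≤ H a k
  excess : 2 * famSum n m t (excessAt k) ≤ ∑ a ∈ range k, H a k
  treated : (∀ a < i, a < k → H a k ≤ famSum n m t (pairInd a k)) ∨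
    famSum n m t (unattached k) ≤ 0

theorem AttachPhase.congr {n m ℓ k : ℕ} {H : ℕ → ℕ → ℝ} {j : ℕ} {s t : State}
    (h : AttachPhase n m ℓ k H j s) (h3 : t.ints 3 = s.ints 3) (h5 : t.ints 5 = s.ints 5)
    (h6 : t.ints 6 = s.ints 6) (h8 : t.ints 8 = s.ints 8) (h1 : t.reals 1 = s.reals 1) :
    AttachPhase n m ℓ k H j t := by
  have e := famSum_congr (n := n) (m := m) h3 h5 h6 h8 h1
  refine ⟨h.fam.congr h3 h5 h6 h8 h1, by rw [h3]; exact h.size, ?_, ?_, ?_, ?_, ?_⟩ <;> rw [e]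
  exacts [h.total, h.le, h.star, h.excess, h.treated]

/-- What has been rerouted to `ak` is at most the sum of `W - H` over the pairs at `a`, hence at
most `H a k`: the capacities at `k` suffice. Summing over all `a` counts each pair twice, so the
excess is at most half of the degree of `k`. -/
theorem PairPhase.attachPhase {n m ℓ k : ℕ} {H W : ℕ → ℕ → ℝ} {s : State}
    (h : PairPhase n m ℓ k H W (n * n) s) (hkn : k < n) (hR : LevelRel k H W)
    (hH : ∀ a b, H a b = H b a) (hW : ∀ a b, W a b = W b a) :
    AttachPhase n m (ℓ + n * n) k H 0 s := by
  have hα : ∀ x < k, ∀ y < k, 0 ≤ W x y - H x y := fun x hx y hy => by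
    linarith [hR.le x hx y hy]
  have hs : ∀ x y, W x y - H x y = W y x - H y x := fun x y => by rw [hH, hW]
  refine ⟨h.fam, h.size, h.total, fun a b hab hb => ?_, fun a ha => ?_, ?_,
    Or.inl fun a ha => absurd ha (Nat.not_lt_zero a)⟩
  · obtain ⟨j, hj, rfl, rfl⟩ := div_mod_surj (n := n) (p := a) (q := b) (by omega) (by omega)
    exact h.treated j hj hab hb
  · refine (h.star a ha).trans ((sum_pairs_star_le (α := fun x y => W x y - H x y) hkn ha hα
      hs).trans (hR.sum_le a ha))
  · have h1 := sum_pairs_le (α := fun x y => W x y - H x y) hkn hα hs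
    have h2 := sum_le_sum fun a ha => hR.sum_le a (mem_range.1 ha)
    linarith [h.excess]

theorem AttachPhase.skip {n m ℓ k : ℕ} {H : ℕ → ℕ → ℝ} {i : ℕ} {s : State}
    (h : AttachPhase n m ℓ k H i s) (hi : ¬ i < k) : AttachPhase n m ℓ k H (i + 1) s := by
  refine ⟨h.fam, by have := h.size; omega, h.total, h.le, h.star, h.excess,
    h.treated.imp_left fun h a ha hk => h a (by omega) hk⟩

/-- Attaching affects only the pair `ik` and members that have no pair at `k`, so the excess does
not grow. Either the capacity of `ik` is now exhausted, or every member is attached, and the latter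
remains true in later steps. -/
theorem AttachPhase.step {n m ℓ k : ℕ} {H : ℕ → ℕ → ℝ} {i : ℕ} {s t : State}
    (h : AttachPhase n m ℓ k H i s) (hi : i < k) {μ : ℝ}
    (hM : Moves n m (LevelGood k) (fun o => o.A < k) (attach k i) μ s t)
    (hμ : μ ≤ max 0 (H i k - famSum n m s (pairInd i k)))
    (hor : μ = max 0 (H i k - famSum n m s (pairInd i k)) ∨
      ∀ j < t.ints 3 0, ¬ (member n m t j).A < k) :
    AttachPhase n m ℓ k H (i + 1) t := by
  rw [max_eq_right (by linarith [h.star i hi])] at hμ hor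
  have le' : ∀ a b, ¬ (a = i ∧ b = k) →
      famSum n m t (pairInd a b) ≤ famSum n m s (pairInd a b) := by
    intro a b hab
    have := hM.sum_le (pairInd a b) 0 fun o _ _ => by rw [pairInd_attach hab, add_zero]
    linarith
  have ge' : ∀ a b, ¬ (a = i ∧ b = k) →
      famSum n m s (pairInd a b) ≤ famSum n m t (pairInd a b) := by
    intro a b hab
    have := hM.sum_le (fun o => -pairInd a b o) 0 fun o _ _ => by rw [pairInd_attach hab, add_zero]
    rw [famSum_neg, famSum_neg] at this
    linarith
  refine ⟨hM.fam, by have := h.size; have := hM.size; omega, hM.total.trans h.total,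
    fun a b hab hb => (le' a b (by omega)).trans (h.le a b hab hb), fun a ha => ?_, ?_, ?_⟩
  · by_cases hai : a = i
    · subst hai
      have := hM.sum_le (pairInd a k) 1 fun o ho hp => (pairInd_attach_self hi ho hp.ne).le
      linarith
    · exact (le' a k (by tauto)).trans (h.star a ha)
  · have := hM.sum_le (excessAt k) 0 fun o ho hp => by
      rw [add_zero]; exact excessAt_attach hi ho hp.ne
    linarith [h.excess]
  · rcases h.treated with hT | hT
    · rcases hor with hor | hor
      · left
        intro a ha hak
        by_cases hai : a = i
        · subst hai
          have := hM.sum_le (fun o => -pairInd a k o) (-1) fun o ho hp => by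
            rw [pairInd_attach_self hi ho hp.ne]; linarith
          rw [famSum_neg, famSum_neg] at this
          linarith
        · exact (hT a (by omega) hak).trans (ge' a k (by tauto))
      · right
        exact (famSum_eq_zero fun j hj => by rw [unattached, if_neg (hor j hj)]).le
    · right
      have := hM.sum_le (unattached k) 0 fun o ho hp => by simp [unattached, attach, hp]
      linarith

/-- The state of the family after level `k`: connected graphs on `0, …, k` with weights at
most `H`. -/
structure LevelPhase (n m ℓ k : ℕ) (H : ℕ → ℕ → ℝ) (t : State) : Prop where
  fam : IsFamily n m (fun o => LevelGood (k + 1) o ∧ o.A ≤ k) t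
  size : t.ints 3 0 ≤ ℓ
  total : famSum n m t (fun _ => 1) = 1
  le : ∀ a b, a < b → b ≤ k → famSum n m t (pairInd a b) ≤ H a b

theorem LevelPhase.congr {n m ℓ k : ℕ} {H : ℕ → ℕ → ℝ} {s t : State}
    (h : LevelPhase n m ℓ k H s) (h3 : t.ints 3 = s.ints 3) (h5 : t.ints 5 = s.ints 5)
    (h6 : t.ints 6 = s.ints 6) (h8 : t.ints 8 = s.ints 8) (h1 : t.reals 1 = s.reals 1) :
    LevelPhase n m ℓ k H t := by
  have e := famSum_congr (n := n) (m := m) h3 h5 h6 h8 h1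
  refine ⟨h.fam.congr h3 h5 h6 h8 h1, by rw [h3]; exact h.size, ?_, ?_⟩ <;> rw [e]
  exacts [h.total, h.le]

/-- Let `D` be the degree of `k` at this level. If all capacities are exhausted, the average degree
of `k` in the family is at least `D`. It is at most the average excess, which is at most `D / 2`,
plus 1, minus the weight of the unattached members. So this weight is at most `1 - D / 2 ≤ 0`, as `D
≥ 2`. In the other case no member is unattached anyway. -/
theorem AttachPhase.levelPhase {n m ℓ k : ℕ} {H : ℕ → ℕ → ℝ} {s : State}
    (h : AttachPhase n m ℓ k H n s) (hkn : k < n) (hD : 2 ≤ ∑ a ∈ range k, H a k) :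
    LevelPhase n m (ℓ + n) k H s := by
  have hun : famSum n m s (unattached k) ≤ 0 := by
    rcases h.treated with hT | hT
    · have h1 : ∑ a ∈ range k, H a k ≤ famSum n m s (degAt k) := by
        unfold degAt
        rw [famSum_sum]
        exact sum_le_sum fun a ha => hT a (by have := mem_range.1 ha; omega) (mem_range.1 ha)
      have h2 := h.fam.famSum_le (φ := degAt k)
        (ψ := fun o => (excessAt k o + 1) + -unattached k o) fun o ho => by
          have := degAt_le ho; linarith
      rw [famSum_add, famSum_neg, famSum_add, h.total] at h2
      linarith [h.excess]
    · exact hT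
  have hz := h.fam.eq_zero (φ := unattached k)
    (fun o _ => by unfold unattached; split_ifs <;> norm_num) hun
  refine ⟨⟨fun i hi => ?_, h.fam.pos⟩, h.size, h.total, fun a b hab hb => ?_⟩
  · suffices (member n m s i).A = k from ⟨(h.fam.good i hi).succ this, this.le⟩
    have h1 := hz i hi
    have h2 := (h.fam.good i hi).le
    by_contra hne
    rw [unattached, if_pos (by omega)] at h1
    norm_num at h1
  · rcases hb.lt_or_eq with hb | rfl
    · exact h.le a b hab hb
    · exact h.star a hab

/-- No member has been extended at level `k + 1` so far, so all quantities at the new vertex start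
at zero. -/
theorem LevelPhase.pairPhase {n m ℓ k : ℕ} {H W : ℕ → ℕ → ℝ} {s : State}
    (h : LevelPhase n m ℓ k W s) : PairPhase n m ℓ (k + 1) H W 0 s := by
  have hz : ∀ a, ∀ i < s.ints 3 0, pairInd a (k + 1) (member n m s i) = 0 := by
    intro a i hi
    obtain ⟨h1, h2⟩ := h.fam.good i hi
    unfold pairInd
    rw [if_neg]
    intro hne
    have := h1.attached.2 ⟨a, (h1.supp a _ hne).1, hne⟩
    omega
  refine ⟨⟨fun i hi => (h.fam.good i hi).1, h.fam.pos⟩, h.size, h.total,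
    fun a b hab hb => h.le a b hab (by omega), fun i hi => absurd hi (Nat.not_lt_zero i),
    fun a ha => ?_, ?_⟩
  · rw [famSum_eq_zero (hz a)]; simp
  · rw [famSum_eq_zero fun i hi => ?_]
    · simp
    · have : degAt (k + 1) (member n m s i) = 0 := sum_eq_zero fun a _ => hz a i hi
      rw [excessAt, this]; norm_num

/-- Reverses the elimination of the vertex `k`, which is in the variable `10`. -/
def liftLevel : Stmt :=
  iter 54 (.mul numV numV) (
    assign 16 (.div (var 54) numV) ;;
    assign 17 (.mod (var 54) numV) ;;
    when (.and (.ltInt (var 16) (var 17)) (.ltInt (var 17) (var 10))) reducePair) ;;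
  iter 58 numV (
    assign 16 (var 58) ;;
    when (.ltInt (var 16) (var 10)) attachPair)

/-- Computes a family of connected graphs from the levels. -/
def lift : Stmt :=
  assign 3 (.const 1) ;;
  setReal 1 (.const 0) (rconst 1) ;;
  iter 57 (.sub numV (.const 1)) (assign 10 (.add (var 57) (.const 1)) ;; liftLevel)

/-- Each transfer creates at most one member. There are at most `n * n` transfers for pairs and `n`
for attaching, which accounts for the new size. -/
theorem liftLevel_spec {s : State} {n m ℓ k : ℕ} {W : ℕ → ℕ → ℝ} (hn : s.ints 0 0 = n)
    (hm : s.ints 0 1 = m) (hk : s.ints 10 0 = k + 1) (hkn : k + 1 < n)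
    (hbound : ℓ + n * n + n ≤ familyBound.eval s)
    (hH : ∀ a b, level n (k + 1) s a b = level n (k + 1) s b a) (hW : ∀ a b, W a b = W b a)
    (hH0 : ∀ a b, 0 ≤ level n (k + 1) s a b)
    (hF : Full (k + 1 + 1) (level n (k + 1) s)) (hR : LevelRel (k + 1) (level n (k + 1) s) W)
    (h : LevelPhase n m ℓ k W s) :
    LevelPhase n m (ℓ + n * n + n) (k + 1) (level n (k + 1) s) (liftLevel.run s) := by
  obtain ⟨H, hHdef⟩ : ∃ H, H = level n (k + 1) s := ⟨_, rfl⟩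
  have lev : ∀ t : State, t.reals 3 = s.reals 3 → level n (k + 1) t = H := by
    intro t ht; rw [hHdef]; unfold level; rw [ht]
  rw [← hHdef] at hH hH0 hF hR ⊢
  obtain ⟨s1, hs1⟩ : ∃ s1, s1 = (iter 54 (.mul numV numV) (
    assign 16 (.div (var 54) numV) ;;
    assign 17 (.mod (var 54) numV) ;;
    when (.and (.ltInt (var 16) (var 17)) (.ltInt (var 17) (var 10))) reducePair)).run s := ⟨_, rfl⟩
  have i1 : ∀ c ∈ [0, 10], s1.ints c = s.ints c := by
    intro c hc
    simp only [List.mem_cons, List.not_mem_nil, or_false] at hc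
    rw [hs1]
    rcases hc with rfl | rfl <;> exact run_ints _ (by decide) _
  have r1 : s1.reals 3 = s.reals 3 := by rw [hs1]; exact run_reals _ (by decide) _
  have c1 := run_iter (a := 54) (N := .mul numV numV) (s := s) (P :=
    assign 16 (.div (var 54) numV) ;;
    assign 17 (.mod (var 54) numV) ;;
    when (.and (.ltInt (var 16) (var 17)) (.ltInt (var 17) (var 10))) reducePair)
    (fun j t => PairPhase n m ℓ (k + 1) H W j t)
    (h.pairPhase.congr rfl rfl rfl rfl rfl)
    (by
      intro j t hj hc hfi hfr ih
      have e : IntExpr.eval s (.mul numV numV) = n * n := by simp [IntExpr.eval, hn]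
      rw [e] at hj
      have e0 : t.ints 0 = s.ints 0 := hfi 0 (by norm_num) (by decide)
      have e10 : t.ints 10 0 = k + 1 := by rw [hfi 10 (by norm_num) (by decide), hk]
      obtain ⟨t1, ht1⟩ : ∃ t1, t1 = (t.setInt 16 0 (j / n)).setInt 17 0 (j % n) := ⟨_, rfl⟩
      have et : (assign 17 (.mod (var 54) numV)).run ((assign 16 (.div (var 54) numV)).run t) =
          t1 := by
        rw [ht1]; simp [IntExpr.eval, hc, e0, hn]
      have g16 : t1.ints 16 0 = j / n := by rw [ht1]; simp
      have g17 : t1.ints 17 0 = j % n := by rw [ht1]; simp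
      have g10 : t1.ints 10 0 = k + 1 := by rw [ht1]; simp [e10]
      have g0 : t1.ints 0 = s.ints 0 := by rw [← e0, ht1]; rfl
      have ih1 : PairPhase n m ℓ (k + 1) H W j t1 := by
        rw [ht1]; exact ih.congr rfl rfl rfl rfl rfl
      have l1 : level n (k + 1) t1 = H := lev _ (by rw [ht1]; exact hfr 3 (by decide))
      simp only [run_seq, et]
      refine PairPhase.congr (s := (when (.and (.ltInt (var 16) (var 17)) (.ltInt (var 17) (var 10)))
        reducePair).run t1) ?_ (ints_setInt_ne _ (by norm_num) _ _)
        (ints_setInt_ne _ (by norm_num) _ _) (ints_setInt_ne _ (by norm_num) _ _)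
        (ints_setInt_ne _ (by norm_num) _ _) rfl
      by_cases hv : j / n < j % n ∧ j % n < k + 1
      · rw [run_when_pos (by simpa [Test.holds, g16, g17, g10] using hv)]
        obtain ⟨μ, m1, m2, m3⟩ := reducePair_spec (s := t1) (n := n) (m := m) (by rw [g0, hn])
          (by rw [g0, hm]) g10 g16 g17 hv.1 hv.2 hkn
          (by rw [familyBound_congr g0]; have := ih1.size; omega) (by rw [l1]; exact hH0 _ _) ih1.fam
        rw [l1] at m2 m3
        exact ih1.step hv.1 hv.2 (hR.le _ (by omega) _ hv.2) m1 m2 m3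
      · rw [run_when_neg (by simpa [Test.holds, g16, g17, g10] using hv)]
        exact (ih1.skip hv).congr rfl rfl rfl rfl rfl)
  have e : IntExpr.eval s (.mul numV numV) = n * n := by simp [IntExpr.eval, hn]
  rw [e, ← hs1] at c1
  have c2 := run_iter (a := 58) (N := numV) (s := s1)
    (P := assign 16 (var 58) ;; when (.ltInt (var 16) (var 10)) attachPair)
    (fun i t => AttachPhase n m (ℓ + n * n) (k + 1) H i t)
    ((c1.attachPhase hkn hR hH hW).congr rfl rfl rfl rfl rfl)
    (by
      intro i t hi hc hfi hfr ih
      rw [eval_numV, i1 0 (by decide), hn] at hi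
      have e0 : t.ints 0 = s.ints 0 := by rw [hfi 0 (by norm_num) (by decide), i1 0 (by decide)]
      have e10 : t.ints 10 0 = k + 1 := by
        rw [hfi 10 (by norm_num) (by decide), i1 10 (by decide), hk]
      obtain ⟨t1, ht1⟩ : ∃ t1, t1 = t.setInt 16 0 i := ⟨_, rfl⟩
      have et : (assign 16 (var 58)).run t = t1 := by rw [ht1]; simp [hc]
      have g16 : t1.ints 16 0 = i := by rw [ht1]; simp
      have g10 : t1.ints 10 0 = k + 1 := by rw [ht1]; simp [e10]
      have g0 : t1.ints 0 = s.ints 0 := by rw [← e0, ht1]; rfl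
      have ih1 : AttachPhase n m (ℓ + n * n) (k + 1) H i t1 := by
        rw [ht1]; exact ih.congr rfl rfl rfl rfl rfl
      have l1 : level n (k + 1) t1 = H := lev _ (by
        rw [ht1, reals_setInt, hfr 3 (by decide), r1])
      simp only [run_seq, et]
      refine AttachPhase.congr (s := (when (.ltInt (var 16) (var 10)) attachPair).run t1) ?_
        (ints_setInt_ne _ (by norm_num) _ _)
        (ints_setInt_ne _ (by norm_num) _ _) (ints_setInt_ne _ (by norm_num) _ _)
        (ints_setInt_ne _ (by norm_num) _ _) rfl
      by_cases hv : i < k + 1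
      · rw [run_when_pos (by simpa [Test.holds, g16, g10] using hv)]
        obtain ⟨μ, m1, m2, m3⟩ := attachPair_spec (s := t1) (n := n) (m := m) (by rw [g0, hn])
          (by rw [g0, hm]) g10 g16 hv hkn
          (by rw [familyBound_congr g0]; have := ih1.size; omega) ih1.fam
        rw [l1] at m2 m3
        exact ih1.step hv m1 m2 m3
      · rw [run_when_neg (by simpa [Test.holds, g16, g10] using hv)]
        exact (ih1.skip hv).congr rfl rfl rfl rfl rfl)
  rw [eval_numV, i1 0 (by decide), hn] at c2
  have : liftLevel.run s = (iter 58 numV (assign 16 (var 58) ;;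
    when (.ltInt (var 16) (var 10)) attachPair)).run s1 := by
    simp only [liftLevel, run_seq, ← hs1]
  rw [this]
  refine c2.levelPhase hkn ?_
  -- The degree of the new vertex is at least 2, by the cut condition for its star. This is why the
  -- saved levels satisfy the cut condition for all cuts, the star of the last vertex included.
  have := hF {k + 1} (by simp) (by simp) (by
    intro h
    have : (0 : ℕ) ∈ ({k + 1} : Finset ℕ) := by rw [h]; simp
    simp at this)
  rw [range_add_one, cut_singleton hH (by simp) (by simp) (by
    intro a ha; have := mem_range.1 ha; simp; omega)] at this
  refine this.trans (le_of_eq (sum_congr rfl fun a _ => ?_))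
  exact hH _ _

end Stmt

end RAM

/-! ### Building the family level by level. -/

namespace RAM.Stmt

open Finset WCut

/-- Initially the family has the single member without any pair. -/
theorem levelPhase_zero {n m : ℕ} {s : State} (W : ℕ → ℕ → ℝ) (h3 : s.ints 3 0 = 1)
    (h1 : s.reals 1 0 = 1) (h5 : ∀ i, s.ints 5 i = 0) (h6 : ∀ i, s.ints 6 i = 0)
    (h8 : ∀ i, s.ints 8 i = 0) : LevelPhase n m 1 0 W s := by
  have hT : (member n m s 0).T = fun _ _ => 0 := by
    funext a b; simp [member, h5]
  refine ⟨⟨fun i hi => ?_, fun i hi => ?_⟩, h3.le, ?_, fun a b h1 h2 => by omega⟩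
  · rw [h3] at hi
    obtain rfl : i = 0 := by omega
    have hA : (member n m s 0).A = 0 := h8 0
    refine ⟨⟨fun a b h => absurd (by rw [hT]) h, fun x hx y hy => ?_, by omega,
      ⟨fun h => by omega, ?_⟩, fun e => ?_⟩, hA.le⟩
    · obtain rfl : x = y := by omega
      exact Conn.refl _
    · rintro ⟨a, _, h⟩
      exact absurd (by rw [hT]) h
    · simp [member, h6]
  · rw [h3] at hi
    obtain rfl : i = 0 := by omega
    rw [h1]; norm_num
  · simp [famSum, h3, h1]

/-- The family starts as one member of weight 1 without pairs, which is connected on the single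
vertex `0`. The levels `1, …, n - 1` are then undone in this order. -/
theorem lift_spec {s : State} {n m : ℕ} {W : ℕ → ℕ → ℝ} (hn : s.ints 0 0 = n)
    (hm : s.ints 0 1 = m) (hpos : 0 < n) (h5 : ∀ i, s.ints 5 i = 0) (h6 : ∀ i, s.ints 6 i = 0)
    (h8 : ∀ i, s.ints 8 i = 0) (hL : Levels n W fun k => level n k s) :
    LevelPhase n m (1 + (n - 1) * (n * n + n)) (n - 1) W (lift.run s) := by
  obtain ⟨s1, hs1⟩ : ∃ s1, s1 = (s.setInt 3 0 1).setReal 1 0 1 := ⟨_, rfl⟩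
  have i1 : ∀ c, c ≠ 3 → s1.ints c = s.ints c := fun c hc => by
    rw [hs1, ints_setReal]; exact ints_setInt_ne _ hc _ _
  have r1 : ∀ c, c ≠ 1 → s1.reals c = s.reals c := fun c hc => by
    rw [hs1]; funext j; simp [hc]
  have hrun : lift.run s = (iter 57 (.sub numV (.const 1))
      (assign 10 (.add (var 57) (.const 1)) ;; liftLevel)).run s1 := by
    simp only [lift, run_seq, hs1]
    congr 1
    simp [IntExpr.eval]
  have eN : IntExpr.eval s1 (.sub numV (.const 1)) = n - 1 := by
    simp [IntExpr.eval, i1 0 (by norm_num), hn]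
  have hB : familyBound.eval s1 = n * (n * n + n) + 2 * m + 1 := by
    simp [familyBound, IntExpr.eval, i1 0 (by norm_num), hn, hm]
  have key := run_iter (a := 57) (N := .sub numV (.const 1)) (s := s1)
    (P := assign 10 (.add (var 57) (.const 1)) ;; liftLevel)
    (fun i t => LevelPhase n m (1 + i * (n * n + n)) i (level n i s) t)
    (by
      refine LevelPhase.congr (s := s1) ?_ rfl rfl rfl rfl rfl
      rw [zero_mul, add_zero]
      refine levelPhase_zero _ (by rw [hs1]; simp) (by rw [hs1]; simp) ?_ ?_ ?_
      · rw [i1 5 (by norm_num)]; exact h5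
      · rw [i1 6 (by norm_num)]; exact h6
      · rw [i1 8 (by norm_num)]; exact h8)
    (by
      intro i t hi hc hfi hfr ih
      rw [eN] at hi
      have e0 : t.ints 0 = s1.ints 0 := hfi 0 (by norm_num) (by decide)
      obtain ⟨t1, ht1⟩ : ∃ t1, t1 = t.setInt 10 0 (i + 1) := ⟨_, rfl⟩
      have et : (assign 10 (.add (var 57) (.const 1))).run t = t1 := by
        rw [ht1]; simp [IntExpr.eval, hc]
      have g0 : t1.ints 0 = s1.ints 0 := by rw [← e0, ht1]; rfl
      have lev : level n (i + 1) t1 = level n (i + 1) s := by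
        unfold level
        rw [ht1, reals_setInt, hfr 3 (by decide), r1 3 (by norm_num)]
      simp only [run_seq, et]
      have hle : (i + 1) * (n * n + n) ≤ n * (n * n + n) := Nat.mul_le_mul_right _ (by omega)
      have hexp : (i + 1) * (n * n + n) = i * (n * n + n) + (n * n + n) := by ring
      have := liftLevel_spec (s := t1) (n := n) (m := m) (ℓ := 1 + i * (n * n + n)) (k := i)
        (W := level n i s) (by rw [g0, i1 0 (by norm_num), hn])
        (by rw [g0, i1 0 (by norm_num), hm]) (by rw [ht1]; simp) (by omega)
        (by rw [familyBound_congr g0, hB]; omega)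
        (by rw [lev]; exact hL.symm _ (by omega)) (hL.symm _ (by omega))
        (by rw [lev]; exact hL.nonneg _ (by omega)) (by rw [lev]; exact hL.full _ (by omega))
        (by rw [lev]; exact hL.rel _ (by omega))
        (by rw [ht1]; exact ih.congr rfl rfl rfl rfl rfl)
      rw [lev] at this
      refine LevelPhase.congr (s := liftLevel.run t1) ?_ (ints_setInt_ne _ (by norm_num) _ _)
        (ints_setInt_ne _ (by norm_num) _ _) (ints_setInt_ne _ (by norm_num) _ _)
        (ints_setInt_ne _ (by norm_num) _ _) rfl
      rwa [hexp, ← add_assoc, ← add_assoc])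
  rw [eN, ← hrun] at key
  have : level n (n - 1) s = W := hL.top
  rwa [this] at key

end RAM.Stmt

/-! ### From pairs of vertices to edges. -/

namespace RAM

open Finset WCut

/-- The edge `e` of the graph with ends `a`, `b` joins `u` and `w`. -/
abbrev Joins (a b : ℕ → ℕ) (e u w : ℕ) : Prop := (u = a e ∧ w = b e) ∨ (u = b e ∧ w = a e)

namespace Stmt

/-- Puts the weights of the pairs of vertices into the real matrix `2`. -/
def pairWeights : Stmt :=
  iter 56 numE (when (.not (.eqInt (.get 1 (var 56)) (.get 2 (var 56))))
    (incrEdge (.get 1 (var 56)) (.get 2 (var 56)) (.get 0 (var 56))))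

/-- Loops are skipped, as they cross no cut. The cut values are followed along with the matrix,
because each edge changes them in the way described by `cut_addEdge`. -/
theorem pairWeights_spec {s : State} {n m : ℕ} (hm : s.ints 0 1 = m)
    (ha : ∀ e < m, s.ints 1 e < n) (hb : ∀ e < m, s.ints 2 e < n) (h0 : mat n 2 s = fun _ _ => 0) :
    (∀ u w, mat n 2 (pairWeights.run s) u w = ∑ e ∈ range m,
      if s.ints 1 e ≠ s.ints 2 e ∧ Joins (s.ints 1) (s.ints 2) e u w then s.reals 0 e else 0) ∧
    ∀ S, cut (mat n 2 (pairWeights.run s)) (range n) S =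
      ∑ e ∈ range m, sep S (s.ints 1 e) (s.ints 2 e) * s.reals 0 e := by
  have key := run_iter (a := 56) (N := numE) (s := s)
    (P := when (.not (.eqInt (.get 1 (var 56)) (.get 2 (var 56))))
      (incrEdge (.get 1 (var 56)) (.get 2 (var 56)) (.get 0 (var 56))))
    (fun i t => (∀ u w, mat n 2 t u w = ∑ e ∈ range i,
      if s.ints 1 e ≠ s.ints 2 e ∧ Joins (s.ints 1) (s.ints 2) e u w then s.reals 0 e else 0) ∧
      (∀ S, cut (mat n 2 t) (range n) S =
        ∑ e ∈ range i, sep S (s.ints 1 e) (s.ints 2 e) * s.reals 0 e))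
    (by
      have e : mat n 2 (s.setInt 56 0 0) = mat n 2 s := rfl
      rw [e, h0]; simp [cut])
    (by
      intro i t hi hc hfi hfr ⟨ih1, ih2⟩
      rw [eval_numE, hm] at hi
      have e1 : t.ints 1 = s.ints 1 := hfi 1 (by norm_num) (by decide)
      have e2 : t.ints 2 = s.ints 2 := hfi 2 (by norm_num) (by decide)
      have er : t.reals 0 = s.reals 0 := hfr 0 (by decide)
      have hset : ∀ (t : State) v, mat n 2 (t.setInt 56 0 v) = mat n 2 t := fun _ _ => rfl
      rw [hset]
      by_cases hab : s.ints 1 i = s.ints 2 i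
      · rw [run_when_neg (by simp [Test.holds, IntExpr.eval, hc, e1, e2, hab])]
        have : mat n 2 (t.setInt 99 0 0) = mat n 2 t := rfl
        rw [this]
        refine ⟨fun u w => ?_, fun S => ?_⟩
        · rw [sum_range_succ, ih1, if_neg (by simp [hab]), add_zero]
        · rw [sum_range_succ, ih2, hab, sep_self, zero_mul, add_zero]
      · rw [run_when_pos (by simp [Test.holds, IntExpr.eval, hc, e1, e2, hab])]
        have hsymm : ∀ u w, mat n 2 t u w = mat n 2 t w u := by
          intro u w
          rw [ih1, ih1]
          refine sum_congr rfl fun e _ => ?_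
          congr 1
          apply propext; unfold Joins; tauto
        rw [incrEdge_spec (s := t) (n := n) (x := s.ints 1 i) (y := s.ints 2 i) (δ := s.reals 0 i)
          (fun r hr => by simp [IntExpr.eval, hr, hc, e1]) (fun r hr => by
            simp [IntExpr.eval, hr, hc, e2]) (by simp [RealExpr.eval, hc, er]) (ha i hi) (hb i hi) hab
          hsymm]
        refine ⟨fun u w => ?_, fun S => ?_⟩
        · rw [sum_range_succ, addEdge, ih1]
          simp [hab]
        · rw [sum_range_succ, cut_addEdge (mem_range.2 (ha i hi)) (mem_range.2 (hb i hi)) hab, ih2])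
  rwa [eval_numE, hm] at key

/-- Whether the `i`-th member contains the edge `e`. -/
def hasEdge (i e : IntExpr) : Test := .ltInt (.const 0) (.get 6 (i.pair e))

/-- Moves weight from members with the pair `uw` to the edge `e` that joins `u` and `w`, where `e`,
`u`, `w` are in the variables `56`, `16`, `17`. -/
def usePair : Stmt :=
  transfer (.or (hasPair (var 40) (var 16) (var 17)) (hasPair (var 40) (var 17) (var 16))) (
    setInt 5 ((var 40).pair ((var 16).pair (var 17))) (.const 0) ;;
    setInt 5 ((var 40).pair ((var 17).pair (var 16))) (.const 0) ;;
    setInt 6 ((var 40).pair (var 56)) (.const 1))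

/-- Adds the edge `e` to members of total weight at most the value of the real variable `7`. -/
def fillEdge : Stmt :=
  transfer (.not (hasEdge (var 40) (var 56))) (setInt 6 ((var 40).pair (var 56)) (.const 1))

/-- Replaces pairs by edges such that the weight of each edge `e` becomes the minimum of `1` and the
given weight. -/
def distribute : Stmt :=
  iter 56 numE (
    assign 16 (.get 1 (var 56)) ;;
    assign 17 (.get 2 (var 56)) ;;
    cond (.ltReal (.get 0 (var 56)) (rconst 1)) (rassign 8 (.get 0 (var 56))) (rassign 8 (rconst 1)) ;;
    rassign 7 (rvar 8) ;;
    usePair ;;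
    sumWeights (hasEdge (var 43) (var 56)) ;;
    rassign 7 (.sub (rvar 8) (rvar 7)) ;;
    fillEdge)

end Stmt

/-- The indicator function of the edge `e`. -/
noncomputable def edgeInd (e : ℕ) (o : Member) : ℝ := if o.U e ≠ 0 then 1 else 0

/-- The pairs and the edges of the member form a connected graph. -/
structure EdgeGood (n m : ℕ) (a b : ℕ → ℕ) (o : Member) : Prop where
  supp : ∀ u w, o.T u w ≠ 0 → u < w
  conn : ∀ x < n, ∀ y < n, Relation.EqvGen
    (fun p q => o.T p q ≠ 0 ∨ ∃ e < m, o.U e ≠ 0 ∧ p = a e ∧ q = b e) x y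

/-- Replacement of the pair `uw` by the edge `e`. -/
def usePairOf (u w e : ℕ) (o : Member) : Member where
  T p q := if (p = u ∧ q = w) ∨ (p = w ∧ q = u) then 0 else o.T p q
  U := Function.update o.U e 1
  A := o.A

/-- Addition of the edge `e`. -/
def addEdgeOf (e : ℕ) (o : Member) : Member where
  T := o.T
  U := Function.update o.U e 1
  A := o.A

theorem eqvGen_bind {α : Type*} {R R' : α → α → Prop} (h : ∀ a b, R a b → Relation.EqvGen R' a b)
    {x y : α} (hxy : Relation.EqvGen R x y) : Relation.EqvGen R' x y := by
  induction hxy with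
  | rel a b hab => exact h a b hab
  | refl a => exact .refl _
  | symm a b _ ih => exact .symm _ _ ih
  | trans a b c _ _ ih1 ih2 => exact .trans _ _ _ ih1 ih2

theorem EdgeGood.usePairOf {n m e : ℕ} {a b : ℕ → ℕ} {o : Member} (h : EdgeGood n m a b o)
    (he : e < m) : EdgeGood n m a b (usePairOf (a e) (b e) e o) := by
  refine ⟨fun u w hT => h.supp u w ?_, fun x hx y hy => eqvGen_bind ?_ (h.conn x hx y hy)⟩
  · simp only [RAM.usePairOf] at hT
    split_ifs at hT
    · exact absurd rfl hT
    · exact hT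
  · rintro p q (hT | ⟨f, hf, hU, rfl, rfl⟩)
    · by_cases hpq : (p = a e ∧ q = b e) ∨ (p = b e ∧ q = a e)
      · have key : Relation.EqvGen (fun p q => (RAM.usePairOf (a e) (b e) e o).T p q ≠ 0 ∨
            ∃ e' < m, (RAM.usePairOf (a e) (b e) e o).U e' ≠ 0 ∧ p = a e' ∧ q = b e') (a e) (b e) :=
          .rel _ _ (Or.inr ⟨e, he, by simp [RAM.usePairOf], rfl, rfl⟩)
        rcases hpq with ⟨rfl, rfl⟩ | ⟨rfl, rfl⟩
        · exact key
        · exact .symm _ _ key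
      · exact .rel _ _ (Or.inl (by simpa only [RAM.usePairOf, hpq, if_false] using hT))
    · refine .rel _ _ (Or.inr ⟨f, hf, ?_, rfl, rfl⟩)
      by_cases hfe : f = e
      · subst hfe; simp [RAM.usePairOf]
      · simpa [RAM.usePairOf, hfe] using hU

theorem EdgeGood.addEdgeOf {n m e : ℕ} {a b : ℕ → ℕ} {o : Member} (h : EdgeGood n m a b o) :
    EdgeGood n m a b (addEdgeOf e o) := by
  refine ⟨h.supp, fun x hx y hy => Relation.EqvGen.mono ?_ _ _ (h.conn x hx y hy)⟩
  rintro p q (hT | ⟨f, hf, hU, rfl, rfl⟩)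
  · exact Or.inl hT
  · refine Or.inr ⟨f, hf, ?_, rfl, rfl⟩
    by_cases hfe : f = e
    · subst hfe; simp [RAM.addEdgeOf]
    · simpa [RAM.addEdgeOf, hfe] using hU

theorem edgeInd_usePairOf {u w e f : ℕ} (hf : f ≠ e) (o : Member) :
    edgeInd f (usePairOf u w e o) = edgeInd f o := by simp [edgeInd, usePairOf, hf]

theorem edgeInd_addEdgeOf {e f : ℕ} (hf : f ≠ e) (o : Member) :
    edgeInd f (addEdgeOf e o) = edgeInd f o := by simp [edgeInd, addEdgeOf, hf]

theorem edgeInd_nonneg (e : ℕ) (o : Member) : 0 ≤ edgeInd e o := by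
  unfold edgeInd; split_ifs <;> norm_num

theorem edgeInd_le_one (e : ℕ) (o : Member) : edgeInd e o ≤ 1 := by
  unfold edgeInd; split_ifs <;> norm_num

namespace Stmt

/-- Pairs are stored with the smaller vertex first, while the ends of an edge come in any order.
Therefore both orders are tested and cleared. -/
theorem usePair_spec {s : State} {n m e : ℕ} {a b : ℕ → ℕ} (hn : s.ints 0 0 = n)
    (hm : s.ints 0 1 = m) (he : s.ints 56 0 = e) (hem : e < m) (hu : s.ints 16 0 = a e)
    (hw : s.ints 17 0 = b e) (hun : a e < n) (hwn : b e < n)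
    (hbound : s.ints 3 0 ≤ familyBound.eval s) (hF : IsFamily n m (EdgeGood n m a b) s) :
    ∃ μ, Moves n m (EdgeGood n m a b) (fun o => o.T (a e) (b e) ≠ 0 ∨ o.T (b e) (a e) ≠ 0)
      (usePairOf (a e) (b e) e) μ s (usePair.run s) ∧
      μ ≤ max 0 (s.reals 7 0) ∧ (μ = max 0 (s.reals 7 0) ∨ ∀ i < (usePair.run s).ints 3 0,
        ¬ ((member n m (usePair.run s) i).T (a e) (b e) ≠ 0 ∨
          (member n m (usePair.run s) i).T (b e) (a e) ≠ 0)) := by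
  refine transfer_moves _ _ _ hn hm hbound ⟨fun c hc => ?_, fun c => ?_⟩ ?_ ?_ ?_ hF
  · simp only [List.mem_cons, List.not_mem_nil, or_false, not_or] at hc
    simp [writesInt]; omega
  · simp [writesReal]
  · intro t ht
    simp only [hasPair, Test.holds_or, Test.holds, IntExpr.eval, IntExpr.eval_pair, eval_var,
      ht.ints 16 (by decide), ht.ints 17 (by decide), hu, hw, member_of_lt t hun hwn,
      member_of_lt t hwn hun, Nat.pos_iff_ne_zero]
  · intro t ht _ _
    obtain ⟨i, hi⟩ : ∃ i, t.ints 40 0 = i := ⟨_, rfl⟩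
    have e16 : t.ints 16 0 = a e := by rw [ht.ints 16 (by decide), hu]
    have e17 : t.ints 17 0 = b e := by rw [ht.ints 17 (by decide), hw]
    have e56 : t.ints 56 0 = e := by rw [ht.ints 56 (by decide), he]
    rw [hi]
    simp only [run_seq, run_setInt, IntExpr.eval, IntExpr.eval_pair, eval_var, ints_setInt,
      Nat.reduceEqDiff, false_and, if_false, hi, e16, e17, e56]
    refine ⟨Member.ext ?_ ?_ ?_, fun j hj => Member.ext ?_ ?_ ?_⟩
    · funext p q
      simp only [member, RAM.usePairOf, ints_setInt, pairIndex_inj, Nat.reduceEqDiff, false_and,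
        if_false, true_and]
      split_ifs <;> first | rfl | (exfalso; tauto)
    · funext f
      simp only [member, RAM.usePairOf, ints_setInt, pairIndex_inj, Nat.reduceEqDiff, false_and,
        if_false, true_and, Function.update_apply]
      split_ifs <;> first | rfl | (exfalso; omega)
    · simp [member, RAM.usePairOf]
    · funext p q; simp [member, pairIndex_inj, hj]
    · funext f; simp [member, pairIndex_inj, hj]
    · simp [member]
  · intro o ho _
    exact ⟨ho.usePairOf hem, by simp [RAM.usePairOf]⟩

theorem fillEdge_spec {s : State} {n m e : ℕ} {a b : ℕ → ℕ} (hn : s.ints 0 0 = n)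
    (hm : s.ints 0 1 = m) (he : s.ints 56 0 = e) (hem : e < m)
    (hbound : s.ints 3 0 ≤ familyBound.eval s) (hF : IsFamily n m (EdgeGood n m a b) s) :
    ∃ μ, Moves n m (EdgeGood n m a b) (fun o => o.U e = 0)
      (addEdgeOf e) μ s (fillEdge.run s) ∧
      μ ≤ max 0 (s.reals 7 0) ∧ (μ = max 0 (s.reals 7 0) ∨ ∀ i < (fillEdge.run s).ints 3 0,
        ¬ (member n m (fillEdge.run s) i).U e = 0) := by
  refine transfer_moves _ _ _ hn hm hbound ⟨fun c hc => ?_, fun c => ?_⟩ ?_ ?_ ?_ hF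
  · simp only [List.mem_cons, List.not_mem_nil, or_false, not_or] at hc
    simp [writesInt]; omega
  · simp [writesReal]
  · intro t ht
    simp [hasEdge, Test.holds, IntExpr.eval, ht.ints 56 (by decide), he, member, hem]
  · intro t ht _ _
    obtain ⟨i, hi⟩ : ∃ i, t.ints 40 0 = i := ⟨_, rfl⟩
    have e56 : t.ints 56 0 = e := by rw [ht.ints 56 (by decide), he]
    rw [hi]
    simp only [run_setInt, IntExpr.eval, IntExpr.eval_pair, eval_var, hi, e56]
    refine ⟨Member.ext ?_ ?_ ?_, fun j hj => Member.ext ?_ ?_ ?_⟩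
    · funext p q; simp [member, RAM.addEdgeOf]
    · funext f
      simp only [member, RAM.addEdgeOf, ints_setInt, pairIndex_inj, true_and, Function.update_apply]
      split_ifs <;> first | rfl | (exfalso; omega)
    · simp [member, RAM.addEdgeOf]
    · funext p q; simp [member]
    · funext f; simp [member, pairIndex_inj, hj]
    · simp [member]
  · intro o ho _
    exact ⟨ho.addEdgeOf, by simp [RAM.addEdgeOf]⟩

end Stmt

end RAM

/-! ### Giving every edge exactly the weight `min 1 (x e)`. -/

namespace RAM

open Finset WCut

namespace Stmt

/-- The state of the family when the edges below `i` have been treated. -/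
structure EdgePhase (n m ℓ : ℕ) (a b : ℕ → ℕ) (x : ℕ → ℝ) (i : ℕ) (t : State) : Prop where
  fam : IsFamily n m (EdgeGood n m a b) t
  size : t.ints 3 0 ≤ ℓ + 2 * i
  total : famSum n m t (fun _ => 1) = 1
  edge : ∀ e < m, famSum n m t (edgeInd e) = if e < i then min 1 (x e) else 0
  pair : ∀ u w, u < w → w < n → famSum n m t (pairInd u w) ≤
    ∑ e ∈ range m, if i ≤ e ∧ Joins a b e u w then x e else 0

theorem EdgePhase.congr {n m ℓ : ℕ} {a b : ℕ → ℕ} {x : ℕ → ℝ} {i : ℕ} {s t : State}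
    (h : EdgePhase n m ℓ a b x i s) (h3 : t.ints 3 = s.ints 3) (h5 : t.ints 5 = s.ints 5)
    (h6 : t.ints 6 = s.ints 6) (h8 : t.ints 8 = s.ints 8) (h1 : t.reals 1 = s.reals 1) :
    EdgePhase n m ℓ a b x i t := by
  have e := famSum_congr (n := n) (m := m) h3 h5 h6 h8 h1
  refine ⟨h.fam.congr h3 h5 h6 h8 h1, by rw [h3]; exact h.size, ?_, ?_, ?_⟩ <;> rw [e]
  exacts [h.total, h.edge, h.pair]

/-- The weight of a pair stays within the total `x` of those edges joining it that are still to be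
treated. If `x e ≤ 1`, moving `x e` from the pair to `e` lowers the weight of the pair by this
amount, unless it vanishes earlier. If `x e > 1`, the budget 1 is the whole weight of the family, so
the pair disappears. Afterwards `e` is added to further members until its weight is exact, which
affects neither pairs nor other edges. -/
theorem EdgePhase.step {n m ℓ e : ℕ} {a b : ℕ → ℕ} {x : ℕ → ℝ} {s t r : State} {μ ν : ℝ}
    (hx : ∀ e < m, 0 ≤ x e) (he : e < m) (h : EdgePhase n m ℓ a b x e s)
    (hM : Moves n m (EdgeGood n m a b) (fun o => o.T (a e) (b e) ≠ 0 ∨ o.T (b e) (a e) ≠ 0)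
      (usePairOf (a e) (b e) e) μ s t)
    (hμ : μ ≤ min 1 (x e)) (hμ' : μ = min 1 (x e) ∨ ∀ i < t.ints 3 0,
      ¬ ((member n m t i).T (a e) (b e) ≠ 0 ∨ (member n m t i).T (b e) (a e) ≠ 0))
    (hN : Moves n m (EdgeGood n m a b) (fun o => o.U e = 0) (addEdgeOf e) ν t r)
    (hν : ν ≤ max 0 (min 1 (x e) - famSum n m t (edgeInd e)))
    (hν' : ν = max 0 (min 1 (x e) - famSum n m t (edgeInd e)) ∨ ∀ i < r.ints 3 0,
      ¬ (member n m r i).U e = 0) :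
    EdgePhase n m ℓ a b x (e + 1) r := by
  have htot : famSum n m r (fun _ => 1) = 1 := (hN.total.trans hM.total).trans h.total
  -- The edge `e` was unused before, so its weight is at most what has just been moved and does not
  -- exceed `min 1 (x e)`; the second budget is not negative.
  have hmt : famSum n m t (edgeInd e) ≤ μ := by
    have h1 := hM.sum_le (edgeInd e) 1 fun o _ _ =>
      (edgeInd_le_one e _).trans (by linarith [edgeInd_nonneg e o])
    have h2 := h.edge e he
    rw [if_neg (lt_irrefl e)] at h2
    linarith
  rw [max_eq_right (by linarith)] at hν hν'
  refine ⟨hN.fam, by have := h.size; have := hM.size; have := hN.size; omega, htot,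
    fun f hf => ?_, fun u w huw hwn => ?_⟩
  · by_cases hfe : f = e
    · subst hfe
      rw [if_pos (Nat.lt_succ_self f)]
      refine le_antisymm ?_ ?_
      · have h1 := hN.sum_le (edgeInd f) 1 fun o _ _ =>
          (edgeInd_le_one f _).trans (by linarith [edgeInd_nonneg f o])
        linarith
      -- If the second budget is not spent, every member contains `e`, and the weight of `e` is the
      -- total weight 1.
      · rcases hν' with hν' | hν'
        · have h1 := hN.sum_le (fun o => -edgeInd f o) (-1) fun o _ ho => by
            simp [edgeInd, addEdgeOf, ho]
          rw [famSum_neg, famSum_neg] at h1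
          linarith
        · have : famSum n m r (edgeInd f) = famSum n m r fun _ => 1 := by
            unfold famSum
            refine sum_congr rfl fun i hi => ?_
            rw [edgeInd, if_pos (hν' i (mem_range.1 hi))]
          rw [this, htot]
          exact min_le_left _ _
    · have e1 : famSum n m r (edgeInd f) = famSum n m s (edgeInd f) := by
        have h1 := hM.sum_le (edgeInd f) 0 fun o _ _ => by rw [edgeInd_usePairOf hfe, add_zero]
        have h2 := hM.sum_le (fun o => -edgeInd f o) 0 fun o _ _ => by
          rw [edgeInd_usePairOf hfe, add_zero]
        have h3 := hN.sum_le (edgeInd f) 0 fun o _ _ => by rw [edgeInd_addEdgeOf hfe, add_zero]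
        have h4 := hN.sum_le (fun o => -edgeInd f o) 0 fun o _ _ => by
          rw [edgeInd_addEdgeOf hfe, add_zero]
        rw [famSum_neg, famSum_neg] at h2 h4
        linarith
      rw [e1, h.edge f hf]
      by_cases hlt : f < e
      · rw [if_pos hlt, if_pos (by omega)]
      · rw [if_neg hlt, if_neg (by omega)]
  · have h1 : famSum n m r (pairInd u w) ≤ famSum n m t (pairInd u w) := by
      have := hN.sum_le (pairInd u w) 0 fun o _ _ => by rw [add_zero]; rfl
      linarith
    have h2 : famSum n m t (pairInd u w) ≤ famSum n m s (pairInd u w) := by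
      have := hM.sum_le (pairInd u w) 0 fun o _ _ => by
        rw [add_zero]
        by_cases hJ : (u = a e ∧ w = b e) ∨ (u = b e ∧ w = a e)
        · have h0 : (usePairOf (a e) (b e) e o).T u w = 0 := by
            simp only [usePairOf]; exact if_pos hJ
          rw [pairInd, if_neg (not_not.2 h0)]
          exact pairInd_nonneg _ _ _
        · have h0 : (usePairOf (a e) (b e) e o).T u w = o.T u w := by
            simp only [usePairOf]; exact if_neg hJ
          rw [pairInd_congr h0]
      linarith
    have hnn : 0 ≤ ∑ f ∈ range m, if e + 1 ≤ f ∧ Joins a b f u w then x f else 0 := by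
      refine sum_nonneg fun f hf => ?_
      split_ifs
      · exact hx f (mem_range.1 hf)
      · exact le_rfl
    have hsum : (∑ f ∈ range m, if e ≤ f ∧ Joins a b f u w then x f else 0) =
        (∑ f ∈ range m, if e + 1 ≤ f ∧ Joins a b f u w then x f else 0) +
          if Joins a b e u w then x e else 0 := by
      have : (if Joins a b e u w then x e else 0) =
          ∑ f ∈ range m, if f = e then (if Joins a b e u w then x e else 0) else 0 := by
        rw [sum_ite_eq', if_pos (mem_range.2 he)]
      rw [this, ← sum_add_distrib]
      refine sum_congr rfl fun f _ => ?_
      by_cases hfe : f = e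
      · subst hfe; simp
      · have : e ≤ f ↔ e + 1 ≤ f := by omega
        simp [hfe, this]
    have hs := h.pair u w huw hwn
    rw [hsum] at hs
    by_cases hJ : Joins a b e u w
    · rw [if_pos hJ] at hs
      rcases hμ' with hμ' | hμ'
      · have h3 := hM.sum_le (pairInd u w) (-1) fun o ho hp => by
          have hT : o.T u w ≠ 0 := by
            rcases hJ with ⟨rfl, rfl⟩ | ⟨rfl, rfl⟩ <;> rcases hp with hp | hp
            · exact hp
            · have := ho.supp _ _ hp; omega
            · have := ho.supp _ _ hp; omega
            · exact hp
          have hT' : (usePairOf (a e) (b e) e o).T u w = 0 := by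
            simp only [usePairOf]; exact if_pos hJ
          simp [pairInd, hT, hT']
        by_cases hx1 : x e ≤ 1
        · rw [min_eq_right hx1] at hμ'; linarith
        · rw [min_eq_left (by linarith)] at hμ'
          have h4 := h.fam.famSum_le (φ := pairInd u w) (ψ := fun _ => 1) fun o _ =>
            pairInd_le_one u w o
          rw [h.total] at h4
          linarith
      · have h3 : famSum n m t (pairInd u w) = 0 := famSum_eq_zero fun i hi => by
          unfold pairInd
          rw [if_neg]
          intro hT
          refine hμ' i hi ?_
          rcases hJ with ⟨rfl, rfl⟩ | ⟨rfl, rfl⟩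
          · exact Or.inl hT
          · exact Or.inr hT
        linarith
    · rw [if_neg hJ, add_zero] at hs
      linarith

theorem distribute_spec {s : State} {n m ℓ : ℕ} (hn : s.ints 0 0 = n) (hm : s.ints 0 1 = m)
    (ha : ∀ e < m, s.ints 1 e < n) (hb : ∀ e < m, s.ints 2 e < n)
    (hx : ∀ e < m, 0 ≤ s.reals 0 e) (hbound : ℓ + 2 * m ≤ familyBound.eval s)
    (h : EdgePhase n m ℓ (s.ints 1) (s.ints 2) (s.reals 0) 0 s) :
    EdgePhase n m ℓ (s.ints 1) (s.ints 2) (s.reals 0) m (distribute.run s) := by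
  obtain ⟨x, hxdef⟩ : ∃ x, x = s.reals 0 := ⟨_, rfl⟩
  obtain ⟨a, hadef⟩ : ∃ a, a = s.ints 1 := ⟨_, rfl⟩
  obtain ⟨b, hbdef⟩ : ∃ b, b = s.ints 2 := ⟨_, rfl⟩
  rw [← hxdef] at hx
  rw [← hadef] at ha
  rw [← hbdef] at hb
  rw [← hxdef, ← hadef, ← hbdef] at h ⊢
  have key := run_iter (a := 56) (N := numE) (s := s) (P :=
    assign 16 (.get 1 (var 56)) ;;
    assign 17 (.get 2 (var 56)) ;;
    cond (.ltReal (.get 0 (var 56)) (rconst 1)) (rassign 8 (.get 0 (var 56))) (rassign 8 (rconst 1)) ;;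
    rassign 7 (rvar 8) ;;
    usePair ;;
    sumWeights (hasEdge (var 43) (var 56)) ;;
    rassign 7 (.sub (rvar 8) (rvar 7)) ;;
    fillEdge)
    (fun i t => EdgePhase n m ℓ a b x i t) (h.congr rfl rfl rfl rfl rfl)
    (by
      intro e t he hc hfi hfr ih
      rw [eval_numE, hm] at he
      have e0 : t.ints 0 = s.ints 0 := hfi 0 (by norm_num) (by decide)
      have e1 : t.ints 1 = a := by rw [hadef]; exact hfi 1 (by norm_num) (by decide)
      have e2 : t.ints 2 = b := by rw [hbdef]; exact hfi 2 (by norm_num) (by decide)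
      have er : t.reals 0 = x := by rw [hxdef]; exact hfr 0 (by decide)
      obtain ⟨t1, ht1⟩ : ∃ t1, t1 = ((((t.setInt 16 0 (a e)).setInt 17 0 (b e)).setReal 8 0
        (min 1 (x e))).setReal 7 0 (min 1 (x e))) := ⟨_, rfl⟩
      have et : (rassign 7 (rvar 8)).run ((cond (.ltReal (.get 0 (var 56)) (rconst 1))
          (rassign 8 (.get 0 (var 56))) (rassign 8 (rconst 1))).run
          ((assign 17 (.get 2 (var 56))).run ((assign 16 (.get 1 (var 56))).run t))) = t1 := by
        have : (assign 17 (.get 2 (var 56))).run ((assign 16 (.get 1 (var 56))).run t) =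
            (t.setInt 16 0 (a e)).setInt 17 0 (b e) := by
          simp [IntExpr.eval, hc, e1, e2]
        rw [this]
        by_cases hlt : x e < 1
        · rw [run_cond_pos (by simpa [Test.holds, RealExpr.eval, IntExpr.eval, hc, er] using hlt),
            ht1, min_eq_right hlt.le]
          simp [RealExpr.eval, hc, er]
        · rw [run_cond_neg (by simpa [Test.holds, RealExpr.eval, IntExpr.eval, hc, er] using hlt),
            ht1, min_eq_left (not_lt.1 hlt)]
          simp
      have i1 : ∀ c, c ≠ 16 → c ≠ 17 → t1.ints c = t.ints c := by
        intro c h1 h2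
        rw [ht1]; simp only [ints_setReal]
        rw [ints_setInt_ne _ h2, ints_setInt_ne _ h1]
      have g1 : t1.reals 1 = t.reals 1 := by rw [ht1]; rfl
      have g7 : t1.reals 7 0 = min 1 (x e) := by rw [ht1]; simp
      have g8 : t1.reals 8 0 = min 1 (x e) := by rw [ht1]; simp
      have g0 : t1.ints 0 = s.ints 0 := by rw [i1 0 (by norm_num) (by norm_num), e0]
      have g56 : t1.ints 56 0 = e := by rw [i1 56 (by norm_num) (by norm_num), hc]
      have ih1 : EdgePhase n m ℓ a b x e t1 := ih.congr (i1 3 (by norm_num) (by norm_num))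
        (i1 5 (by norm_num) (by norm_num)) (i1 6 (by norm_num) (by norm_num))
        (i1 8 (by norm_num) (by norm_num)) g1
      have hmin : 0 ≤ min 1 (x e) := le_min zero_le_one (hx e he)
      obtain ⟨μ, m1, m2, m3⟩ := usePair_spec (s := t1) (n := n) (m := m) (e := e) (a := a) (b := b)
        (by rw [g0, hn]) (by rw [g0, hm]) g56 he (by rw [ht1]; simp) (by rw [ht1]; simp)
        (ha e he) (hb e he) (by rw [familyBound_congr g0]; have := ih1.size; omega) ih1.fam
      rw [g7, max_eq_right hmin] at m2 m3
      obtain ⟨t2, ht2⟩ : ∃ t2, t2 = usePair.run t1 := ⟨_, rfl⟩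
      rw [← ht2] at m1 m3
      have i2 : ∀ c ∈ [0, 56], t2.ints c = t1.ints c := by
        intro c hc
        simp only [List.mem_cons, List.not_mem_nil, or_false] at hc
        rw [ht2]
        rcases hc with rfl | rfl <;> exact run_ints _ (by decide) _
      have f8 : t2.reals 8 0 = min 1 (x e) := by rw [ht2, run_reals _ (by decide), g8]
      obtain ⟨t3, ht3⟩ : ∃ t3, t3 = (sumWeights (hasEdge (var 43) (var 56))).run t2 := ⟨_, rfl⟩
      obtain ⟨i3, r3⟩ := sumWeights_frame (hasEdge (var 43) (var 56)) t2
      have hB2 : t2.ints 3 0 ≤ familyBound.eval t2 := by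
        rw [familyBound_congr (i2 0 (by decide)), familyBound_congr g0]
        have := ih1.size; have := m1.size; omega
      have v3 : t3.reals 7 0 = famSum n m t2 (edgeInd e) := by
        rw [ht3]
        refine sumWeights_spec _ rfl hB2 fun q h1 _ _ => ?_
        simp only [hasEdge, Test.holds, IntExpr.eval, IntExpr.eval_pair, eval_var,
          h1 6 (by decide), h1 56 (by decide), i2 56 (by decide), g56, edgeInd, member, he, if_true,
          Nat.pos_iff_ne_zero]
        exact ⟨fun h => if_pos h, fun h => if_neg h⟩
      rw [← ht3] at i3 r3
      obtain ⟨t4, ht4⟩ : ∃ t4, t4 = (rassign 7 (.sub (rvar 8) (rvar 7))).run t3 := ⟨_, rfl⟩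
      have i4 : ∀ c, c ∉ [43, 99] → t4.ints c = t2.ints c := by
        intro c hc; rw [ht4]; exact i3 c hc
      have r4 : t4.reals 1 = t2.reals 1 := by
        rw [← r3 1 (by norm_num), ht4]; rfl
      have v4 : t4.reals 7 0 = min 1 (x e) - famSum n m t2 (edgeInd e) := by
        rw [ht4]; simp [RealExpr.eval, v3, r3 8 (by norm_num), f8]
      obtain ⟨ν, n1, n2, n3⟩ := fillEdge_spec (s := t4) (n := n) (m := m) (e := e) (a := a) (b := b)
        (by rw [i4 0 (by decide), i2 0 (by decide), g0, hn])
        (by rw [i4 0 (by decide), i2 0 (by decide), g0, hm])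
        (by rw [i4 56 (by decide), i2 56 (by decide), g56]) he
        (by rw [i4 3 (by decide), familyBound_congr (i4 0 (by decide))]; exact hB2)
        (m1.fam.congr (i4 3 (by decide)) (i4 5 (by decide)) (i4 6 (by decide)) (i4 8 (by decide)) r4)
      rw [v4] at n2 n3
      have n1' := n1.congr (s' := t2) (i4 3 (by decide)).symm (i4 5 (by decide)).symm
        (i4 6 (by decide)).symm (i4 8 (by decide)).symm r4.symm
      have := ih1.step hx he m1 m2 m3 n1' n2 n3
      simp only [run_seq, et, ← ht2, ← ht3, ← ht4]
      exact this.congr (ints_setInt_ne _ (by norm_num) _ _)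
        (ints_setInt_ne _ (by norm_num) _ _) (ints_setInt_ne _ (by norm_num) _ _)
        (ints_setInt_ne _ (by norm_num) _ _) rfl)
  rwa [eval_numE, hm] at key

/-- The edges of each member form a connected graph. -/
theorem EdgePhase.connected {n m ℓ : ℕ} {a b : ℕ → ℕ} {x : ℕ → ℝ} {s : State}
    (h : EdgePhase n m ℓ a b x m s) {i : ℕ} (hi : i < s.ints 3 0) {y z : ℕ} (hy : y < n)
    (hz : z < n) : Relation.EqvGen
      (fun p q => ∃ e < m, (member n m s i).U e ≠ 0 ∧ p = a e ∧ q = b e) y z := by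
  refine Relation.EqvGen.mono ?_ _ _ ((h.fam.good i hi).conn y hy z hz)
  rintro p q (hT | h')
  · exfalso
    have hpq := (h.fam.good i hi).supp p q hT
    have hqn : q < n := by
      by_contra hc
      exact hT (by simp [member, hc])
    -- No edge is left to be treated, so the bound on the weight of this pair is an empty sum, and
    -- no member can contain it.
    have h1 := h.pair p q hpq hqn
    rw [sum_eq_zero fun e he => if_neg (by have := mem_range.1 he; omega)] at h1
    have h2 := h.fam.eq_zero (fun o _ => pairInd_nonneg p q o) h1 i hi
    simp [pairInd, hT] at h2
  · exact h'

/-- A pair has two different elements and is never joined by a loop, so the condition that excludes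
loops can be dropped from the bound. -/
theorem LevelPhase.edgePhase {n m ℓ : ℕ} {a b : ℕ → ℕ} {x : ℕ → ℝ} {W : ℕ → ℕ → ℝ} {s : State}
    (hn : 0 < n) (h : LevelPhase n m ℓ (n - 1) W s)
    (hW : ∀ u w, u < w → W u w = ∑ e ∈ range m, if a e ≠ b e ∧ Joins a b e u w then x e else 0) :
    EdgePhase n m ℓ a b x 0 s := by
  have hn1 : n - 1 + 1 = n := by omega
  have hfam := h.fam
  rw [hn1] at hfam
  refine ⟨⟨fun i hi => ⟨fun u w hT => ((hfam.good i hi).1.supp u w hT).1, fun x hx y hy => ?_⟩,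
    h.fam.pos⟩, h.size, h.total, fun e he => ?_, fun u w huw hwn => ?_⟩
  · exact Relation.EqvGen.mono (fun p q hpq => Or.inl hpq.2) _ _ ((hfam.good i hi).1.conn x hx y hy)
  · rw [if_neg (Nat.not_lt_zero e)]
    exact famSum_eq_zero fun i hi => by simp [edgeInd, (hfam.good i hi).1.empty]
  · refine (h.le u w huw (by omega)).trans (le_of_eq ?_)
    rw [hW u w huw]
    refine sum_congr rfl fun e _ => ?_
    congr 1
    apply propext
    unfold Joins
    constructor
    · exact fun h => ⟨Nat.zero_le e, h.2⟩
    · exact fun h => ⟨by omega, h.2⟩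

end Stmt

end RAM

/-! ### Separating pairs of edges and the table of multiplicities. -/

namespace RAM

open Finset WCut

/-- The removal of the edges `e` and `f` separates the ends of `e`, where `a` and `b` describe the
ends of the `m` edges. -/
def Separates (m : ℕ) (a b : ℕ → ℕ) (e f : ℕ) : Prop :=
  ¬ Relation.EqvGen (fun p q => ∃ g < m, (g ≠ e ∧ g ≠ f) ∧ p = a g ∧ q = b g) (a e) (b e)

/-- The multiplicity of the edge `e` in the connector that is built from the edge set `U`. -/
noncomputable def multiplicity (m : ℕ) (a b : ℕ → ℕ) (U : ℕ → ℕ) (e : ℕ) : ℕ := open Classical in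
  if U e = 0 then 0 else if ∃ f < m, Separates m a b e f ∧ (f = e ∨ U f = 0) then 2 else 1

namespace Stmt

/-- Tabulates in the integer array `9` which pairs of edges separate the ends of the first one. -/
def separationTable : Stmt :=
  iter 46 (.mul numE numE) (
    assign 18 (.div (var 46) numE) ;;
    assign 19 (.mod (var 46) numE) ;;
    labels numE (.and (.not (.eqInt (var 30) (var 18))) (.not (.eqInt (var 30) (var 19))))
      (.get 1 (var 30)) (.get 2 (var 30)) ;;
    cond (.eqInt (.get 7 (.get 1 (var 18))) (.get 7 (.get 2 (var 18))))
      (setInt 9 ((var 18).pair (var 19)) (.const 0)) (setInt 9 ((var 18).pair (var 19)) (.const 1)))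

/-- Writes the multiplicities of the edges in the connectors. -/
def connectorTable : Stmt :=
  iter 47 (.mul familyBound numE) (
    assign 18 (.div (var 47) numE) ;;
    assign 19 (.mod (var 47) numE) ;;
    cond (hasEdge (var 18) (var 19))
      (setInt 4 (var 47) (.const 1) ;;
        iter 48 numE (when (.and (.ltInt (.const 0) (.get 9 ((var 19).pair (var 48))))
          (.or (.eqInt (var 48) (var 19)) (.not (hasEdge (var 18) (var 48)))))
          (setInt 4 (var 47) (.const 2))))
      (setInt 4 (var 47) (.const 0)))

/-- Components are computed without the edges `e` and `f`; the ends of `e` are separated when their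
labels differ. -/
theorem separationTable_spec {s : State} {n m : ℕ} (hn : s.ints 0 0 = n) (hm : s.ints 0 1 = m)
    (ha : ∀ e < m, s.ints 1 e < n) (hb : ∀ e < m, s.ints 2 e < n) {e f : ℕ} (he : e < m)
    (hf : f < m) : (separationTable.run s).ints 9 (pairIndex e f) ≠ 0 ↔
      Separates m (s.ints 1) (s.ints 2) e f := by
  have key := run_iter (a := 46) (N := .mul numE numE) (s := s) (P :=
    assign 18 (.div (var 46) numE) ;;
    assign 19 (.mod (var 46) numE) ;;
    labels numE (.and (.not (.eqInt (var 30) (var 18))) (.not (.eqInt (var 30) (var 19))))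
      (.get 1 (var 30)) (.get 2 (var 30)) ;;
    cond (.eqInt (.get 7 (.get 1 (var 18))) (.get 7 (.get 2 (var 18))))
      (setInt 9 ((var 18).pair (var 19)) (.const 0)) (setInt 9 ((var 18).pair (var 19)) (.const 1)))
    (fun i t => ∀ j < i, t.ints 9 (pairIndex (j / m) (j % m)) ≠ 0 ↔
      Separates m (s.ints 1) (s.ints 2) (j / m) (j % m))
    (fun j hj => absurd hj (Nat.not_lt_zero j))
    (by
      intro i t hi hc hfi hfr ih
      have eN : IntExpr.eval s (.mul numE numE) = m * m := by simp [IntExpr.eval, hm]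
      rw [eN] at hi
      have hdm : i / m < m := Nat.div_lt_of_lt_mul hi
      have e0 : t.ints 0 = s.ints 0 := hfi 0 (by norm_num) (by decide)
      have e1 : t.ints 1 = s.ints 1 := hfi 1 (by norm_num) (by decide)
      have e2 : t.ints 2 = s.ints 2 := hfi 2 (by norm_num) (by decide)
      obtain ⟨t1, ht1⟩ : ∃ t1, t1 = (t.setInt 18 0 (i / m)).setInt 19 0 (i % m) := ⟨_, rfl⟩
      have et : (assign 19 (.mod (var 46) numE)).run ((assign 18 (.div (var 46) numE)).run t) =
          t1 := by rw [ht1]; simp [IntExpr.eval, hc, e0, hm]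
      have i1 : ∀ c, c ≠ 18 → c ≠ 19 → t1.ints c = t.ints c := by
        intro c h1 h2
        rw [ht1, ints_setInt_ne _ h2, ints_setInt_ne _ h1]
      have g18 : t1.ints 18 0 = i / m := by rw [ht1]; simp
      have g19 : t1.ints 19 0 = i % m := by rw [ht1]; simp
      have g0 : t1.ints 0 = s.ints 0 := by rw [i1 0 (by norm_num) (by norm_num), e0]
      have g1 : t1.ints 1 = s.ints 1 := by rw [i1 1 (by norm_num) (by norm_num), e1]
      have g2 : t1.ints 2 = s.ints 2 := by rw [i1 2 (by norm_num) (by norm_num), e2]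
      have g9 : t1.ints 9 = t.ints 9 := i1 9 (by norm_num) (by norm_num)
      obtain ⟨t2, ht2⟩ : ∃ t2, t2 = (labels numE (.and (.not (.eqInt (var 30) (var 18)))
        (.not (.eqInt (var 30) (var 19)))) (.get 1 (var 30)) (.get 2 (var 30))).run t1 := ⟨_, rfl⟩
      have i2 : ∀ c, c ∉ [7, 30, 31, 32, 33, 99] → t2.ints c = t1.ints c := by
        intro c hc
        simp only [List.mem_cons, List.not_mem_nil, or_false, not_or] at hc
        rw [ht2]
        exact run_ints _ (by simp [labels, writesInt, when, skip, assign]; omega) _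
      have hlab : t2.ints 7 (s.ints 1 (i / m)) = t2.ints 7 (s.ints 2 (i / m)) ↔
          ¬ Separates m (s.ints 1) (s.ints 2) (i / m) (i % m) := by
        rw [ht2, labels_spec (s := t1) (K := m) (n := n) (by rw [g0, hn])
          (fun j => j ≠ i / m ∧ j ≠ i % m) (s.ints 1) (s.ints 2)
          (by intro r hr; rw [eval_numE, hr 0 (by decide), g0, hm])
          (by
            intro r j hr _ hj hjm
            simp only [Test.holds, Test.holds_eqInt, IntExpr.eval, eval_var, hj, hr 18 (by decide),
              hr 19 (by decide), hr 1 (by decide), hr 2 (by decide), g18, g19, g1, g2, ne_eq,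
              true_and]
            exact fun _ => ⟨ha j hjm, hb j hjm⟩) _ (ha _ hdm) _ (hb _ hdm)]
        rw [Separates, not_not]
      have f18 : t2.ints 18 0 = i / m := by rw [i2 18 (by decide), g18]
      have f19 : t2.ints 19 0 = i % m := by rw [i2 19 (by decide), g19]
      have f1 : t2.ints 1 = s.ints 1 := by rw [i2 1 (by decide), g1]
      have f2 : t2.ints 2 = s.ints 2 := by rw [i2 2 (by decide), g2]
      have f9 : t2.ints 9 = t.ints 9 := by rw [i2 9 (by decide), g9]
      -- Quotient and remainder determine the number, so earlier entries of the table are not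
      -- overwritten.
      have hnew : ∀ j < i, ¬ (j / m = i / m ∧ j % m = i % m) := by
        rintro j hj ⟨h1, h2⟩
        have h3 := Nat.div_add_mod j m
        have h4 := Nat.div_add_mod i m
        rw [h1, h2] at h3
        omega
      intro j hj
      simp only [run_seq, et, ← ht2, ints_setInt, Nat.reduceEqDiff, false_and, if_false]
      by_cases hS : Separates m (s.ints 1) (s.ints 2) (i / m) (i % m)
      · rw [run_cond_neg (by
          simp only [Test.holds_eqInt, IntExpr.eval, eval_var, f18, f1, f2, hlab, not_not]
          exact hS)]
        simp only [run_setInt, IntExpr.eval, IntExpr.eval_pair, eval_var, f18, f19, ints_setInt,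
          true_and, pairIndex_inj, f9]
        rcases Nat.lt_succ_iff_lt_or_eq.1 hj with hj | rfl
        · rw [if_neg (hnew j hj)]; exact ih j hj
        · simp [hS]
      · rw [run_cond_pos (by
          simp only [Test.holds_eqInt, IntExpr.eval, eval_var, f18, f1, f2, hlab]
          exact hS)]
        simp only [run_setInt, IntExpr.eval, IntExpr.eval_pair, eval_var, f18, f19, ints_setInt,
          true_and, pairIndex_inj, f9]
        rcases Nat.lt_succ_iff_lt_or_eq.1 hj with hj | rfl
        · rw [if_neg (hnew j hj)]; exact ih j hj
        · simp [hS])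
  have eN : IntExpr.eval s (.mul numE numE) = m * m := by simp [IntExpr.eval, hm]
  rw [eN] at key
  obtain ⟨j, hj, rfl, rfl⟩ := div_mod_surj he hf
  exact key j hj

/-- The rows run up to the static bound on the family size rather than to the actual size, since
loop bounds may only depend on the input. Rows beyond the actual size are never part of the output.
-/
theorem connectorTable_spec {s : State} {m : ℕ} {a b : ℕ → ℕ} (hm : s.ints 0 1 = m)
    (h9 : ∀ e < m, ∀ f < m, s.ints 9 (pairIndex e f) ≠ 0 ↔ Separates m a b e f) {i e : ℕ}
    (hi : i < familyBound.eval s) (he : e < m) :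
    (connectorTable.run s).ints 4 (i * m + e) =
      multiplicity m a b (fun f => if f < m then s.ints 6 (pairIndex i f) else 0) e := by
  have eN : IntExpr.eval s (.mul familyBound numE) = familyBound.eval s * m := by
    simp [IntExpr.eval, hm]
  have key := run_iter (a := 47) (N := .mul familyBound numE) (s := s) (P :=
    assign 18 (.div (var 47) numE) ;;
    assign 19 (.mod (var 47) numE) ;;
    cond (hasEdge (var 18) (var 19))
      (setInt 4 (var 47) (.const 1) ;;
        iter 48 numE (when (.and (.ltInt (.const 0) (.get 9 ((var 19).pair (var 48))))
          (.or (.eqInt (var 48) (var 19)) (.not (hasEdge (var 18) (var 48)))))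
          (setInt 4 (var 47) (.const 2))))
      (setInt 4 (var 47) (.const 0)))
    (fun i t => ∀ j < i, t.ints 4 j =
      multiplicity m a b (fun f => if f < m then s.ints 6 (pairIndex (j / m) f) else 0) (j % m))
    (fun j hj => absurd hj (Nat.not_lt_zero j))
    (by
      intro i t hi hc hfi hfr ih
      rw [eN] at hi
      have hm0 : 0 < m := Nat.pos_of_ne_zero (by rintro rfl; simp at hi)
      have hmod : i % m < m := Nat.mod_lt _ hm0
      have e0 : t.ints 0 = s.ints 0 := hfi 0 (by norm_num) (by decide)
      have e6 : t.ints 6 = s.ints 6 := hfi 6 (by norm_num) (by decide)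
      have e9 : t.ints 9 = s.ints 9 := hfi 9 (by norm_num) (by decide)
      obtain ⟨t1, ht1⟩ : ∃ t1, t1 = (t.setInt 18 0 (i / m)).setInt 19 0 (i % m) := ⟨_, rfl⟩
      have et : (assign 19 (.mod (var 47) numE)).run ((assign 18 (.div (var 47) numE)).run t) =
          t1 := by rw [ht1]; simp [IntExpr.eval, hc, e0, hm]
      have i1 : ∀ c, c ≠ 18 → c ≠ 19 → t1.ints c = t.ints c := by
        intro c h1 h2
        rw [ht1, ints_setInt_ne _ h2, ints_setInt_ne _ h1]
      have g18 : t1.ints 18 0 = i / m := by rw [ht1]; simp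
      have g19 : t1.ints 19 0 = i % m := by rw [ht1]; simp
      have g4 : t1.ints 4 = t.ints 4 := i1 4 (by norm_num) (by norm_num)
      have g0 : t1.ints 0 = s.ints 0 := by rw [i1 0 (by norm_num) (by norm_num), e0]
      have g6 : t1.ints 6 = s.ints 6 := by rw [i1 6 (by norm_num) (by norm_num), e6]
      have g9 : t1.ints 9 = s.ints 9 := by rw [i1 9 (by norm_num) (by norm_num), e9]
      have g47 : t1.ints 47 0 = i := by rw [i1 47 (by norm_num) (by norm_num), hc]
      intro j hj
      simp only [run_seq, et, ints_setInt, Nat.reduceEqDiff, false_and, if_false]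
      by_cases hU : s.ints 6 (pairIndex (i / m) (i % m)) = 0
      · rw [run_cond_neg (by simp [Test.holds, hasEdge, IntExpr.eval, g18, g19, g6, hU])]
        simp only [run_setInt, IntExpr.eval, eval_var, g47, ints_setInt, true_and, g4]
        rcases Nat.lt_succ_iff_lt_or_eq.1 hj with hj | rfl
        · rw [if_neg hj.ne]; exact ih j hj
        · rw [if_pos rfl, multiplicity, if_pos (by rw [if_pos hmod]; exact hU)]
      · rw [run_cond_pos (by
          simp [Test.holds, hasEdge, IntExpr.eval, g18, g19, g6, Nat.pos_iff_ne_zero, hU])]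
        obtain ⟨t2, ht2⟩ : ∃ t2, t2 = t1.setInt 4 i 1 := ⟨_, rfl⟩
        have et2 : (setInt 4 (var 47) (.const 1)).run t1 = t2 := by
          rw [ht2]; simp [IntExpr.eval, g47]
        have i2 : ∀ c, c ≠ 4 → t2.ints c = t1.ints c := by
          intro c h1; rw [ht2, ints_setInt_ne _ h1]
        have inner := run_iter (a := 48) (N := numE) (s := t2)
          (P := when (.and (.ltInt (.const 0) (.get 9 ((var 19).pair (var 48))))
            (.or (.eqInt (var 48) (var 19)) (.not (hasEdge (var 18) (var 48)))))
            (setInt 4 (var 47) (.const 2)))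
          (fun k r => (∀ j < i, r.ints 4 j = t.ints 4 j) ∧
            ((∃ f < k, Separates m a b (i % m) f ∧ (f = i % m ∨ s.ints 6 (pairIndex (i / m) f) = 0))
              → r.ints 4 i = 2) ∧
            ((¬ ∃ f < k, Separates m a b (i % m) f ∧ (f = i % m ∨
              s.ints 6 (pairIndex (i / m) f) = 0)) → r.ints 4 i = 1))
          (by
            rw [ht2]
            refine ⟨fun j hj => ?_, fun h => ?_, fun _ => ?_⟩
            · simp [hj.ne, g4]
            · obtain ⟨f, hf, -⟩ := h; omega
            · simp)
          (by
            intro k r hk hck hri hrr ⟨ih1, ih2, ih3⟩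
            rw [eval_numE, i2 0 (by norm_num), g0, hm] at hk
            have r18 : r.ints 18 0 = i / m := by
              rw [hri 18 (by norm_num) (by decide), i2 18 (by norm_num), g18]
            have r19 : r.ints 19 0 = i % m := by
              rw [hri 19 (by norm_num) (by decide), i2 19 (by norm_num), g19]
            have r47 : r.ints 47 0 = i := by
              rw [hri 47 (by norm_num) (by decide), i2 47 (by norm_num), g47]
            have r6 : r.ints 6 = s.ints 6 := by
              rw [hri 6 (by norm_num) (by decide), i2 6 (by norm_num), g6]
            have r9 : r.ints 9 = s.ints 9 := by
              rw [hri 9 (by norm_num) (by decide), i2 9 (by norm_num), g9]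
            have htest : (Test.and (.ltInt (.const 0) (.get 9 ((var 19).pair (var 48))))
                (.or (.eqInt (var 48) (var 19)) (.not (hasEdge (var 18) (var 48))))).holds r ↔
                Separates m a b (i % m) k ∧ (k = i % m ∨ s.ints 6 (pairIndex (i / m) k) = 0) := by
              rw [← h9 _ hmod k hk]
              simp [Test.holds, hasEdge, IntExpr.eval, r18, r19, r6, r9, hck, Nat.pos_iff_ne_zero]
            by_cases ht : Separates m a b (i % m) k ∧
                (k = i % m ∨ s.ints 6 (pairIndex (i / m) k) = 0)
            · rw [run_when_pos (htest.2 ht)]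
              simp only [run_setInt, IntExpr.eval, eval_var, r47, ints_setInt, Nat.reduceEqDiff,
                false_and, if_false, true_and, if_true]
              refine ⟨fun j hj => ?_, fun _ => trivial, fun h => ?_⟩
              · rw [if_neg hj.ne]; exact ih1 j hj
              · exact absurd ⟨k, by omega, ht⟩ h
            · rw [run_when_neg fun h => ht (htest.1 h)]
              simp only [ints_setInt, Nat.reduceEqDiff, false_and, if_false]
              have : (∃ f < k + 1, Separates m a b (i % m) f ∧ (f = i % m ∨
                  s.ints 6 (pairIndex (i / m) f) = 0)) ↔ ∃ f < k, Separates m a b (i % m) f ∧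
                  (f = i % m ∨ s.ints 6 (pairIndex (i / m) f) = 0) := by
                constructor
                · rintro ⟨f, hf, hf'⟩
                  rcases Nat.lt_succ_iff_lt_or_eq.1 hf with hf | rfl
                  · exact ⟨f, hf, hf'⟩
                  · exact absurd hf' ht
                · rintro ⟨f, hf, hf'⟩; exact ⟨f, by omega, hf'⟩
              rw [this]
              exact ⟨ih1, ih2, ih3⟩)
        rw [eval_numE, i2 0 (by norm_num), g0, hm] at inner
        simp only [run_seq, et2]
        rcases Nat.lt_succ_iff_lt_or_eq.1 hj with hj | rfl
        · rw [inner.1 j hj]; exact ih j hj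
        · rw [multiplicity, if_neg (by rw [if_pos hmod]; exact hU)]
          have hex : (∃ f < m, Separates m a b (j % m) f ∧ (f = j % m ∨
              (if f < m then s.ints 6 (pairIndex (j / m) f) else 0) = 0)) ↔
              ∃ f < m, Separates m a b (j % m) f ∧ (f = j % m ∨
                s.ints 6 (pairIndex (j / m) f) = 0) := by
            refine exists_congr fun f => and_congr_right fun hf => ?_
            rw [if_pos hf]
          by_cases hx : ∃ f < m, Separates m a b (j % m) f ∧ (f = j % m ∨
              s.ints 6 (pairIndex (j / m) f) = 0)
          · rw [if_pos (hex.2 hx), inner.2.1 hx]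
          · rw [if_neg fun h => hx (hex.1 h), inner.2.2 hx])
  rw [eN] at key
  have hlt : i * m + e < familyBound.eval s * m := by
    have := Nat.mul_le_mul_right m (Nat.succ_le_of_lt hi)
    rw [Nat.succ_mul] at this
    omega
  refine (key _ hlt).trans ?_
  have hd : (i * m + e) / m = i := by
    rw [mul_comm, Nat.mul_add_div (by omega), Nat.div_eq_of_lt he, add_zero]
  have hmod : (i * m + e) % m = e := by rw [Nat.mul_add_mod', Nat.mod_eq_of_lt he]
  rw [hd, hmod]

end Stmt

end RAM

/-! ### Doubling of edges and 2-edge cuts. -/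

namespace EdgeListGraph

open Finset

variable {G : EdgeListGraph}

theorem mem_cut {S : Finset (Fin G.n)} {e : Fin G.m} :
    e ∈ G.cut S ↔ ¬ (G.fst e ∈ S ↔ G.snd e ∈ S) := by simp [cut]

theorem mem_cut_symmDiff {R S : Finset (Fin G.n)} {e : Fin G.m} :
    e ∈ G.cut (symmDiff R S) ↔ ¬ (e ∈ G.cut R ↔ e ∈ G.cut S) := by
  simp only [mem_cut, mem_symmDiff]; tauto

/-- Some cut contains the edge `e` and no other edge except possibly `f`. -/
def Critical (G : EdgeListGraph) (e f : Fin G.m) : Prop :=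
  ∃ R, e ∈ G.cut R ∧ ∀ g ∈ G.cut R, g = e ∨ g = f

/-- The multiplicities of the edges in the connector that is built from the edge set `U`. -/
noncomputable def mult (G : EdgeListGraph) (U : Fin G.m → Prop) (e : Fin G.m) : ℕ :=
  open Classical in
  if U e then if ∃ f, G.Critical e f ∧ (f = e ∨ ¬ U f) then 2 else 1 else 0

/-- If `R` is a cut that causes the doubling of `g`, then the symmetric difference of `R` and `S`
exchanges `g` for `h` and causes the doubling of `h`. The case that `h` already lies in the cut of
`R` cannot occur: then `h` would be the missing edge `f`, but `h` is present. -/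
theorem mult_eq_two_of_cut {U : Fin G.m → Prop} {S : Finset (Fin G.n)} {g h : Fin G.m}
    (hgh : g ≠ h) (hS : G.cut S = {g, h}) (hh : U h) (hg : G.mult U g = 2) :
    G.mult U h = 2 := by
  have hgS : g ∈ G.cut S := by simp [hS]
  have hhS : h ∈ G.cut S := by simp [hS]
  unfold mult at hg ⊢
  rw [if_pos hh]
  split_ifs at hg with hU hex
  · refine if_pos ?_
    obtain ⟨f, ⟨R, hR, hR'⟩, hf⟩ := hex
    have hg' : g ∉ G.cut (symmDiff R S) := by rw [mem_cut_symmDiff]; tauto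
    by_cases hhR : h ∈ G.cut R
    · have hfh : h = f := (hR' h hhR).resolve_left hgh.symm
      rcases hf with hf | hf
      · exact absurd (hf.symm.trans hfh.symm) hgh
      · exact absurd (hfh ▸ hh) hf
    -- If `f = g`, then `g` is a bridge, and the new cut consists of `h` alone. Otherwise the same
    -- missing edge `f` serves for `h`.
    · refine ⟨if f = g then h else f, ⟨symmDiff R S, by rw [mem_cut_symmDiff]; tauto, ?_⟩, ?_⟩
      · intro k hk
        have hkg : k ≠ g := fun h => hg' (h ▸ hk)
        rw [mem_cut_symmDiff] at hk
        by_cases hkR : k ∈ G.cut R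
        · have hkf := (hR' k hkR).resolve_left hkg
          right
          rw [if_neg (by rw [← hkf]; exact hkg), hkf]
        · have hkS : k ∈ G.cut S := by tauto
          rw [hS] at hkS
          left
          simpa [hkg] using hkS
      · by_cases hfg : f = g
        · left; rw [if_pos hfg]
        · right; rw [if_neg hfg]; exact hf.resolve_left hfg
  · omega

theorem mult_of_cut {U : Fin G.m → Prop} {S : Finset (Fin G.n)} {g h : Fin G.m}
    (hS : G.cut S = {g, h}) (hg : U g) (hh : ¬ U h) : G.mult U g = 2 := by
  unfold mult
  rw [if_pos hg, if_pos]
  exact ⟨h, ⟨S, by simp [hS], fun k hk => by simpa [hS] using hk⟩, Or.inr hh⟩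

theorem mult_eq_zero {U : Fin G.m → Prop} {e : Fin G.m} (he : ¬ U e) : G.mult U e = 0 := by
  unfold mult; rw [if_neg he]

theorem mult_eq_one_or_two {U : Fin G.m → Prop} {e : Fin G.m} (he : U e) :
    G.mult U e = 1 ∨ G.mult U e = 2 := by
  unfold mult; rw [if_pos he]; split_ifs <;> simp

theorem mult_le_two (U : Fin G.m → Prop) (e : Fin G.m) : G.mult U e ≤ 2 := by
  unfold mult; split_ifs <;> omega

/-- If both edges of the cut are present, they are doubled together or not at all. If only one is,
the absence of the other makes it doubled. Connectivity plays no role for the parity. -/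
theorem even_mult {U : Fin G.m → Prop} {S : Finset (Fin G.n)} (hS : (G.cut S).card = 2) :
    Even (∑ e ∈ G.cut S, G.mult U e) := by
  obtain ⟨g, h, hgh, hS⟩ := card_eq_two.1 hS
  rw [hS, sum_pair hgh]
  have hS' : G.cut S = {h, g} := by rw [hS, pair_comm]
  by_cases hg : U g
  · by_cases hh : U h
    · have h1 := mult_eq_two_of_cut hgh hS hh
      have h2 := mult_eq_two_of_cut hgh.symm hS' hg
      rcases mult_eq_one_or_two hg with h3 | h3
      · rcases mult_eq_one_or_two hh with h4 | h4
        · rw [h3, h4]; decide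
        · rw [h2 h4] at h3; omega
      · rw [h3, h1 h3]; decide
    · rw [mult_of_cut hS hg hh, mult_eq_zero hh]; decide
  · by_cases hh : U h
    · rw [mult_of_cut hS' hh hg, mult_eq_zero hg]; decide
    · rw [mult_eq_zero hg, mult_eq_zero hh]; decide

theorem two_le_of_mem_cut {x : Fin G.m → ℝ} (hx : x ∈ G.subtour) {R : Finset (Fin G.n)}
    {e : Fin G.m} (he : e ∈ G.cut R) : 2 ≤ ∑ g ∈ G.cut R, x g := by
  refine hx.2 R ?_ ?_
  · by_contra hne
    rw [not_nonempty_iff_eq_empty] at hne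
    simp [mem_cut, hne] at he
  · rintro rfl
    simp [mem_cut] at he

theorem Critical.two_le_self {x : Fin G.m → ℝ} (hx : x ∈ G.subtour) {e : Fin G.m}
    (h : G.Critical e e) : 2 ≤ x e := by
  obtain ⟨R, hR, hR'⟩ := h
  have h1 := two_le_of_mem_cut hx hR
  have h2 : G.cut R = {e} := by
    ext g; rw [mem_singleton]
    exact ⟨fun hg => by simpa using hR' g hg, fun hg => hg ▸ hR⟩
  rwa [h2, sum_singleton] at h1

theorem Critical.two_le {x : Fin G.m → ℝ} (hx : x ∈ G.subtour) {e f : Fin G.m} (hef : e ≠ f)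
    (h : G.Critical e f) : 2 ≤ x e + x f := by
  obtain ⟨R, hR, hR'⟩ := h
  have h1 := two_le_of_mem_cut hx hR
  have h2 : G.cut R ⊆ {e, f} := fun g hg => by simpa using hR' g hg
  have h3 := sum_le_sum_of_subset_of_nonneg h2 fun g _ _ => hx.1 g
  rw [sum_pair hef] at h3
  linarith

/-- As `e` is no bridge, the two cuts are exactly `{e, f}` and `{e, f'}`, and their symmetric
difference is `{f, f'}`. -/
theorem Critical.trans {e f f' : Fin G.m} (he : ¬ G.Critical e e) (hff : f ≠ f')
    (h : G.Critical e f) (h' : G.Critical e f') : G.Critical f f' := by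
  have key : ∀ {f : Fin G.m} {R : Finset (Fin G.n)}, e ∈ G.cut R →
      (∀ g ∈ G.cut R, g = e ∨ g = f) → f ∈ G.cut R ∧ f ≠ e := by
    intro f R h1 h2
    by_contra hc
    refine he ⟨R, h1, fun g hg => ?_⟩
    rcases h2 g hg with h3 | h3
    · exact Or.inl h3
    · by_cases hfe : f = e
      · exact Or.inl (h3.trans hfe)
      · exact absurd ⟨h3 ▸ hg, hfe⟩ hc
  obtain ⟨R, h1, h2⟩ := h
  obtain ⟨R', h1', h2'⟩ := h'
  obtain ⟨hf, hfe⟩ := key h1 h2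
  obtain ⟨hf', hfe'⟩ := key h1' h2'
  refine ⟨symmDiff R R', ?_, fun g hg => ?_⟩
  · rw [mem_cut_symmDiff]
    have : f ∉ G.cut R' := fun hc => by
      rcases h2' f hc with h3 | h3
      · exact hfe h3
      · exact hff h3
    tauto
  · rw [mem_cut_symmDiff] at hg
    have hge : g ≠ e := by rintro rfl; tauto
    by_cases hgR : g ∈ G.cut R
    · exact Or.inl ((h2 g hgR).resolve_left hge)
    · exact Or.inr ((h2' g (by tauto)).resolve_left hge)

-- A bridge satisfies `x e ≥ 2`, which pays for two copies everywhere. Otherwise any two distinct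
-- critical edges of `e` have values summing to at least 2, so at most one of them, `f`, is below 1
-- and hence absent from some members. Then `e` is doubled only in members without `f`, of total
-- weight `1 - x f`, and `1 + (1 - x f) ≤ x e`.
open Classical in
theorem sum_mult_le {x : Fin G.m → ℝ} (hx : x ∈ G.subtour) {ℓ : ℕ} {lam : Fin ℓ → ℝ}
    {U : Fin ℓ → Fin G.m → Prop} (hpos : ∀ i, 0 < lam i) (htot : ∑ i, lam i = 1)
    (hU : ∀ e, ∑ i, lam i * (if U i e then 1 else 0) = min 1 (x e)) (e : Fin G.m) :
    ∑ i, lam i * (G.mult (U i) e : ℝ) ≤ x e := by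
  by_cases hee : G.Critical e e
  · calc ∑ i, lam i * (G.mult (U i) e : ℝ) ≤ ∑ i, lam i * 2 :=
          sum_le_sum fun i _ => mul_le_mul_of_nonneg_left (by
            exact_mod_cast mult_le_two (U i) e) (hpos i).le
      _ = 2 := by rw [← sum_mul, htot, one_mul]
      _ ≤ x e := hee.two_le_self hx
  -- An edge with value at least 1 has total weight 1 in the family, and since all multipliers are
  -- positive it belongs to every member.
  · have hlt : ∀ f i, ¬ U i f → x f < 1 := by
      intro f i hi
      by_contra hc
      have h1 : ∑ j, lam j * (if U j f then 1 else 0) < ∑ j, lam j * 1 := by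
        refine sum_lt_sum (fun j _ => mul_le_mul_of_nonneg_left ?_ (hpos j).le) ⟨i, mem_univ i, ?_⟩
        · split_ifs <;> norm_num
        · rw [if_neg hi]; have := hpos i; linarith
      rw [hU f, ← sum_mul, htot, min_eq_left (not_lt.1 hc)] at h1
      norm_num at h1
    by_cases hex : ∃ f, G.Critical e f ∧ x f < 1
    · obtain ⟨f, hf, hf1⟩ := hex
      have hfe : e ≠ f := by rintro rfl; exact hee hf
      -- If `f` is present but `e` is doubled, another critical edge `f'` is absent. Then both `x f`
      -- and `x f'` are below 1, although they sum to at least 2.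
      have hle : ∀ i, (G.mult (U i) e : ℝ) ≤
          (if U i e then 1 else 0) + (1 - if U i f then 1 else 0) := by
        intro i
        unfold mult
        by_cases h1 : U i e
        · rw [if_pos h1, if_pos h1]
          by_cases h2 : U i f
          · rw [if_neg]
            · simp [h2]
            · rintro ⟨f', hf', h3⟩
              have hfe' : f' ≠ e := by rintro rfl; exact hee hf'
              have h4 : ¬ U i f' := h3.resolve_left hfe'
              have hff : f ≠ f' := by rintro rfl; exact h4 h2
              have h5 := (hf.trans hee hff hf').two_le hx hff
              have h6 := hlt f' i h4
              linarith
          · rw [if_neg h2]; split_ifs <;> norm_num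
        · rw [if_neg h1, if_neg h1]; split_ifs <;> norm_num
      have h1 : ∑ i, lam i * (G.mult (U i) e : ℝ) ≤ min 1 (x e) + (1 - min 1 (x f)) := by
        refine (sum_le_sum fun i _ => mul_le_mul_of_nonneg_left (hle i) (hpos i).le).trans ?_
        simp only [mul_add, mul_sub, sum_add_distrib, sum_sub_distrib, hU, mul_one, htot]
        exact le_rfl
      have h2 := hf.two_le hx hfe
      rw [min_eq_right hf1.le] at h1
      have h3 := min_le_left 1 (x e)
      linarith
    -- All critical edges are present in every member, so nothing is doubled at `e`.
    · have hle : ∀ i, (G.mult (U i) e : ℝ) = if U i e then 1 else 0 := by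
        intro i
        unfold mult
        by_cases h1 : U i e
        · rw [if_pos h1, if_pos h1, if_neg]
          · norm_num
          · rintro ⟨f, hf, h3⟩
            have hfe : f ≠ e := by rintro rfl; exact hee hf
            exact hex ⟨f, hf, hlt f i (h3.resolve_left hfe)⟩
        · rw [if_neg h1, if_neg h1]; norm_num
      rw [sum_congr rfl fun i _ => by rw [hle i], hU e]
      exact min_le_right _ _

theorem eqvGen_iff {α : Type*} {R : α → α → Prop} {Q : α → Prop} (h : ∀ p q, R p q → (Q p ↔ Q q))
    {x y : α} (hxy : Relation.EqvGen R x y) : Q x ↔ Q y := by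
  induction hxy with
  | rel a b hab => exact h a b hab
  | refl a => exact Iff.rfl
  | symm a b _ ih => exact ih.symm
  | trans a b c _ _ ih1 ih2 => exact ih1.trans ih2

/-- The set of vertices reachable from one end of `e` without `e` and `f` is left by no other edges.
Conversely, membership in the set defining a cut inside `{e, f}` does not change along any other
edge. -/
theorem separates_iff {a b : ℕ → ℕ} (ha : ∀ e : Fin G.m, a e = G.fst e)
    (hb : ∀ e : Fin G.m, b e = G.snd e) (e f : Fin G.m) :
    RAM.Separates G.m a b e f ↔ G.Critical e f := by
  classical
  constructor
  · intro h
    let P : ℕ → Prop := fun v => Relation.EqvGen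
      (fun p q => ∃ g < G.m, (g ≠ (e : ℕ) ∧ g ≠ (f : ℕ)) ∧ p = a g ∧ q = b g) (a e) v
    refine ⟨univ.filter fun v => P v, ?_, fun g hg => ?_⟩
    · rw [mem_cut]
      simp only [mem_filter, mem_univ, true_and, ← ha, ← hb]
      exact fun hiff => h (hiff.1 (.refl _))
    · by_contra hc
      rw [not_or] at hc
      rw [mem_cut] at hg
      simp only [mem_filter, mem_univ, true_and, ← ha, ← hb] at hg
      refine hg ?_
      have hrel : Relation.EqvGen
          (fun p q => ∃ g < G.m, (g ≠ (e : ℕ) ∧ g ≠ (f : ℕ)) ∧ p = a g ∧ q = b g) (a g) (b g) :=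
        .rel _ _ ⟨g, g.2, ⟨fun h => hc.1 (Fin.ext h), fun h => hc.2 (Fin.ext h)⟩, rfl, rfl⟩
      exact ⟨fun h => .trans _ _ _ h hrel, fun h => .trans _ _ _ h (.symm _ _ hrel)⟩
  · rintro ⟨R, hR, hR'⟩ h
    -- Membership in `R` is transported to natural numbers, on which the program works.
    have key := eqvGen_iff (Q := fun v => ∃ y ∈ R, (y : ℕ) = v) (by
      rintro p q ⟨g, hg, hne, rfl, rfl⟩
      have hgR : (⟨g, hg⟩ : Fin G.m) ∉ G.cut R := by
        intro hc
        rcases hR' _ hc with h | h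
        · exact hne.1 (congrArg Fin.val h)
        · exact hne.2 (congrArg Fin.val h)
      rw [mem_cut, not_not] at hgR
      have e1 := ha ⟨g, hg⟩
      have e2 := hb ⟨g, hg⟩
      simp only at e1 e2
      rw [e1, e2]
      simpa [Fin.val_inj] using hgR) h
    rw [mem_cut] at hR
    rw [ha, hb] at key
    exact hR (by simpa [Fin.val_inj] using key)

theorem multiplicity_eq {a b : ℕ → ℕ} (ha : ∀ e : Fin G.m, a e = G.fst e)
    (hb : ∀ e : Fin G.m, b e = G.snd e) (U : ℕ → ℕ) (e : Fin G.m) :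
    RAM.multiplicity G.m a b U e = G.mult (fun f => U f ≠ 0) e := by
  unfold RAM.multiplicity mult
  have : (∃ f < G.m, RAM.Separates G.m a b e f ∧ (f = (e : ℕ) ∨ U f = 0)) ↔
      ∃ f : Fin G.m, G.Critical e f ∧ (f = e ∨ ¬ U f ≠ 0) := by
    constructor
    · rintro ⟨f, hf, h1, h2⟩
      exact ⟨⟨f, hf⟩, (separates_iff ha hb e ⟨f, hf⟩).1 h1, h2.imp (fun h => Fin.ext h) not_not.2⟩
    · rintro ⟨f, h1, h2⟩
      exact ⟨f, f.2, (separates_iff ha hb e f).2 h1, h2.imp (congrArg Fin.val) not_not.1⟩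
  by_cases h : U e = 0
  · rw [if_pos h, if_neg (not_not.2 h)]
  · rw [if_neg h, if_pos h]
    by_cases hex : ∃ f : Fin G.m, G.Critical e f ∧ (f = e ∨ ¬ U f ≠ 0)
    · rw [if_pos hex, if_pos (this.2 hex)]
    · rw [if_neg hex, if_neg fun h => hex (this.1 h)]

/-- Doubling does not change which edges have positive multiplicity, so connectivity is inherited
from the edge set. Loops relate a vertex to itself and contribute no adjacency. -/
theorem isConnector_mult {a b : ℕ → ℕ} (ha : ∀ e : Fin G.m, a e = G.fst e)
    (hb : ∀ e : Fin G.m, b e = G.snd e) (hn : 0 < G.n) {U : ℕ → ℕ}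
    (h : ∀ y < G.n, ∀ z < G.n, Relation.EqvGen
      (fun p q => ∃ e < G.m, U e ≠ 0 ∧ p = a e ∧ q = b e) y z) :
    G.IsConnector (G.mult fun f => U f ≠ 0) := by
  refine ⟨mult_le_two _, ?_⟩
  have : Nonempty (Fin G.n) := ⟨⟨0, hn⟩⟩
  refine ⟨fun y z => ?_⟩
  have key := eqvGen_iff (Q := fun v => ∃ u : Fin G.n, (u : ℕ) = v ∧
    (G.supportGraph (G.mult fun f => U f ≠ 0)).Reachable y u) (by
      rintro p q ⟨g, hg, hU, rfl, rfl⟩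
      have e1 := ha ⟨g, hg⟩
      have e2 := hb ⟨g, hg⟩
      simp only at e1 e2
      have hr : (G.supportGraph (G.mult fun f => U f ≠ 0)).Reachable (G.fst ⟨g, hg⟩)
          (G.snd ⟨g, hg⟩) := by
        by_cases heq : G.fst ⟨g, hg⟩ = G.snd ⟨g, hg⟩
        · rw [heq]
        · refine SimpleGraph.Adj.reachable ?_
          rw [supportGraph, SimpleGraph.fromRel_adj]
          refine ⟨heq, Or.inl ⟨⟨g, hg⟩, ?_, rfl, rfl⟩⟩
          rcases mult_eq_one_or_two (G := G) (U := fun f => U f ≠ 0) (e := ⟨g, hg⟩) hU with h | h <;>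
            omega
      rw [e1, e2]
      constructor
      · rintro ⟨u, hu, hru⟩
        obtain rfl := Fin.ext hu
        exact ⟨_, rfl, hru.trans hr⟩
      · rintro ⟨u, hu, hru⟩
        obtain rfl := Fin.ext hu
        exact ⟨_, rfl, hru.trans hr.symm⟩) (h y y.2 z z.2)
  obtain ⟨u, hu, hru⟩ := key.1 ⟨y, rfl, SimpleGraph.Reachable.refl _⟩
  obtain rfl := Fin.ext hu
  exact hru

end EdgeListGraph

/-! ### The complete program and the sizes of its numbers. -/

namespace RAM

open Finset

/-- The program that decomposes a point of the subtour polyhedron. -/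
def decompose : Stmt :=
  Stmt.pairWeights ;; Stmt.eliminateAll ;; Stmt.lift ;; Stmt.distribute ;;
    Stmt.separationTable ;; Stmt.connectorTable

/-- All claims on running time and on the lengths of numbers rest on this finite check of the
syntax. -/
theorem decompose_wf : decompose.wf := by
  decide

/-! ### The length of the numbers -/

/-- The number `r` times `2 ^ k` is, for rational `x`, an integer multiple of the common
denominator of the entries of `x`, and the absolute value of `r` is at most `2 ^ k` times the bound
for the entries of `x`. -/
def Graduated {m : ℕ} (x : Fin m → ℝ) (k : ℕ) (r : ℝ) : Prop :=
  ∀ (q : Fin m → ℚ) (b : ℕ), (∀ e, (q e : ℝ) = x e ∧ (q e).num.natAbs.size ≤ b ∧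
    (q e).den.size ≤ b) →
    (∃ z : ℤ, r * (2 ^ k * ((∏ e, (q e).den : ℕ) : ℝ)) = z) ∧ |r| ≤ 2 ^ k * 2 ^ b

/-- Sums and differences keep the common denominator and at most double the absolute value; halving
doubles the denominator. Denominators are never multiplied with each other, so they do not grow
beyond a power of 2 times the product of the input denominators. -/
theorem graded_graduated {m : ℕ} (x : Fin m → ℝ) : Graded (Graduated x) where
  mono := by
    intro k l r hkl h q b hq
    obtain ⟨⟨z, hz⟩, h2⟩ := h q b hq
    refine ⟨⟨z * 2 ^ (l - k), ?_⟩, h2.trans ?_⟩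
    · rw [Int.cast_mul, Int.cast_pow, ← hz]
      have : (2 : ℝ) ^ l = 2 ^ k * 2 ^ (l - k) := by rw [← pow_add]; congr 1; omega
      rw [this]; push_cast; ring
    · gcongr; norm_num
  add := by
    intro k r r' h h' q b hq
    obtain ⟨⟨z, hz⟩, h2⟩ := h q b hq
    obtain ⟨⟨z', hz'⟩, h2'⟩ := h' q b hq
    refine ⟨⟨2 * (z + z'), ?_⟩, (abs_add_le _ _).trans ?_⟩
    · rw [Int.cast_mul, Int.cast_add, ← hz, ← hz', pow_succ]; push_cast; ring
    · rw [pow_succ]; linarith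
  sub := by
    intro k r r' h h' q b hq
    obtain ⟨⟨z, hz⟩, h2⟩ := h q b hq
    obtain ⟨⟨z', hz'⟩, h2'⟩ := h' q b hq
    refine ⟨⟨2 * (z - z'), ?_⟩, (abs_sub _ _).trans ?_⟩
    · rw [Int.cast_mul, Int.cast_sub, ← hz, ← hz', pow_succ]; push_cast; ring
    · rw [pow_succ]; linarith
  half := by
    intro k r h q b hq
    obtain ⟨⟨z, hz⟩, h2⟩ := h q b hq
    refine ⟨⟨z, ?_⟩, ?_⟩
    · rw [← hz, pow_succ]; ring
    · rw [abs_div, abs_two, pow_succ]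
      have : (0 : ℝ) ≤ 2 ^ k * 2 ^ b := by positivity
      linarith
  nat := by
    intro k c hc q b hq
    refine ⟨⟨c * (2 ^ k * (∏ e, (q e).den : ℕ)), by push_cast; ring⟩, ?_⟩
    have h1 : (c : ℝ) ≤ 2 ^ k := by exact_mod_cast hc.le
    have h2 : (1 : ℝ) ≤ 2 ^ b := one_le_pow₀ (by norm_num)
    rw [Nat.abs_cast]
    nlinarith

theorem graduated_self {m : ℕ} (x : Fin m → ℝ) (k : ℕ) (e : Fin m) : Graduated x k (x e) := by
  intro q b hq
  obtain ⟨h1, h2, -⟩ := hq e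
  have hden : ((q e).den : ℝ) ≠ 0 := by exact_mod_cast (q e).den_ne_zero
  have hx : x e * (q e).den = (q e).num := by
    rw [← h1]; exact_mod_cast Rat.mul_den_eq_num (q e)
  refine ⟨⟨(q e).num * (2 ^ k * (∏ f ∈ univ.erase e, (q f).den : ℕ)), ?_⟩, ?_⟩
  · rw [← mul_prod_erase univ (fun f => (q f).den) (mem_univ e)]
    push_cast
    rw [← hx]; ring
  · have h3 : (q e).num.natAbs < 2 ^ b := Nat.size_le.1 h2
    have h4 : |x e| * (q e).den = (q e).num.natAbs := by
      rw [← Nat.abs_cast (q e).den, ← abs_mul, hx, Nat.cast_natAbs, Int.cast_abs]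
    have h5 : (1 : ℝ) ≤ (q e).den := by exact_mod_cast (q e).den_pos
    have h6 : ((q e).num.natAbs : ℝ) ≤ 2 ^ b := by exact_mod_cast h3.le
    have h7 : (1 : ℝ) ≤ 2 ^ k := one_le_pow₀ (by norm_num)
    have h8 : |x e| ≤ |x e| * (q e).den := le_mul_of_one_le_right (abs_nonneg _) h5
    have h9 : (0 : ℝ) ≤ 2 ^ b := by positivity
    nlinarith

/-- The denominator in lowest terms divides `2 ^ k` times the product of the `m` input denominators,
so it is at most `2 ^ (k + b * m)`. The numerator is the denominator times a number of absolute
value at most `2 ^ (k + b)`. -/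
theorem Graduated.hasBitSize {m : ℕ} {x : Fin m → ℝ} {k : ℕ} {r : ℝ} (h : Graduated x k r) {b : ℕ}
    (hb : ∀ e, HasBitSize (x e) b) {B : ℕ} (hB : 2 * k + b + b * m + 1 ≤ B) : HasBitSize r B := by
  choose q hq using hb
  obtain ⟨⟨z, hz⟩, h2⟩ := h q b hq
  obtain ⟨N, hN⟩ : ∃ N : ℕ, N = 2 ^ k * ∏ e, (q e).den := ⟨_, rfl⟩
  have hN0 : 0 < N := by
    rw [hN]; exact Nat.mul_pos (by positivity) (prod_pos fun e _ => (q e).den_pos)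
  have hNle : N ≤ 2 ^ (k + b * m) := by
    rw [hN, pow_add]
    refine Nat.mul_le_mul_left _ ?_
    calc ∏ e, (q e).den ≤ ∏ _e : Fin m, 2 ^ b :=
          prod_le_prod' fun e _ => (Nat.size_le.1 (hq e).2.2).le
      _ = 2 ^ (b * m) := by rw [prod_const, card_univ, Fintype.card_fin, pow_mul]
  have hzN : r * N = z := by rw [← hz, hN]; push_cast; ring
  have hN0' : (N : ℝ) ≠ 0 := by exact_mod_cast hN0.ne'
  obtain ⟨p, hp⟩ : ∃ p : ℚ, p = Rat.divInt z N := ⟨_, rfl⟩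
  have hpr : (p : ℝ) = r := by
    rw [hp, Rat.divInt_eq_div]
    push_cast
    rw [← hzN]; field_simp
  have hdvd : (p.den : ℤ) ∣ (N : ℤ) := by rw [hp]; exact Rat.den_dvd z N
  have hden : p.den ≤ N := Nat.le_of_dvd hN0 (by exact_mod_cast hdvd)
  have hden' : p.den < 2 ^ (k + b * m + 1) :=
    (hden.trans hNle).trans_lt (Nat.pow_lt_pow_right (by norm_num) (by omega))
  have hnum : p.num.natAbs < 2 ^ (2 * k + b + b * m + 1) := by
    have e1 : (p.num.natAbs : ℝ) = |r| * p.den := by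
      rw [← hpr, ← Nat.abs_cast p.den, ← abs_mul, Nat.cast_natAbs, Int.cast_abs]
      congr 1
      exact_mod_cast (Rat.mul_den_eq_num p).symm
    have e2 : |r| * p.den ≤ (2 ^ k * 2 ^ b) * 2 ^ (k + b * m) := by
      have : (p.den : ℝ) ≤ 2 ^ (k + b * m) := by exact_mod_cast hden.trans hNle
      exact mul_le_mul h2 this (by positivity) (by positivity)
    have e3 : (p.num.natAbs : ℝ) ≤ ((2 ^ (2 * k + b + b * m) : ℕ) : ℝ) := by
      rw [e1]
      refine e2.trans (le_of_eq ?_)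
      push_cast
      rw [← pow_add, ← pow_add]; congr 1; ring
    have e4 : p.num.natAbs ≤ 2 ^ (2 * k + b + b * m) := by exact_mod_cast e3
    exact e4.trans_lt (Nat.pow_lt_pow_right (by norm_num) (by omega))
  exact ⟨p, hpr, (Nat.size_le.2 hnum).trans hB, (Nat.size_le.2 hden').trans (by omega)⟩

theorem eval_mono (p : Polynomial ℕ) {a b : ℕ} (hab : a ≤ b) : p.eval a ≤ p.eval b := by
  induction p using Polynomial.induction_on' with
  | add p q hp hq => simpa using add_le_add hp hq
  | monomial n c =>
    simp only [Polynomial.eval_monomial]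
    exact Nat.mul_le_mul_left _ (Nat.pow_le_pow_left hab n)

end RAM

/-! ### From the input to the output of the program. -/

namespace EdgeListGraph

open RAM Finset WCut

variable {G : EdgeListGraph}

theorem input_fst (x : Fin G.m → ℝ) (e : Fin G.m) : (G.input x).ints 1 e = G.fst e := by
  simp [input]

theorem input_snd (x : Fin G.m → ℝ) (e : Fin G.m) : (G.input x).ints 2 e = G.snd e := by
  simp [input]

theorem input_reals (x : Fin G.m → ℝ) (e : Fin G.m) : (G.input x).reals 0 e = x e := by
  simp [input]

/-- The cut values of the matrix are those of the graph, loops contributing nothing on either side,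
so the cut condition of the polyhedron carries over. -/
theorem full_of_subtour {x : Fin G.m → ℝ} (hx : x ∈ G.subtour) {W : ℕ → ℕ → ℝ}
    (hW : ∀ S, WCut.cut W (range G.n) S = ∑ e ∈ range G.m,
      sep S ((G.input x).ints 1 e) ((G.input x).ints 2 e) * (G.input x).reals 0 e) :
    Full G.n W := by
  intro S hS hne hS'
  rw [hW, sum_range fun e => sep S ((G.input x).ints 1 e) ((G.input x).ints 2 e) *
    (G.input x).reals 0 e]
  obtain ⟨v, hv⟩ := hne
  have h1 := hx.2 (univ.filter fun v => (v : ℕ) ∈ S)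
    ⟨⟨v, mem_range.1 (hS hv)⟩, by simpa using hv⟩ (by
      intro h
      refine hS' (subset_antisymm hS fun w hw => ?_)
      have : (⟨w, mem_range.1 hw⟩ : Fin G.n) ∈ univ.filter fun v : Fin G.n => (v : ℕ) ∈ S := by
        rw [h]; exact mem_univ _
      simpa using this)
  refine h1.trans (le_of_eq ?_)
  rw [EdgeListGraph.cut, sum_filter]
  refine sum_congr rfl fun e _ => ?_
  rw [input_fst, input_snd, input_reals]
  simp only [mem_filter, mem_univ, true_and, sep]
  by_cases h : (G.fst e : ℕ) ∈ S ↔ (G.snd e : ℕ) ∈ S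
  · simp [h]
  · rw [if_pos h, if_neg h, one_mul]

/-- The memory after the run of the program. -/
theorem decompose_spec {x : Fin G.m → ℝ} (hn : 0 < G.n) (hx : x ∈ G.subtour) :
    ∃ (ℓ : ℕ) (U : Fin ℓ → ℕ → ℕ) (lam : Fin ℓ → ℝ),
      G.IsOutput (decompose.run (G.input x)) ℓ (fun i => G.mult fun f => U i f ≠ 0) lam ∧
      (∀ i, G.IsConnector (G.mult fun f => U i f ≠ 0)) ∧ (∀ i, 0 < lam i) ∧ ∑ i, lam i = 1 ∧
      ∀ e : Fin G.m, ∑ i, lam i * (if U i e ≠ 0 then 1 else 0) = min 1 (x e) := by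
  obtain ⟨s0, hs0⟩ : ∃ s0, s0 = G.input x := ⟨_, rfl⟩
  obtain ⟨n, hnd⟩ : ∃ n, n = G.n := ⟨_, rfl⟩
  obtain ⟨m, hmd⟩ : ∃ m, m = G.m := ⟨_, rfl⟩
  have n0 : s0.ints 0 0 = n := by rw [hs0, hnd]; simp [input]
  have m0 : s0.ints 0 1 = m := by rw [hs0, hmd]; simp [input]
  have afst : ∀ e : Fin G.m, s0.ints 1 e = G.fst e := by rw [hs0]; exact input_fst x
  have bsnd : ∀ e : Fin G.m, s0.ints 2 e = G.snd e := by rw [hs0]; exact input_snd x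
  have ha : ∀ e < m, s0.ints 1 e < n := by
    intro e he
    rw [hmd] at he
    have := afst ⟨e, he⟩
    simp only at this
    rw [this, hnd]; exact (G.fst _).2
  have hb : ∀ e < m, s0.ints 2 e < n := by
    intro e he
    rw [hmd] at he
    have := bsnd ⟨e, he⟩
    simp only at this
    rw [this, hnd]; exact (G.snd _).2
  have hx0 : ∀ e < m, 0 ≤ s0.reals 0 e := by
    intro e he
    rw [hmd] at he
    have := input_reals x ⟨e, he⟩
    simp only at this
    rw [hs0, this]; exact hx.1 _
  have hz : ∀ a, a ∉ [0, 1, 2] → ∀ i, s0.ints a i = 0 := by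
    intro a ha i
    simp only [List.mem_cons, List.not_mem_nil, or_false, not_or] at ha
    rw [hs0]; simp [input, ha]
  have hM0 : mat n 2 s0 = fun _ _ => 0 := by
    funext u w; simp [mat, hs0, input]
  obtain ⟨s1, hs1⟩ : ∃ s1, s1 = Stmt.pairWeights.run s0 := ⟨_, rfl⟩
  obtain ⟨w1, w2⟩ := Stmt.pairWeights_spec m0 ha hb hM0
  rw [← hs1] at w1 w2
  have i1 : ∀ c, c ≠ 56 → c ≠ 99 → s1.ints c = s0.ints c := by
    intro c h1 h2
    rw [hs1]
    exact Stmt.run_ints _ (by simp [Stmt.pairWeights, Stmt.writesInt, Stmt.when, Stmt.skip,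
      Stmt.assign, Stmt.incrEdge, Stmt.setEntry]; omega) _
  have r1 : s1.reals 0 = s0.reals 0 := by rw [hs1]; exact Stmt.run_reals _ (by decide) _
  obtain ⟨s2, hs2⟩ : ∃ s2, s2 = Stmt.eliminateAll.run s1 := ⟨_, rfl⟩
  have hL := Stmt.eliminateAll_spec (s := s1) (n := n) (by rw [i1 0 (by norm_num) (by norm_num), n0])
    (by omega)
    (by
      intro u w
      rw [w1, w1]
      refine sum_congr rfl fun e _ => ?_
      congr 1
      apply propext; unfold Joins; tauto)
    (by
      intro u w
      rw [w1]
      refine sum_nonneg fun e he => ?_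
      split_ifs
      · exact hx0 e (mem_range.1 he)
      · exact le_rfl)
    (by
      rw [hs0, hnd, hmd] at w2
      have := full_of_subtour hx w2
      rwa [← hnd] at this)
  rw [← hs2] at hL
  have i2 : ∀ c ∈ [0, 1, 2, 5, 6, 8], s2.ints c = s0.ints c := by
    intro c hc
    simp only [List.mem_cons, List.not_mem_nil, or_false] at hc
    rw [← i1 c (by omega) (by omega), hs2]
    rcases hc with rfl | rfl | rfl | rfl | rfl | rfl <;> exact Stmt.run_ints _ (by decide) _
  have r2 : s2.reals 0 = s0.reals 0 := by rw [← r1, hs2]; exact Stmt.run_reals _ (by decide) _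
  obtain ⟨s3, hs3⟩ : ∃ s3, s3 = Stmt.lift.run s2 := ⟨_, rfl⟩
  have hlift := Stmt.lift_spec (s := s2) (n := n) (m := m) (by rw [i2 0 (by decide), n0])
    (by rw [i2 0 (by decide), m0]) (by omega)
    (by rw [i2 5 (by decide)]; exact hz 5 (by decide))
    (by rw [i2 6 (by decide)]; exact hz 6 (by decide))
    (by rw [i2 8 (by decide)]; exact hz 8 (by decide)) hL
  rw [← hs3] at hlift
  have i3 : ∀ c ∈ [0, 1, 2], s3.ints c = s0.ints c := by
    intro c hc
    simp only [List.mem_cons, List.not_mem_nil, or_false] at hc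
    rw [← i2 c (by simp; omega), hs3]
    rcases hc with rfl | rfl | rfl <;> exact Stmt.run_ints _ (by decide) _
  have r3 : s3.reals 0 = s0.reals 0 := by rw [← r2, hs3]; exact Stmt.run_reals _ (by decide) _
  obtain ⟨s4, hs4⟩ : ∃ s4, s4 = Stmt.distribute.run s3 := ⟨_, rfl⟩
  -- One initial member, at most `n * n + n` new ones for each of the `n - 1` levels, and at most
  -- two for each edge.
  have hB : ∀ t : State, t.ints 0 = s0.ints 0 →
      1 + (n - 1) * (n * n + n) + 2 * m ≤ Stmt.familyBound.eval t := by
    intro t ht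
    have e : Stmt.familyBound.eval t = n * (n * n + n) + 2 * m + 1 := by
      simp [Stmt.familyBound, IntExpr.eval, ht, n0, m0]
    have := Nat.mul_le_mul_right (n * n + n) (Nat.sub_le n 1)
    omega
  have hedge := Stmt.distribute_spec (s := s3) (n := n) (m := m)
    (ℓ := 1 + (n - 1) * (n * n + n)) (by rw [i3 0 (by decide), n0])
    (by rw [i3 0 (by decide), m0]) (by rw [i3 1 (by decide)]; exact ha)
    (by rw [i3 2 (by decide)]; exact hb) (by rw [r3]; exact hx0) (hB _ (i3 0 (by decide)))
    (hlift.edgePhase (by omega) (by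
      intro u w _
      rw [w1, i3 1 (by decide), i3 2 (by decide), r3]))
  rw [← hs4, i3 1 (by decide), i3 2 (by decide), r3] at hedge
  have i4 : ∀ c ∈ [0, 1, 2], s4.ints c = s0.ints c := by
    intro c hc
    simp only [List.mem_cons, List.not_mem_nil, or_false] at hc
    rw [← i3 c (by simp; omega), hs4]
    rcases hc with rfl | rfl | rfl <;> exact Stmt.run_ints _ (by decide) _
  obtain ⟨s5, hs5⟩ : ∃ s5, s5 = Stmt.separationTable.run s4 := ⟨_, rfl⟩
  have hsep := fun e f (he : e < m) (hf : f < m) =>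
    Stmt.separationTable_spec (s := s4) (n := n) (m := m) (e := e) (f := f)
    (by rw [i4 0 (by decide), n0]) (by rw [i4 0 (by decide), m0])
    (by rw [i4 1 (by decide)]; exact ha) (by rw [i4 2 (by decide)]; exact hb) he hf
  rw [← hs5, i4 1 (by decide), i4 2 (by decide)] at hsep
  have i5 : ∀ c ∈ [0, 3, 6], s5.ints c = s4.ints c := by
    intro c hc
    simp only [List.mem_cons, List.not_mem_nil, or_false] at hc
    rw [hs5]
    rcases hc with rfl | rfl | rfl <;> exact Stmt.run_ints _ (by decide) _
  obtain ⟨s6, hs6⟩ : ∃ s6, s6 = Stmt.connectorTable.run s5 := ⟨_, rfl⟩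
  have h50 : s5.ints 0 = s0.ints 0 := by rw [i5 0 (by decide), i4 0 (by decide)]
  have hrun : decompose.run (G.input x) = s6 := by
    rw [← hs0]
    simp only [decompose, Stmt.run_seq, ← hs1, ← hs2, ← hs3, ← hs4, ← hs5, ← hs6]
  have hr6 : s6.reals 1 = s4.reals 1 := by
    rw [hs6, Stmt.run_reals _ (by decide), hs5, Stmt.run_reals _ (by decide)]
  have h63 : s6.ints 3 = s4.ints 3 := by
    rw [hs6, Stmt.run_ints _ (by decide), i5 3 (by decide)]
  rw [hrun]
  refine ⟨s4.ints 3 0, fun i => (member n m s4 i).U, fun i => s4.reals 1 i, ⟨by rw [h63],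
    fun i e => ?_, fun i => by rw [hr6]⟩, fun i => ?_, fun i => hedge.fam.pos i i.2, ?_, fun e => ?_⟩
  · have key := Stmt.connectorTable_spec (s := s5) (m := m) (a := s0.ints 1) (b := s0.ints 2)
      (by rw [h50, m0]) (fun e he f hf => hsep e f he hf) (i := i) (e := e)
      (by
        have h1 := hB s5 h50
        have h2 := hedge.size
        have h3 := i.2
        omega) (by rw [hmd]; exact e.2)
    rw [← hs6, hmd] at key
    rw [key, multiplicity_eq afst bsnd, i5 6 (by decide)]
    simp only [member, hmd]
  · refine isConnector_mult afst bsnd hn fun y hy z hz => ?_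
    rw [← hmd]
    exact hedge.connected i.2 (by omega) (by omega)
  · have := hedge.total
    rw [famSum, sum_range] at this
    simpa using this
  · have := hedge.edge e (by rw [hmd]; exact e.2)
    rw [famSum, sum_range, if_pos (by rw [hmd]; exact e.2), hs0, input_reals] at this
    exact this

end EdgeListGraph

/-! ### The theorem. -/

theorem theorem4p4 :
    ∃ (P : RAM.Program) (p : Polynomial ℕ), ∀ (G : EdgeListGraph) (x : Fin G.m → ℝ),
      0 < G.n → x ∈ G.subtour →
      ∃ (s : RAM.State) (t : ℕ),
        RAM.Exec (p.eval (G.n + G.m))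
          (fun r => ∀ b : ℕ, (∀ e, HasBitSize (x e) b) →
            HasBitSize r (p.eval (G.n + G.m + b)))
          P (G.input x) s t ∧
        t ≤ p.eval (G.n + G.m) ∧
        ∃ (ℓ : ℕ) (F : Fin ℓ → Fin G.m → ℕ) (lam : Fin ℓ → ℝ),
          G.IsOutput s ℓ F lam ∧
          (∀ i, G.IsConnector (F i)) ∧
          (∀ i, 0 < lam i) ∧
          ∑ i, lam i = 1 ∧
          (∀ e, ∑ i, lam i * (F i e : ℝ) ≤ x e) ∧
          (∀ i (S : Finset (Fin G.n)), (G.cut S).card = 2 → Even (∑ e ∈ G.cut S, F i e)) := by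
  obtain ⟨c, hc⟩ : ∃ c, c = RAM.decompose.costPoly := ⟨_, rfl⟩
  refine ⟨RAM.decompose.compile,
    -- The input has grade `n + m`, so `X + 4 * c` bounds the final grade `k`. The remaining terms
    -- make up the digit bound `2 * k + b + b * m + 1`, with `X` standing for `n + m + b`, so that
    -- `X * X` covers `b * m`.
    2 * (Polynomial.X + 4 * c) + Polynomial.X + Polynomial.X * Polynomial.X + 1,
    fun G x hn hx => ?_⟩
  have hin : ∀ a i, (G.input x).ints a i ≤ G.n + G.m := by
    intro a i
    unfold EdgeListGraph.input
    simp only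
    split_ifs <;> omega
  -- All integers of the input are at most `n + m`, hence below `2 ^ (n + m)`. This is the initial
  -- grade, and the entries of `x` have every grade.
  obtain ⟨t, ht, hexec, -⟩ := RAM.Stmt.exec_compile (RAM.graded_graduated x) (n := G.n + G.m) RAM.decompose
    RAM.decompose_wf (G.input x) (G.n + G.m) (hin 0) (fun a i => (hin a i).trans_lt Nat.lt_two_pow_self)
    (fun a i => by
      unfold EdgeListGraph.input
      simp only
      split_ifs
      · exact RAM.graduated_self x _ _
      · simpa using (RAM.graded_graduated x).nat (k := G.n + G.m) (c := 0) (by positivity)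
      · simpa using (RAM.graded_graduated x).nat (k := G.n + G.m) (c := 0) (by positivity))
  rw [← hc] at ht
  obtain ⟨ℓ, U, lam, hout, hcon, hpos, htot, hU⟩ := EdgeListGraph.decompose_spec hn hx
  refine ⟨RAM.decompose.run (G.input x), t, hexec _ _ ?_ fun r hr b hb => ?_, ?_, ℓ, _, lam, hout, hcon,
    hpos, htot, fun e => EdgeListGraph.sum_mult_le hx hpos htot (fun e => ?_) e, fun i S hS => EdgeListGraph.even_mult hS⟩
  · simp only [Polynomial.eval_add, Polynomial.eval_mul, Polynomial.eval_X, Polynomial.eval_one,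
      Polynomial.eval_ofNat]
    nlinarith
  · refine hr.hasBitSize hb ?_
    have h1 := RAM.eval_mono c (Nat.le_add_right (G.n + G.m) b)
    simp only [Polynomial.eval_add, Polynomial.eval_mul, Polynomial.eval_X, Polynomial.eval_one,
      Polynomial.eval_ofNat]
    have h2 : b * G.m ≤ (G.n + G.m + b) * (G.n + G.m + b) :=
      Nat.mul_le_mul (by omega) (by omega)
    omega
  · simp only [Polynomial.eval_add, Polynomial.eval_mul, Polynomial.eval_X, Polynomial.eval_one,
      Polynomial.eval_ofNat]
    nlinarith
  · rw [← hU e]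
    refine Finset.sum_congr rfl fun i _ => ?_
    congr 1
    split_ifs <;> rfl
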